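/- Work over $\mathbb{C}$. Let $Y=\{F=0\}\subset\mathbb{P}^5$ be a smooth cubic fourfold containing the plane $A=\{x_0=x_1=x_2=0\}$, and write $$F=\sum_{i,j=0}^{2} l_{ij}\,y_iy_j+2\sum_{k=0}^{2}q_k\,y_k+f,\qquad M=\begin{pmatrix} l_{ij} & q_k\\ q_k & f\end{pmatrix},$$ where $l_{ij}=l_{ji}$, $q_k$, $f$ are forms in $x_0,x_1,x_2$ of degrees $1,2,3$ respectively. Let $C=\{\det M=0\}\subset\mathbb{P}^2(x_0:x_1:x_2)$ be the associated sextic curve. Let $\mathscr{T}$ be the linear system of all symmetric matrices of forms in $x_0,\dots,x_3$ $$\bar M=\begin{pmatrix} l_{ij} & q_k\\ q_k & f\end{pmatrix}+x_3\begin{pmatrix}\bar l_{ij} & \bar q_k\\ \bar q_k & \bar f\end{pmatrix},$$ where $\bar l_{ij}=\bar l_{ji}$, $\bar q_k$, $\bar f$ are arbitrary forms in $x_0,\dots,x_3$ of degrees $0,1,2$ respectively. Its members are sections of $S^2\mathscr{E}^*\otimes\mathscr{O}_{\mathbb{P}^3}(1)$, i.e. symmetric morphisms $\phi:\mathscr{E}\to\mathscr{E}^*(1)$,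 where $\mathscr{E}=3\mathscr{O}_{\mathbb{P}^3}\oplus\mathscr{O}_{\mathbb{P}^3}(-1)$. Put $\bar C=\{\det\bar M=0\}\subset\mathbb{P}^3$ and $D_2=\{x\in\mathbb{P}^3:\operatorname{rk}\bar M(x)\le 2\}$. Then for a generic member of $\mathscr{T}$ (that is, for all $(\bar l_{ij},\bar q_k,\bar f)$ in a nonempty Zariski open subset of the parameter space): 1. the cubic $\bar Y=\{F+x_3(\sum\bar l_{ij}y_iy_j+2\sum\bar q_ky_k+\bar f)=0\}\subset\mathbb{P}^6$ is a smooth cubic fivefold; 2. $D_2$ has codimension $3$ in $\mathbb{P}^3$ (in particular it is not empty); 3. $D_2$ is finite, and each of its points is an ordinary double point of the sextic surface $\bar C$; 4. the embedding $\mathbb{P}^2=\{x_3=0\}\subset\mathbb{P}^3$ restricts to a bijection from the set of nodes (ordinary double points) of $C$ onto $D_2\cap\{x_3=0\}$. -/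

import Mathlib

open MvPolynomial LinearAlgebra.Projectivization

noncomputable section

namespace CubicPlane

/-- The twist attached to a summand of the rank four bundle `E = 3 𝒪 ⊕ 𝒪(-1)`: it is `0` for the
three trivial summands and `1` for the summand `𝒪(-1)`. -/
def twist : Fin 3 ⊕ Unit → ℕ
  | Sum.inl _ => 0
  | Sum.inr _ => 1

/-- Symmetric `4 × 4` matrices, in block form `(l_ij, q_k; q_k, f)`, whose entries are forms in `m`
variables with `deg l_ij = d`, `deg q_k = d + 1` and `deg f = d + 2`. These are the global sections
of `S² E^* ⊗ 𝒪(d)` on the projective space of dimension `m - 1`, for `E = 3 𝒪 ⊕ 𝒪(-1)`, that is,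
the symmetric morphisms `E → E^*(d)`. -/
def symForms (m d : ℕ) :
    Submodule ℂ (Matrix (Fin 3 ⊕ Unit) (Fin 3 ⊕ Unit) (MvPolynomial (Fin m) ℂ)) where
  carrier := {M | M.IsSymm ∧ ∀ i j, (M i j).IsHomogeneous (d + twist i + twist j)}
  add_mem' := fun hM hN => ⟨hM.1.add hN.1, fun i j => (hM.2 i j).add (hN.2 i j)⟩
  zero_mem' := ⟨Matrix.isSymm_zero, fun _ _ => isHomogeneous_zero _ _ _⟩
  smul_mem' := fun c _ hM => ⟨hM.1.smul c, fun i j =>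
    (homogeneousSubmodule (Fin m) ℂ (d + twist i + twist j)).smul_mem c (hM.2 i j)⟩

/-- The form `∑ l_ij y_i y_j + 2 ∑ q_k y_k + f` in the variables `x` (left summand) and `y`
(right summand) that is attached to the matrix `(l_ij, q_k; q_k, f)` of forms in `x`. -/
def cubicForm {m : ℕ} (M : Matrix (Fin 3 ⊕ Unit) (Fin 3 ⊕ Unit) (MvPolynomial (Fin m) ℂ)) :
    MvPolynomial (Fin m ⊕ Fin 3) ℂ :=
  (∑ i : Fin 3, ∑ j : Fin 3,
      rename Sum.inl (M (Sum.inl i) (Sum.inl j)) * X (Sum.inr i) * X (Sum.inr j))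
    + 2 * (∑ k : Fin 3, rename Sum.inl (M (Sum.inl k) (Sum.inr ())) * X (Sum.inr k))
    + rename Sum.inl (M (Sum.inr ()) (Sum.inr ()))

/-- The projective hypersurface `{G = 0}` of a form `G` is smooth: at no point of it do all partial
derivatives of `G` vanish. -/
def IsSmoothHypersurface {σ : Type*} (G : MvPolynomial σ ℂ) : Prop :=
  ∀ v : σ → ℂ, v ≠ 0 → eval v G = 0 → ∃ i, eval v (pderiv i G) ≠ 0

/-- The point `p` is an ordinary double point (a node) of the hypersurface `{G = 0}` in projective
`n`-space, for a form `G`: the form and its first derivatives vanish at `p`, and the Hessian of `G`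
has rank `n` there. By Euler's relation a representative of `p` lies in the kernel of the Hessian,
so rank `n` says that the Hessian induces a nondegenerate quadratic form on the tangent space of
projective space at `p`. -/
def IsOrdinaryDoublePoint {n : ℕ} (G : MvPolynomial (Fin (n + 1)) ℂ)
    (p : ℙ ℂ (Fin (n + 1) → ℂ)) : Prop :=
  eval p.rep G = 0 ∧ (∀ i, eval p.rep (pderiv i G) = 0) ∧
    (Matrix.of fun i j => eval p.rep (pderiv i (pderiv j G))).rank = n

/-- The degeneracy locus `D_k`: the points at which the matrix has rank at most `k`. For a matrix in
`symForms (n + 1) d` the rank does not depend on the representative of the point. -/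
def degeneracyLocus {n : ℕ} (k : ℕ)
    (M : Matrix (Fin 3 ⊕ Unit) (Fin 3 ⊕ Unit) (MvPolynomial (Fin (n + 1)) ℂ)) :
    Set (ℙ ℂ (Fin (n + 1) → ℂ)) :=
  {p | (M.map (eval p.rep)).rank ≤ k}

/-- The codimension of a closed subset `Z` of projective `n`-space: the height of the ideal of the
polynomials that vanish on the cone over `Z`. It is `⊤` for the empty set. -/
def codim {n : ℕ} (Z : Set (ℙ ℂ (Fin (n + 1) → ℂ))) : ℕ∞ :=
  (vanishingIdeal ℂ {v : Fin (n + 1) → ℂ | ∃ h : v ≠ 0, Projectivization.mk ℂ v h ∈ Z}).height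

/-- The property `p` holds for a generic vector of the complex vector space `V`: it holds on a
nonempty subset of the form `{P ≠ 0}`, where `P` is a polynomial function on `V`, that is, a
polynomial in linear functionals on `V`. -/
def HoldsGenerically {V : Type*} [AddCommGroup V] [Module ℂ V] (p : V → Prop) : Prop :=
  ∃ P : MvPolynomial (Module.Dual ℂ V) ℂ,
    (∃ v : V, eval (fun φ : Module.Dual ℂ V => φ v) P ≠ 0) ∧
      ∀ v : V, eval (fun φ : Module.Dual ℂ V => φ v) P ≠ 0 → p v

/-- The member `M + x₃ N` of the linear system of extensions of the matrix `M` of forms in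
`x₀, x₁, x₂`. -/
def extend (M : Matrix (Fin 3 ⊕ Unit) (Fin 3 ⊕ Unit) (MvPolynomial (Fin 3) ℂ))
    (N : Matrix (Fin 3 ⊕ Unit) (Fin 3 ⊕ Unit) (MvPolynomial (Fin 4) ℂ)) :
    Matrix (Fin 3 ⊕ Unit) (Fin 3 ⊕ Unit) (MvPolynomial (Fin 4) ℂ) :=
  M.map (rename Fin.castSucc) + (X 3 : MvPolynomial (Fin 4) ℂ) • N

/-- The linear embedding `(x₀, x₁, x₂) ↦ (x₀, x₁, x₂, 0)`. -/
def planeLin : (Fin 3 → ℂ) →ₗ[ℂ] (Fin 4 → ℂ) where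
  toFun x := ![x 0, x 1, x 2, 0]
  map_add' x y := by ext i; fin_cases i <;> simp
  map_smul' c x := by ext i; fin_cases i <;> simp

theorem planeLin_injective : Function.Injective planeLin := by
  intro x y h
  ext i
  fin_cases i
  · exact congrFun h 0
  · exact congrFun h 1
  · exact congrFun h 2

/-- The embedding of the projective plane as the hyperplane `{x₃ = 0}` of projective `3`-space. -/
def planeEmb : ℙ ℂ (Fin 3 → ℂ) → ℙ ℂ (Fin 4 → ℂ) :=
  Projectivization.map planeLin planeLin_injective

/-- The hyperplane `{x₃ = 0}` of projective `3`-space. -/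
def hyperplane : Set (ℙ ℂ (Fin 4 → ℂ)) := {p | p.rep 3 = 0}

end CubicPlane

end

open MvPolynomial LinearAlgebra.Projectivization

noncomputable section

namespace CubicPlane

/-! The cubic attached to a symmetric matrix A of forms is kᵀA(x)k at k = (y, 1). Its y-derivatives
are twice the first three entries of A(x)k, and its x-derivatives are the numbers kᵀ(∂ᵢA)k; kernel
vectors of the form (a, 0) correspond to points of the plane x = 0. Smoothness of the cubic
therefore forbids a nonzero k in ker A(v), v ≠ 0, at which all the quadratic forms kᵀ(∂ᵢA(v))k
vanish (`exists_derivForm_ne_zero`).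

At corank one the gradient of det A is a nonzero multiple of (kᵀ(∂ᵢA)k)ᵢ, so every singular point of
the discriminant has rank at most two. At corank two, let k₁, k₂ span the kernel and let α, β, γ be
the linear forms given by k₁ᵀ(∂A)k₁, k₂ᵀ(∂A)k₂, k₁ᵀ(∂A)k₂. Then det A starts with a nonzero multiple
of αβ − γ², and smoothness makes the kernel of the Hessian the common zero space of α, β, γ
(`det_singular_of_rank_two`). Euler's relation puts v in that space, so v is a node as soon as
nothing but its multiples lies there. In three variables this is automatic: the nodes of C are
exactly the points of rank at most two (`isNodeAt_det_iff`), which gives the bijection for every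
extension.

In four variables α, β, γ have to be linearly independent, and genericity enters. Off x₃ = 0 it is a
dimension count: the bad extensions lie in the image of a polynomial map from a vector space of
smaller dimension (`IsPolyMap.holdsGenerically_notMem_range`). On x₃ = 0 only finitely many points
have rank at most two, and there ∂₃ of the extension is N itself, so each of them imposes the
nonvanishing of one nonzero linear functional of N. Smoothness of the fivefold is inherited from Y
on x₃ = 0 and is another dimension count off it.

D₂ is finite because nodes are isolated. It is nonempty because pairs (x, symmetric matrix of rank
at most two) form a variety of dimension 4 + 7 = 11, on which the ten equations "matrix = A(x)" have
a solution besides the origin (`exists_rank_le_two`). A finite nonempty set of points in projective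
3-space has codimension 3. -/

theorem eval_aeval_eq {σ τ : Type*} (x : τ → ℂ) (G : σ → MvPolynomial τ ℂ) (P : MvPolynomial σ ℂ) :
    eval x (aeval G P) = eval (fun i => eval x (G i)) P := by
  induction P using MvPolynomial.induction_on with
  | C c => simp
  | add p q hp hq => simp only [map_add, hp, hq]
  | mul_X p i hp => simp only [map_mul, hp, aeval_X, eval_X]

/-! ### Polynomial maps between complex vector spaces -/

section PolyMap

variable {U V W : Type*} [AddCommGroup U] [Module ℂ U] [AddCommGroup V] [Module ℂ V]
  [AddCommGroup W] [Module ℂ W]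

/-- The map `g` is polynomial: its composite with each linear functional is a polynomial in linear
functionals. -/
@[fun_prop]
def IsPolyMap (g : W → V) : Prop :=
  ∀ φ : Module.Dual ℂ V, ∃ P : MvPolynomial (Module.Dual ℂ W) ℂ,
    ∀ w, eval (fun ψ : Module.Dual ℂ W => ψ w) P = φ (g w)

theorem IsPolyMap.exists_eval_eq {g : W → V} (hg : IsPolyMap g)
    (P : MvPolynomial (Module.Dual ℂ V) ℂ) : ∃ Q : MvPolynomial (Module.Dual ℂ W) ℂ,
      ∀ w, eval (fun ψ : Module.Dual ℂ W => ψ w) Q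
        = eval (fun φ : Module.Dual ℂ V => φ (g w)) P := by
  choose G hG using hg
  exact ⟨aeval G P, fun w => by simp only [eval_aeval_eq, hG]⟩

theorem LinearMap.isPolyMap (g : W →ₗ[ℂ] V) : IsPolyMap g :=
  fun φ => ⟨X (φ ∘ₗ g), fun w => by simp⟩

@[fun_prop]
theorem isPolyMap_id : IsPolyMap (fun w : W => w) := LinearMap.isPolyMap LinearMap.id

@[fun_prop]
theorem isPolyMap_const (v : V) : IsPolyMap (fun _ : W => v) :=
  fun φ => ⟨C (φ v), fun w => by simp⟩

@[fun_prop]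
theorem IsPolyMap.comp {f : V → U} {g : W → V} (hf : IsPolyMap f) (hg : IsPolyMap g) :
    IsPolyMap (fun w => f (g w)) := by
  intro φ
  obtain ⟨P, hP⟩ := hf φ
  obtain ⟨Q, hQ⟩ := hg.exists_eval_eq P
  exact ⟨Q, fun w => by rw [hQ, hP]⟩

@[fun_prop]
theorem IsPolyMap.add {f g : W → V} (hf : IsPolyMap f) (hg : IsPolyMap g) :
    IsPolyMap (fun w => f w + g w) := by
  intro φ
  obtain ⟨P, hP⟩ := hf φ
  obtain ⟨Q, hQ⟩ := hg φ
  exact ⟨P + Q, fun w => by simp [hP, hQ]⟩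

@[fun_prop]
theorem IsPolyMap.neg {f : W → V} (hf : IsPolyMap f) : IsPolyMap (fun w => - f w) := by
  intro φ
  obtain ⟨P, hP⟩ := hf φ
  exact ⟨-P, fun w => by simp [hP]⟩

@[fun_prop]
theorem IsPolyMap.sub {f g : W → V} (hf : IsPolyMap f) (hg : IsPolyMap g) :
    IsPolyMap (fun w => f w - g w) := by
  simp only [sub_eq_add_neg]
  exact hf.add hg.neg

@[fun_prop]
theorem IsPolyMap.mul {f g : W → ℂ} (hf : IsPolyMap f) (hg : IsPolyMap g) :
    IsPolyMap (fun w => f w * g w) := by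
  intro φ
  obtain ⟨P, hP⟩ := hf LinearMap.id
  obtain ⟨Q, hQ⟩ := hg φ
  refine ⟨P * Q, fun w => ?_⟩
  have := φ.map_smul (f w) (g w)
  simp only [smul_eq_mul] at this
  simp [hP, hQ, this]

@[fun_prop]
theorem IsPolyMap.sum {ι : Type*} (s : Finset ι) {f : ι → W → V} (hf : ∀ i, IsPolyMap (f i)) :
    IsPolyMap (fun w => ∑ i ∈ s, f i w) := by
  classical
  induction s using Finset.induction_on with
  | empty => simpa using isPolyMap_const (0 : V)
  | insert i s hi ih => simpa only [Finset.sum_insert hi] using (hf i).add ih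

@[fun_prop]
theorem IsPolyMap.fst {f : W → U × V} (hf : IsPolyMap f) : IsPolyMap (fun w => (f w).1) :=
  IsPolyMap.comp (LinearMap.isPolyMap (LinearMap.fst ℂ U V)) hf

@[fun_prop]
theorem IsPolyMap.snd {f : W → U × V} (hf : IsPolyMap f) : IsPolyMap (fun w => (f w).2) :=
  IsPolyMap.comp (LinearMap.isPolyMap (LinearMap.snd ℂ U V)) hf

@[fun_prop]
theorem IsPolyMap.prodMk {f : W → U} {g : W → V} (hf : IsPolyMap f) (hg : IsPolyMap g) :
    IsPolyMap (fun w => (f w, g w)) := by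
  have h1 := IsPolyMap.comp (LinearMap.isPolyMap (LinearMap.inl ℂ U V)) hf
  have h2 := IsPolyMap.comp (LinearMap.isPolyMap (LinearMap.inr ℂ U V)) hg
  simpa using h1.add h2

@[fun_prop]
theorem isPolyMap_apply {ι : Type*} (i : ι) : IsPolyMap (fun f : ι → V => f i) :=
  LinearMap.isPolyMap (LinearMap.proj i : (ι → V) →ₗ[ℂ] V)

@[fun_prop]
theorem IsPolyMap.pi {ι : Type*} [Finite ι] {f : W → ι → V} (hf : ∀ i, IsPolyMap (fun w => f w i)) :
    IsPolyMap f := by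
  classical
  cases nonempty_fintype ι
  have h := IsPolyMap.sum Finset.univ fun i =>
    IsPolyMap.comp (LinearMap.isPolyMap (LinearMap.single ℂ (fun _ : ι => V) i)) (hf i)
  have e : f = fun w => ∑ i, LinearMap.single ℂ (fun _ : ι => V) i (f w i) := by
    funext w
    exact (Finset.univ_sum_single (f w)).symm
  rw [e]
  exact h

@[fun_prop]
theorem IsPolyMap.mvPolynomialEval {σ : Type*} {f : W → σ → ℂ} (hf : ∀ i, IsPolyMap (fun w => f w i))
    (p : MvPolynomial σ ℂ) : IsPolyMap (fun w => MvPolynomial.eval (f w) p) := by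
  induction p using MvPolynomial.induction_on with
  | C a => simpa using isPolyMap_const a
  | add p q hp hq => simpa using hp.add hq
  | mul_X p i hp => simpa using hp.mul (hf i)

end PolyMap

/-! ### Generic properties -/

section Generic

variable {V W : Type*} [AddCommGroup V] [Module ℂ V] [AddCommGroup W] [Module ℂ W]

theorem HoldsGenerically.mono {p q : V → Prop} (hp : HoldsGenerically p) (h : ∀ v, p v → q v) :
    HoldsGenerically q := by
  obtain ⟨P, h0, hP⟩ := hp
  exact ⟨P, h0, fun v hv => h v (hP v hv)⟩

theorem HoldsGenerically.of_forall {p : V → Prop} (h : ∀ v, p v) : HoldsGenerically p :=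
  ⟨1, ⟨0, by simp⟩, fun v _ => h v⟩

/-- The restriction of a polynomial function to the line through `a` in direction `b`. -/
theorem exists_polynomial_on_line (P : MvPolynomial (Module.Dual ℂ V) ℂ) (a b : V) :
    ∃ p : Polynomial ℂ, ∀ t : ℂ,
      p.eval t = eval (fun φ : Module.Dual ℂ V => φ (a + t • b)) P := by
  induction P using MvPolynomial.induction_on with
  | C c => exact ⟨Polynomial.C c, by simp⟩
  | add p q hp hq =>
    obtain ⟨p', hp⟩ := hp
    obtain ⟨q', hq⟩ := hq
    exact ⟨p' + q', fun t => by simp [hp, hq]⟩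
  | mul_X p φ hp =>
    obtain ⟨p', hp⟩ := hp
    refine ⟨p' * (Polynomial.C (φ a) + Polynomial.X * Polynomial.C (φ b)), fun t => ?_⟩
    simp only [Polynomial.eval_mul, hp, map_mul, eval_X, map_add, map_smul, smul_eq_mul,
      Polynomial.eval_add, Polynomial.eval_C, Polynomial.eval_X]

/-- On the line joining the two witnesses both polynomials restrict to nonzero polynomials in one
variable, and their product is nonzero at some point of the line. -/
theorem HoldsGenerically.and {p q : V → Prop} (hp : HoldsGenerically p)
    (hq : HoldsGenerically q) : HoldsGenerically fun v => p v ∧ q v := by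
  obtain ⟨P, ⟨a, ha⟩, hP⟩ := hp
  obtain ⟨Q, ⟨b, hb⟩, hQ⟩ := hq
  obtain ⟨P', hP'⟩ := exists_polynomial_on_line P a (b - a)
  obtain ⟨Q', hQ'⟩ := exists_polynomial_on_line Q a (b - a)
  have h : P' * Q' ≠ 0 := by
    refine mul_ne_zero ?_ ?_
    · rintro rfl
      exact ha (by simpa using (hP' 0).symm)
    · rintro rfl
      exact hb (by simpa using (hQ' 1).symm)
  obtain ⟨t, ht⟩ : ∃ t, (P' * Q').eval t ≠ 0 := by
    by_contra! h'
    exact h (Polynomial.funext fun t => by simpa using h' t)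
  refine ⟨P * Q, ⟨a + t • (b - a), ?_⟩, fun v hv => ?_⟩
  · rwa [map_mul, ← hP', ← hQ', ← Polynomial.eval_mul]
  · rw [map_mul] at hv
    exact ⟨hP v (left_ne_zero_of_mul hv), hQ v (right_ne_zero_of_mul hv)⟩

theorem HoldsGenerically.forall_mem_finset {ι : Type*} (s : Finset ι) {p : ι → V → Prop}
    (hp : ∀ i ∈ s, HoldsGenerically (p i)) : HoldsGenerically fun v => ∀ i ∈ s, p i v := by
  classical
  induction s using Finset.induction_on with
  | empty => exact .of_forall (by simp)
  | insert i s hi ih =>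
    refine ((hp i (by simp)).and (ih fun j hj => hp j (by simp [hj]))).mono ?_
    rintro v ⟨h1, h2⟩ j hj
    rcases Finset.mem_insert.1 hj with rfl | hj
    exacts [h1, h2 j hj]

theorem HoldsGenerically.forall_fin {ι : Type*} [Fintype ι] {p : ι → V → Prop}
    (hp : ∀ i, HoldsGenerically (p i)) : HoldsGenerically fun v => ∀ i, p i v :=
  (HoldsGenerically.forall_mem_finset Finset.univ fun i _ => hp i).mono fun _ h i =>
    h i (Finset.mem_univ i)

theorem holdsGenerically_ne_zero {φ : Module.Dual ℂ V} (h : φ ≠ 0) :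
    HoldsGenerically fun v => φ v ≠ 0 := by
  obtain ⟨v, hv⟩ : ∃ v, φ v ≠ 0 := by
    by_contra! h'
    exact h (LinearMap.ext h')
  exact ⟨X φ, ⟨v, by simpa using hv⟩, fun v hv => by simpa using hv⟩

/-- A property that is generic after pulling back along a surjective linear map is generic. -/
theorem HoldsGenerically.of_surjective {π : W →ₗ[ℂ] V} (hπ : Function.Surjective π)
    {p : V → Prop} (h : HoldsGenerically fun w => p (π w)) : HoldsGenerically p := by
  obtain ⟨P, ⟨w, hw⟩, hP⟩ := h
  obtain ⟨s, hs⟩ := π.exists_rightInverse_of_surjective (LinearMap.range_eq_top.2 hπ)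
  replace hs : ∀ v, π (s v) = v := fun v => LinearMap.congr_fun hs v
  -- This affine section of `π` is translated so as to pass through the witness `w`, which keeps the
  -- pulled-back polynomial nonzero.
  have hpoly : IsPolyMap fun v : V => s v + (w - s (π w)) :=
    (LinearMap.isPolyMap s).add (isPolyMap_const _)
  obtain ⟨Q, hQ⟩ := hpoly.exists_eval_eq P
  refine ⟨Q, ⟨π w, ?_⟩, fun _ hv => ?_⟩
  · rw [hQ]
    simpa using hw
  · rw [hQ] at hv
    simpa [hs] using hP _ hv

/-- A polynomial map from a space of smaller dimension misses a generic vector. -/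
theorem IsPolyMap.holdsGenerically_notMem_range [FiniteDimensional ℂ V] [FiniteDimensional ℂ W]
    {g : W → V} (hg : IsPolyMap g) (h : Module.finrank ℂ W < Module.finrank ℂ V) :
    HoldsGenerically fun v => v ∉ Set.range g := by
  let bV := Module.finBasis ℂ V
  let bW := Module.finBasis ℂ W
  have hpoly : IsPolyMap fun z : Fin (Module.finrank ℂ W) → ℂ => g (bW.equivFun.symm z) :=
    IsPolyMap.comp hg (LinearMap.isPolyMap bW.equivFun.symm.toLinearMap)
  have hG : ∀ j, ∃ G : MvPolynomial (Fin (Module.finrank ℂ W)) ℂ, ∀ z,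
      eval z G = bV.coord j (g (bW.equivFun.symm z)) := by
    intro j
    obtain ⟨P, hP⟩ := hpoly (bV.coord j)
    refine ⟨aeval (fun ψ : Module.Dual ℂ (Fin (Module.finrank ℂ W) → ℂ) =>
      ∑ i, C (ψ (Pi.single i 1)) * X i) P, fun z => ?_⟩
    rw [← hP, eval_aeval_eq]
    congr 2
    funext ψ
    conv_rhs => rw [pi_eq_sum_univ' z, map_sum]
    simp only [map_sum, map_mul, eval_C, eval_X]
    refine Finset.sum_congr rfl fun i _ => ?_
    rw [map_smul, smul_eq_mul, mul_comm]
  choose G hG using hG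
  -- There are dim V coordinate polynomials in only dim W variables, more than the transcendence
  -- degree allows. A relation among them is the polynomial on `V` that vanishes on the range.
  have hdep : ¬ AlgebraicIndependent ℂ G := by
    intro hi
    have := hi.lift_cardinalMk_le_trdeg
    rw [MvPolynomial.trdeg_of_isDomain] at this
    simp at this
    omega
  rw [algebraicIndependent_iff] at hdep
  push Not at hdep
  obtain ⟨P, hP, hP0⟩ := hdep
  obtain ⟨z, hz⟩ : ∃ z, eval z P ≠ 0 := by
    by_contra! h'
    exact hP0 (MvPolynomial.funext fun z => by simpa using h' z)
  refine ⟨rename bV.coord P, ⟨bV.equivFun.symm z, ?_⟩, ?_⟩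
  · rw [eval_rename]
    have e : (fun φ : Module.Dual ℂ V => φ (bV.equivFun.symm z)) ∘ bV.coord = z := by
      funext j
      simp [Finsupp.single_apply]
    rwa [e]
  · rintro v hv ⟨w, rfl⟩
    apply hv
    have := congrArg (eval (bW.equivFun w)) hP
    rw [map_zero, eval_aeval_eq] at this
    rw [eval_rename, ← this]
    congr 2
    funext j
    simp only [Function.comp_apply, hG]
    simp

end Generic

/-! ### Heights of ideals and common zeros -/

section Krull

/-- The length of a strictly increasing chain of prime ideals bounds the height of its last member
from below. -/
theorem le_height_of_chain {A : Type*} [CommRing A] (P : ℕ → Ideal A) (hP : ∀ k, (P k).IsPrime)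
    (n : ℕ) (hlt : ∀ k < n, P k < P (k + 1)) : (n : ℕ∞) ≤ (P n).height := by
  induction n with
  | zero => simp
  | succ n ih =>
    have := hP n
    have := hP (n + 1)
    calc ((n + 1 : ℕ) : ℕ∞) = n + 1 := by push_cast; rfl
      _ ≤ (P n).height + 1 := by
        gcongr
        exact ih fun k hk => hlt k (by omega)
      _ ≤ _ := Ideal.height_add_one_le_of_lt_of_isPrime (hlt n (by omega))

open Classical in
/-- The endomorphism of the polynomial ring that kills the variables in `s`. -/
def killVars {ι : Type*} (s : Set ι) : MvPolynomial ι ℂ →ₐ[ℂ] MvPolynomial ι ℂ :=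
  aeval fun i => if i ∈ s then 0 else X i

@[simp]
theorem killVars_X {ι : Type*} (s : Set ι) (i : ι) [Decidable (i ∈ s)] :
    killVars s (X i : MvPolynomial ι ℂ) = if i ∈ s then 0 else X i := by
  rw [killVars, aeval_X]
  congr

theorem killVars_comp {ι : Type*} {s t : Set ι} (h : s ⊆ t) :
    (killVars t).comp (killVars s) = killVars t := by
  classical
  ext1 i
  by_cases hi : i ∈ s
  · simp [hi, h hi]
  · simp [hi]

theorem eval_zero_killVars {ι : Type*} (s : Set ι) (p : MvPolynomial ι ℂ) :
    eval 0 (killVars s p) = eval 0 p := by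
  classical
  induction p using MvPolynomial.induction_on with
  | C c => simp
  | add p q hp hq => simp only [map_add, hp, hq]
  | mul_X p i hp =>
    simp only [map_mul, killVars_X, hp, eval_X]
    split_ifs <;> simp

/-- A lower bound for the height of a contracted monomial prime. -/
theorem le_height_ker_killVars {A ι : Type*} [CommRing A] [Algebra ℂ A]
    (f : A →ₐ[ℂ] MvPolynomial ι ℂ) (r : ι → ℕ) (n : ℕ)
    (h : ∀ k < n, ∃ a, killVars {i | r i < k} (f a) ≠ 0 ∧ killVars {i | r i < k + 1} (f a) = 0) :
    (n : ℕ∞) ≤ (RingHom.ker ((killVars {i | r i < n}).comp f)).height := by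
  let P : ℕ → Ideal A := fun k => RingHom.ker ((killVars {i | r i < k}).comp f)
  have hP : ∀ k, (P k).IsPrime := fun k => RingHom.ker_isPrime _
  refine le_height_of_chain P hP n fun k hk => ?_
  refine lt_of_le_of_ne (fun a ha => ?_) fun heq => ?_
  · have hs : {i | r i < k} ⊆ {i | r i < k + 1} := fun i (hi : r i < k) => Nat.lt_succ_of_lt hi
    simp only [P, RingHom.mem_ker, AlgHom.comp_apply] at ha ⊢
    rw [← killVars_comp hs, AlgHom.comp_apply, ha, map_zero]
  · obtain ⟨a, h1, h2⟩ := h k hk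
    have ha : a ∈ P (k + 1) := h2
    rw [← heq] at ha
    exact h1 ha

/-- A lower bound for the height of an augmentation ideal. -/
theorem le_height_ker {A ι : Type*} [CommRing A] [Algebra ℂ A] (f : A →ₐ[ℂ] MvPolynomial ι ℂ)
    (r : ι → ℕ) (n : ℕ)
    (h : ∀ k < n, ∃ a, killVars {i | r i < k} (f a) ≠ 0 ∧ killVars {i | r i < k + 1} (f a) = 0) :
    (n : ℕ∞) ≤ (RingHom.ker ((aeval (0 : ι → ℂ)).comp f : A →ₐ[ℂ] ℂ)).height := by
  refine (le_height_ker_killVars f r n h).trans (Ideal.height_mono fun a ha => ?_)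
  simp only [RingHom.mem_ker, AlgHom.comp_apply] at ha ⊢
  rw [aeval_eq_eval]
  exact (eval_zero_killVars _ _).symm.trans (by rw [ha, map_zero])

/-- Fewer than `ht (ker χ₀)` functions on an affine complex variety that vanish at the point `χ₀`
vanish at some other point. -/
theorem exists_algHom_ne {A : Type*} [CommRing A] [Algebra ℂ A] [Algebra.FiniteType ℂ A]
    (χ₀ : A →ₐ[ℂ] ℂ) (s : Finset A) (hs : ∀ a ∈ s, χ₀ a = 0)
    (hc : (s.card : ℕ∞) < (RingHom.ker χ₀).height) :
    ∃ χ : A →ₐ[ℂ] ℂ, χ ≠ χ₀ ∧ ∀ a ∈ s, χ a = 0 := by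
  by_contra! hcon
  have := Algebra.FiniteType.isNoetherianRing ℂ A
  have : IsJacobsonRing A := isJacobsonRing_of_finiteType (A := ℂ)
  -- If χ₀ were the only common zero, the Nullstellensatz would make its kernel the only maximal
  -- ideal over `s`. Primes are intersections of maximal ideals in a Jacobson ring, so that kernel
  -- is minimal over `s`, and Krull's height theorem bounds its height by the number of generators.
  have hmin : RingHom.ker χ₀ ∈ (Ideal.span (s : Set A)).minimalPrimes := by
    refine ⟨⟨RingHom.ker_isPrime _, Ideal.span_le.2 fun a ha => hs a ha⟩, ?_⟩
    rintro q ⟨hq, hsq⟩ -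
    have hrad : q.jacobson = q := isJacobsonRing_iff_prime_eq.1 ‹_› q hq
    rw [← hrad, Ideal.jacobson]
    refine le_sInf ?_
    rintro m ⟨hqm, hm⟩
    let _ := Ideal.Quotient.field m
    have : Module.Finite ℂ (A ⧸ m) := finite_of_finite_type_of_isJacobsonRing ℂ (A ⧸ m)
    have hbij : Function.Bijective (algebraMap ℂ (A ⧸ m)) :=
      IsAlgClosed.algebraMap_bijective_of_isIntegral
    let e : ℂ ≃ₐ[ℂ] (A ⧸ m) := AlgEquiv.ofBijective (Algebra.ofId ℂ (A ⧸ m)) hbij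
    let χ : A →ₐ[ℂ] ℂ := e.symm.toAlgHom.comp (Ideal.Quotient.mkₐ ℂ m)
    have hχ : ∀ a, χ a = 0 ↔ a ∈ m := fun a => by
      simp [χ, Ideal.Quotient.eq_zero_iff_mem]
    have : χ = χ₀ := by
      by_contra hne
      obtain ⟨a, ha, h0⟩ := hcon χ hne
      exact h0 ((hχ a).2 (hqm (hsq (Ideal.subset_span ha))))
    intro a ha
    exact (hχ a).1 (this ▸ ha)
  have := RingHom.ker_isPrime χ₀
  have h1 : (RingHom.ker χ₀).height ≤ s.card :=
    ((RingHom.ker χ₀).height_le_iff_exists_minimalPrimes _).2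
      ⟨_, hmin, by simpa using Submodule.spanRank_span_le_card (R := A) (s : Set A)⟩
  exact absurd hc (not_lt.2 h1)

/-- Fewer than `n` polynomials in `n` variables without constant term have a nontrivial common
zero. -/
theorem exists_ne_zero_common_zero {n : ℕ} (s : Finset (MvPolynomial (Fin n) ℂ))
    (hs : ∀ p ∈ s, eval 0 p = 0) (hc : s.card < n) :
    ∃ v : Fin n → ℂ, v ≠ 0 ∧ ∀ p ∈ s, eval v p = 0 := by
  have hh := le_height_ker (AlgHom.id ℂ (MvPolynomial (Fin n) ℂ)) (fun i => i) n fun k hk =>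
    ⟨X ⟨k, hk⟩, by simp, by simp⟩
  obtain ⟨χ, hχ, h⟩ := exists_algHom_ne _ s (fun p hp => by simpa [aeval_eq_eval] using hs p hp)
    ((Nat.cast_lt.2 hc).trans_le hh)
  have hev : χ = aeval fun i => χ (X i) := by ext; simp
  refine ⟨fun i => χ (X i), fun h0 => hχ ?_, fun p hp => ?_⟩
  · rw [hev, h0]
    rfl
  · rw [← h p hp]
    conv_rhs => rw [hev]
    rfl

end Krull

/-! ### Nonemptiness of the locus of rank at most two -/

/-- Constant matrices `P`, `Q` taken from the rank normal form witness the rank by a single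
determinant, which ring homomorphisms respect; no choice of rows and columns is needed. -/
theorem exists_minor_ne_zero {ι : Type*} [Fintype ι] [DecidableEq ι] {A : Matrix ι ι ℂ} {k : ℕ}
    (h : k ≤ A.rank) : ∃ (P : Matrix (Fin k) ι ℂ) (Q : Matrix ι (Fin k) ℂ), (P * A * Q).det = 1 := by
  obtain ⟨V, U, e, -, -, hVU⟩ := A.exists_rank_normal_form
  let i : Fin k → ι := fun a => e.symm (Sum.inl (Fin.castLE h a))
  refine ⟨V.submatrix i id, U.submatrix id i, ?_⟩
  have : V.submatrix i id * A * U.submatrix id i = (V * A * U).submatrix i i := by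
    ext a b
    simp [Matrix.mul_apply]
  rw [this, hVU]
  convert Matrix.det_one (n := Fin k) (R := ℂ)
  ext a b
  simp [i, Matrix.one_apply]

/-- The generators of the coordinate ring of pairs of a vector `x` and a symmetric matrix
`a bᵀ + b aᵀ`. -/
def secantGen : Fin 4 ⊕ (Fin 4 × Fin 4) → MvPolynomial (Fin 4 ⊕ (Fin 4 ⊕ Fin 4)) ℂ
  | Sum.inl m => X (Sum.inl m)
  | Sum.inr p => X (Sum.inr (Sum.inl p.1)) * X (Sum.inr (Sum.inr p.2)) +
      X (Sum.inr (Sum.inl p.2)) * X (Sum.inr (Sum.inr p.1))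

/-- The stage at which a variable is killed in a chain of monomial primes that is strict on the
coordinate ring generated by `secantGen`. -/
def killStage : Fin 4 ⊕ (Fin 4 ⊕ Fin 4) → ℕ
  | Sum.inl m => 7 + m
  | Sum.inr (Sum.inl i) => 6 - i
  -- The variable b₀ is never killed in the eleven steps: the rescaling (a, b) ↦ (ta, t⁻¹b) fixes a
  -- bᵀ + b aᵀ, so the eight variables a, b yield only seven strict steps.
  | Sum.inr (Sum.inr i) => if i = 0 then 11 else 3 - i

/-- A sum of two rank one matrices stays of rank at most two after multiplication on both sides;
over a commutative ring this is a polynomial identity in the four transformed vectors. -/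
theorem det_mul_secant_mul {R ι : Type*} [CommRing R] [Fintype ι] (P : Matrix (Fin 3) ι R)
    (Q : Matrix ι (Fin 3) R) (a b : ι → R) :
    (P * Matrix.of (fun i j => a i * b j + a j * b i) * Q).det = 0 := by
  have h : P * Matrix.of (fun i j => a i * b j + a j * b i) * Q = Matrix.of fun i j =>
      (P.mulVec a) i * (Matrix.vecMul b Q) j + (P.mulVec b) i * (Matrix.vecMul a Q) j := by
    have : Matrix.of (fun i j => a i * b j + a j * b i)
        = Matrix.vecMulVec a b + Matrix.vecMulVec b a := by
      ext i j
      simp [Matrix.vecMulVec, mul_comm]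
    rw [this, Matrix.mul_add, Matrix.add_mul, Matrix.mul_vecMulVec, Matrix.mul_vecMulVec,
      Matrix.vecMulVec_mul, Matrix.vecMulVec_mul]
    rfl
  rw [h, Matrix.det_fin_three]
  simp only [Matrix.of_apply]
  ring

/-- A symmetric `4 × 4` matrix of polynomials in four variables without constant terms has rank at
most two at some nonzero vector. -/
theorem exists_rank_le_two (A : Matrix (Fin 4) (Fin 4) (MvPolynomial (Fin 4) ℂ)) (hA : A.IsSymm)
    (h0 : ∀ i j, eval 0 (A i j) = 0) : ∃ v : Fin 4 → ℂ, v ≠ 0 ∧ (A.map (eval v)).rank ≤ 2 := by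
  classical
  let f : MvPolynomial (Fin 4 ⊕ (Fin 4 × Fin 4)) ℂ →ₐ[ℂ] MvPolynomial (Fin 4 ⊕ (Fin 4 ⊕ Fin 4)) ℂ :=
    aeval secantGen
  let S := f.range
  have hft : Algebra.FiniteType ℂ S :=
    Algebra.FiniteType.of_surjective f.rangeRestrict f.rangeRestrict_surjective
  let χ₀ : S →ₐ[ℂ] ℂ := (aeval (0 : Fin 4 ⊕ (Fin 4 ⊕ Fin 4) → ℂ)).comp S.val
  have hX : ∀ m, f (X (Sum.inl m)) = X (Sum.inl m) := fun m => by simp [f, secantGen]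
  have hS : ∀ i j, f (X (Sum.inr (i, j))) = X (Sum.inr (Sum.inl i)) * X (Sum.inr (Sum.inr j)) +
      X (Sum.inr (Sum.inl j)) * X (Sum.inr (Sum.inr i)) := fun i j => by simp [f, secantGen]
  -- Killing b₃, b₂, b₁ is detected by the diagonal entries sᵢᵢ = 2aᵢbᵢ. Then s₀ⱼ has become aⱼb₀,
  -- which detects a₃, a₂, a₁, and s₀₀ detects a₀; the four coordinates of x come last.
  have hh : ((11 : ℕ) : ℕ∞) ≤ (RingHom.ker χ₀).height := by
    refine le_height_ker S.val killStage 11 fun k hk => ?_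
    have key : ∀ g, (killVars {i | killStage i < k} (f g) ≠ 0 ∧
        killVars {i | killStage i < k + 1} (f g) = 0) →
        ∃ a : S, killVars {i | killStage i < k} (S.val a) ≠ 0 ∧
          killVars {i | killStage i < k + 1} (S.val a) = 0 :=
      fun g hg => ⟨f.rangeRestrict g, hg⟩
    have htwo : ∀ i : Fin 4, (X (Sum.inr (Sum.inl i)) * X (Sum.inr (Sum.inr i)) +
        X (Sum.inr (Sum.inl i)) * X (Sum.inr (Sum.inr i)) :
          MvPolynomial (Fin 4 ⊕ (Fin 4 ⊕ Fin 4)) ℂ) ≠ 0 := fun i => by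
      rw [← two_mul]
      exact mul_ne_zero two_ne_zero (mul_ne_zero (X_ne_zero _) (X_ne_zero _))
    interval_cases k
    · exact key (X (Sum.inr (3, 3))) (by simp [hS, killStage, htwo])
    · exact key (X (Sum.inr (2, 2))) (by simp [hS, killStage, htwo])
    · exact key (X (Sum.inr (1, 1))) (by simp [hS, killStage, htwo])
    · exact key (X (Sum.inr (0, 3))) (by simp [hS, killStage])
    · exact key (X (Sum.inr (0, 2))) (by simp [hS, killStage])
    · exact key (X (Sum.inr (0, 1))) (by simp [hS, killStage])
    · exact key (X (Sum.inr (0, 0))) (by simp [hS, killStage, htwo])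
    · exact key (X (Sum.inl 0)) (by simp [hX, killStage])
    · exact key (X (Sum.inl 1)) (by simp [hX, killStage])
    · exact key (X (Sum.inl 2)) (by simp [hX, killStage])
    · exact key (X (Sum.inl 3)) (by simp [hX, killStage])
  let x : Fin 4 → S := fun m => f.rangeRestrict (X (Sum.inl m))
  let s : Fin 4 → Fin 4 → S := fun i j => f.rangeRestrict (X (Sum.inr (i, j)))
  let g : Fin 4 × Fin 4 → S := fun p => s p.1 p.2 - aeval x (A p.1 p.2)
  -- By symmetry the ten entries on and above the diagonal suffice, one fewer than the height.
  let J : Finset S := (Finset.univ.filter fun p : Fin 4 × Fin 4 => p.1 ≤ p.2).image g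
  have hJ : J.card ≤ 10 := Finset.card_image_le.trans (by decide)
  have hx0 : ∀ m, χ₀ (x m) = 0 := fun m => by
    change aeval 0 (f (X (Sum.inl m))) = 0
    simp [hX]
  have hs0 : ∀ i j, χ₀ (s i j) = 0 := fun i j => by
    change aeval 0 (f (X (Sum.inr (i, j)))) = 0
    simp [hS]
  have hev : ∀ (χ : S →ₐ[ℂ] ℂ) (p : MvPolynomial (Fin 4) ℂ),
      χ (aeval x p) = eval (fun m => χ (x m)) p := fun χ p => by
    rw [← AlgHom.comp_apply, comp_aeval]
    rfl
  obtain ⟨χ, hχ, hχJ⟩ := exists_algHom_ne χ₀ J (fun a ha => by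
      obtain ⟨p, -, rfl⟩ := Finset.mem_image.1 ha
      rw [map_sub, hs0, hev]
      simp only [hx0]
      rw [zero_sub, neg_eq_zero]
      exact h0 _ _)
    (lt_of_lt_of_le (by exact_mod_cast Nat.lt_succ_of_le hJ) hh)
  have hss : ∀ i j, s i j = s j i := fun i j => by
    apply Subtype.ext
    change f _ = f _
    rw [hS, hS]
    ring
  have hχs : ∀ i j, χ (s i j) = eval (fun m => χ (x m)) (A i j) := by
    have hle : ∀ i j, i ≤ j → χ (s i j) = eval (fun m => χ (x m)) (A i j) := fun i j hij => by
      have := hχJ (g (i, j)) (Finset.mem_image_of_mem g (by simpa using hij))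
      rwa [map_sub, hev, sub_eq_zero] at this
    intro i j
    rcases le_total i j with hij | hij
    · exact hle i j hij
    · rw [hss, hle j i hij, hA.apply]
  refine ⟨fun m => χ (x m), fun h => hχ ?_, ?_⟩
  -- The solution found differs from the origin of the whole cone, and it must have x ≠ 0: at x = 0
  -- the equations give s = A(0) = 0, which is the origin again.
  · have h1 : ∀ i j, χ (s i j) = 0 := fun i j => by
      rw [hχs, h, h0]
    have h2 : χ.comp f.rangeRestrict = χ₀.comp f.rangeRestrict := by
      ext i
      rcases i with m | ⟨i, j⟩
      · exact (congrFun h m).trans (hx0 m).symm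
      · exact (h1 i j).trans (hs0 i j).symm
    ext a
    obtain ⟨b, rfl⟩ := f.rangeRestrict_surjective a
    exact AlgHom.congr_fun h2 b
  · by_contra hr
    obtain ⟨P, Q, hPQ⟩ := exists_minor_ne_zero (show 3 ≤ (A.map (eval fun m => χ (x m))).rank by omega)
    -- Rank three or more at the solution would make det(PAQ) equal to 1, but this determinant is
    -- the image under χ of one that vanishes identically on the secant variety.
    let B : Matrix (Fin 3) (Fin 3) S :=
      P.map (algebraMap ℂ S) * Matrix.of s * Q.map (algebraMap ℂ S)
    have hB : B.det = 0 := by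
      let R := MvPolynomial (Fin 4 ⊕ (Fin 4 ⊕ Fin 4)) ℂ
      let a : Fin 4 → R := fun i => X (Sum.inr (Sum.inl i))
      let b : Fin 4 → R := fun i => X (Sum.inr (Sum.inr i))
      have : S.val.mapMatrix B = P.map (algebraMap ℂ R) *
          Matrix.of (fun i j => a i * b j + a j * b i) * Q.map (algebraMap ℂ R) := by
        ext i j : 2
        simp only [B, AlgHom.mapMatrix_apply, Matrix.map_apply, Matrix.mul_apply, map_sum, map_mul,
          Matrix.of_apply, a, b, ← hS, AlgHom.commutes]
        rfl
      apply Subtype.val_injective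
      change S.val B.det = S.val 0
      rw [AlgHom.map_det, this, det_mul_secant_mul, map_zero]
    have hBχ : B.map χ = P * (A.map (eval fun m => χ (x m))) * Q := by
      ext a b
      simp [B, Matrix.mul_apply, hχs]
    rw [← hBχ, ← AlgHom.mapMatrix_apply, ← AlgHom.map_det, hB, map_zero] at hPQ
    exact zero_ne_one hPQ

/-! ### Codimension of finite sets of points -/

/-- The restriction of polynomials to the line spanned by the vector `v`. -/
def lineHom {n : ℕ} (v : Fin n → ℂ) : MvPolynomial (Fin n) ℂ →ₐ[ℂ] Polynomial ℂ :=
  aeval fun i => Polynomial.C (v i) * Polynomial.X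

theorem eval_lineHom {n : ℕ} (v : Fin n → ℂ) (p : MvPolynomial (Fin n) ℂ) (c : ℂ) :
    (lineHom v p).eval c = eval (c • v) p := by
  induction p using MvPolynomial.induction_on with
  | C a => simp [lineHom]
  | add p q hp hq => simp only [map_add, Polynomial.eval_add, hp, hq]
  | mul_X p i hp =>
    rw [map_mul, Polynomial.eval_mul, hp]
    simp only [lineHom, aeval_X, Polynomial.eval_mul, Polynomial.eval_C, Polynomial.eval_X, map_mul,
      eval_X, Pi.smul_apply, smul_eq_mul, mul_comm c]

/-- The ideal of a line through the origin lies strictly below the maximal ideal of the origin,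
whose height is at most n + 1. For the other inequality, linear coordinates that turn the line into
an axis allow the remaining n coordinates to be killed one by one. -/
theorem height_ker_lineHom {n : ℕ} {v : Fin (n + 1) → ℂ} (hv : v ≠ 0) :
    (RingHom.ker (lineHom v)).height = n := by
  classical
  obtain ⟨i, hi⟩ : ∃ i, v i ≠ 0 := Function.ne_iff.1 hv
  have hprime : (RingHom.ker (lineHom v)).IsPrime := RingHom.ker_isPrime _
  apply le_antisymm
  · have hdim : ringKrullDim (MvPolynomial (Fin (n + 1)) ℂ) = (n + 1 : ℕ) := by
      rw [MvPolynomial.ringKrullDim_of_isNoetherianRing, ringKrullDim_eq_zero_of_field]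
      simp
    let m : Ideal (MvPolynomial (Fin (n + 1)) ℂ) :=
      RingHom.ker (aeval (0 : Fin (n + 1) → ℂ) : MvPolynomial (Fin (n + 1)) ℂ →ₐ[ℂ] ℂ)
    have hm : m.IsPrime := RingHom.ker_isPrime _
    have hlt : RingHom.ker (lineHom v) < m := by
      refine lt_of_le_of_ne (fun q hq => ?_) fun h => ?_
      · rw [RingHom.mem_ker] at hq ⊢
        have := eval_lineHom v q 0
        rw [hq, zero_smul] at this
        simpa [aeval_eq_eval] using this.symm
      · have hX : (X i : MvPolynomial (Fin (n + 1)) ℂ) ∈ m := by simp [m, RingHom.mem_ker]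
        rw [← h, RingHom.mem_ker, lineHom, aeval_X] at hX
        simp [hi] at hX
    have h1 := Ideal.height_add_one_le_of_lt_of_isPrime hlt
    have h2 : m.height ≤ (n + 1 : ℕ) := by
      have := Ideal.height_le_ringKrullDim_of_isPrime (I := m)
      rw [hdim] at this
      exact_mod_cast this
    have h3 := h1.trans h2
    push_cast at h3
    exact (ENat.add_le_add_iff_right (by simp)).1 h3
  · let f : MvPolynomial (Fin (n + 1)) ℂ →ₐ[ℂ] MvPolynomial (Fin (n + 1)) ℂ :=
      aeval fun j => C (v j) * X i + if j = i then 0 else X j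
    -- The axis variable gets stage n and so survives; the substitution `f` takes vᵢxⱼ − vⱼxᵢ to
    -- vᵢxⱼ, which detects the killing of xⱼ.
    let r : Fin (n + 1) → ℕ := i.insertNth (α := fun _ => ℕ) n (fun k => (k : ℕ))
    have hri : r i = n := Fin.insertNth_apply_same _ _ _
    have hrs : ∀ k, r (i.succAbove k) = k := fun k => Fin.insertNth_apply_succAbove _ _ _ k
    refine (le_height_ker_killVars f r n fun k hk => ?_).trans (Ideal.height_mono fun a ha => ?_)
    · have hne := i.succAbove_ne ⟨k, hk⟩
      have hf : f (C (v i) * X (i.succAbove ⟨k, hk⟩) - C (v (i.succAbove ⟨k, hk⟩)) * X i)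
          = C (v i) * X (i.succAbove ⟨k, hk⟩) := by
        simp only [f, map_sub, map_mul, aeval_X, algHom_C, algebraMap_eq, if_neg hne, if_true]
        ring
      refine ⟨C (v i) * X (i.succAbove ⟨k, hk⟩) - C (v (i.succAbove ⟨k, hk⟩)) * X i, ?_, ?_⟩
      · rw [hf]
        simp [hrs, hi]
      · rw [hf]
        simp [hrs]
    · have hcomp : lineHom v = (aeval fun _ => Polynomial.X).comp
          ((killVars {j | r j < n}).comp f) := by
        ext j
        by_cases hj : j = i
        · subst hj
          simp [lineHom, f, hri]
        · obtain ⟨k, rfl⟩ := Fin.exists_succAbove_eq hj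
          simp [lineHom, f, hri, hrs]
      rw [RingHom.mem_ker] at ha ⊢
      rw [hcomp, AlgHom.comp_apply, ha, map_zero]

/-- A finite nonempty set of points of projective `n`-space has codimension `n`. -/
theorem codim_eq_of_finite {n : ℕ} {Z : Set (ℙ ℂ (Fin (n + 1) → ℂ))} (hf : Z.Finite)
    (hne : Z.Nonempty) : codim Z = n := by
  classical
  apply le_antisymm
  -- A polynomial vanishing on the cone vanishes at every nonzero point of the line over `p`, hence
  -- identically on that line.
  · obtain ⟨p, hp⟩ := hne
    rw [← height_ker_lineHom p.rep_nonzero]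
    refine Ideal.height_mono fun q hq => ?_
    rw [RingHom.mem_ker]
    refine Polynomial.eq_zero_of_infinite_isRoot _ ?_
    refine Set.Infinite.mono (s := {0}ᶜ) (fun c hc => ?_) (Set.finite_singleton 0).infinite_compl
    rw [Set.mem_ofPred_eq, Polynomial.IsRoot, eval_lineHom]
    rw [mem_vanishingIdeal_iff] at hq
    refine hq _ ⟨smul_ne_zero hc p.rep_nonzero, ?_⟩
    convert hp
    conv_rhs => rw [← p.mk_rep]
    exact (Projectivization.mk_eq_mk_iff' _ _ _ _ _).2 ⟨c, rfl⟩
  · rw [codim, Ideal.height_eq_inf_minimalPrimes]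
    refine le_iInf₂ fun q hq => ?_
    have := hq.isPrime
    by_cases h : ∃ p ∈ Z, RingHom.ker (lineHom p.rep) ≤ q
    · obtain ⟨p, -, hpq⟩ := h
      rw [← height_ker_lineHom p.rep_nonzero]
      exact Ideal.height_mono hpq
    · exfalso
      push Not at h
      -- Prime avoidance in product form: if `q` contained none of the line ideals, functions
      -- outside `q`, one for each line, would have a product in the vanishing ideal and hence in
      -- the prime `q`.
      have h' : ∀ p : ℙ ℂ (Fin (n + 1) → ℂ), ∃ a, p ∈ Z → lineHom p.rep a = 0 ∧ a ∉ q := by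
        intro p
        by_cases hp : p ∈ Z
        · obtain ⟨a, ha, haq⟩ := SetLike.not_le_iff_exists.1 (h p hp)
          exact ⟨a, fun _ => ⟨ha, haq⟩⟩
        · exact ⟨0, fun h => absurd h hp⟩
      choose a ha using h'
      have hmem : ∏ p ∈ hf.toFinset, a p ∈ q := by
        refine hq.1.2 ?_
        rw [mem_vanishingIdeal_iff]
        rintro v ⟨hv, hvZ⟩
        rw [map_prod]
        refine Finset.prod_eq_zero (hf.mem_toFinset.2 hvZ) ?_
        obtain ⟨c, hc⟩ := Projectivization.exists_smul_eq_mk_rep ℂ v hv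
        have := eval_lineHom (Projectivization.mk ℂ v hv).rep
          (a (Projectivization.mk ℂ v hv)) (c⁻¹ : ℂˣ)
        rw [(ha _ hvZ).1, ← hc, Polynomial.eval_zero] at this
        simp only [Units.smul_def, smul_smul, Units.inv_mul, one_smul] at this
        exact this.symm
      obtain ⟨p, hp, hpq⟩ := (Ideal.IsPrime.prod_mem_iff).1 hmem
      exact (ha p (hf.mem_toFinset.1 hp)).2 hpq

/-! ### Derivatives of determinants -/

section Determinant

variable {m : ℕ}

/-- The Laplace expansion along the first two rows makes orders of vanishing visible. If rows and
columns 0 and 1 vanish at a point, the first product vanishes to order two and all others to order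
at least three. -/
theorem det_fin_four' {R : Type*} [CommRing R] (E : Matrix (Fin 4) (Fin 4) R) : E.det =
    (E 0 0 * E 1 1 - E 0 1 * E 1 0) * (E 2 2 * E 3 3 - E 2 3 * E 3 2)
    - (E 0 0 * E 1 2 - E 0 2 * E 1 0) * (E 2 1 * E 3 3 - E 2 3 * E 3 1)
    + (E 0 0 * E 1 3 - E 0 3 * E 1 0) * (E 2 1 * E 3 2 - E 2 2 * E 3 1)
    + (E 0 1 * E 1 2 - E 0 2 * E 1 1) * (E 2 0 * E 3 3 - E 2 3 * E 3 0)
    - (E 0 1 * E 1 3 - E 0 3 * E 1 1) * (E 2 0 * E 3 2 - E 2 2 * E 3 0)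
    + (E 0 2 * E 1 3 - E 0 3 * E 1 2) * (E 2 0 * E 3 1 - E 2 1 * E 3 0) := by
  rw [Matrix.det_succ_row_zero]
  simp only [Fin.sum_univ_four, Matrix.det_fin_three, Matrix.submatrix_apply, Fin.isValue]
  simp [Fin.succAbove, Fin.lt_def]
  ring

theorem eval_pderiv_mul (v : Fin m → ℂ) (i : Fin m) (p q : MvPolynomial (Fin m) ℂ) :
    eval v (pderiv i (p * q)) = eval v (pderiv i p) * eval v q + eval v p * eval v (pderiv i q) := by
  simp [Derivation.leibniz]
  ring

/-- Each term of the determinant that avoids the corner entry contains a factor from row 0 and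
another from column 0, so it contributes nothing to first order. -/
theorem eval_pderiv_det_of_row_zero (E : Matrix (Fin 4) (Fin 4) (MvPolynomial (Fin m) ℂ))
    (v : Fin m → ℂ) (h0 : ∀ j, eval v (E 0 j) = 0) (h0' : ∀ j, eval v (E j 0) = 0) (i : Fin m) :
    eval v (pderiv i E.det) = eval v (pderiv i (E 0 0)) *
      ((E.map (eval v)).submatrix Fin.succ Fin.succ).det := by
  rw [det_fin_four', Matrix.det_fin_three]
  simp only [map_add, map_sub, eval_pderiv_mul, map_mul, h0, h0', Matrix.submatrix_apply,
    Matrix.map_apply, Fin.succ_zero_eq_one, Fin.succ_one_eq_two, Fin.isValue,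
    show (Fin.succ 2 : Fin 4) = 3 from rfl]
  ring

theorem eval_pderiv_det_of_rows_zero (E : Matrix (Fin 4) (Fin 4) (MvPolynomial (Fin m) ℂ))
    (v : Fin m → ℂ) (h0 : ∀ j, eval v (E 0 j) = 0) (h0' : ∀ j, eval v (E j 0) = 0)
    (h1 : ∀ j, eval v (E 1 j) = 0) (h1' : ∀ j, eval v (E j 1) = 0) (i j : Fin m) :
    eval v (pderiv i (pderiv j E.det)) =
      (eval v (pderiv i (E 0 0)) * eval v (pderiv j (E 1 1)) +
        eval v (pderiv j (E 0 0)) * eval v (pderiv i (E 1 1)) -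
        eval v (pderiv i (E 0 1)) * eval v (pderiv j (E 1 0)) -
        eval v (pderiv j (E 0 1)) * eval v (pderiv i (E 1 0))) *
      ((E.map (eval v)).submatrix (Fin.natAdd 2) (Fin.natAdd 2) : Matrix (Fin 2) (Fin 2) ℂ).det := by
  rw [det_fin_four', Matrix.det_fin_two]
  simp only [map_add, map_sub, Derivation.leibniz, smul_eq_mul, map_mul, h0, h0', h1, h1',
    Matrix.submatrix_apply, Matrix.map_apply, Fin.isValue,
    show (Fin.natAdd 2 (0 : Fin 2) : Fin 4) = 2 from rfl,
    show (Fin.natAdd 2 (1 : Fin 2) : Fin 4) = 3 from rfl, zero_mul, mul_zero, add_zero, zero_add,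
    sub_zero, sub_self]
  ring

end Determinant

/-! ### Determinants of symmetric matrices at degenerate points -/

section Kernel

variable {ι : Type*} [Fintype ι] [DecidableEq ι]

/-- With the zero block placed first, the leading `s` columns of `U` span the kernel. -/
theorem exists_rank_normal_form_zero_one (A : Matrix ι ι ℂ) {r s : ℕ} (hr : A.rank = r)
    (hs : Fintype.card ι = s + r) : ∃ (V U : Matrix ι ι ℂ) (e : Fin (s + r) ≃ ι),
      IsUnit V ∧ IsUnit U ∧ (V * A * U).submatrix e e =
        Matrix.submatrix (Matrix.fromBlocks 0 0 0 1) finSumFinEquiv.symm finSumFinEquiv.symm := by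
  subst hr
  obtain ⟨V, U, e, hV, hU, h⟩ := A.exists_rank_normal_form
  obtain rfl : s = Fintype.card ι - A.rank := by omega
  refine ⟨V, U, finSumFinEquiv.symm.trans ((Equiv.sumComm _ _).trans e.symm), hV, hU, ?_⟩
  rw [h]
  ext a b
  obtain ⟨a, rfl⟩ := finSumFinEquiv.surjective a
  obtain ⟨b, rfl⟩ := finSumFinEquiv.surjective b
  rcases a with a | a <;> rcases b with b | b <;> simp

/-- A basis adapted to the kernel of a symmetric matrix. -/
theorem exists_adapted_basis {A : Matrix ι ι ℂ} (hA : A.IsSymm) {r s : ℕ} (hr : A.rank = r)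
    (hs : Fintype.card ι = s + r) : ∃ (U : Matrix ι ι ℂ) (e : Fin (s + r) ≃ ι), IsUnit U ∧
      (∀ j : Fin s, A.mulVec (fun i => U i (e (Fin.castAdd r j))) = 0) ∧
      (∀ k, A.mulVec k = 0 → ∃ y : Fin s → ℂ, k = ∑ j, y j • fun i => U i (e (Fin.castAdd r j))) ∧
      ((U.transpose * A * U).submatrix (fun j => e (Fin.natAdd s j))
        (fun j => e (Fin.natAdd s j))).det ≠ 0 := by
  obtain ⟨V, U, e, hV, hU, h⟩ := exists_rank_normal_form_zero_one A hr hs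
  have hentry : ∀ a b, (V * A * U) a b = Matrix.fromBlocks (0 : Matrix (Fin s) (Fin s) ℂ) 0 0
      (1 : Matrix (Fin r) (Fin r) ℂ) (finSumFinEquiv.symm (e.symm a))
        (finSumFinEquiv.symm (e.symm b)) := fun a b => by
    simpa using congrFun (congrFun h (e.symm a)) (e.symm b)
  have hVinj : ∀ w, V.mulVec w = 0 → w = 0 := fun w hw => by
    obtain ⟨V', hV'⟩ := hV.exists_left_inv
    rw [← Matrix.one_mulVec w, ← hV', ← Matrix.mulVec_mulVec, hw, Matrix.mulVec_zero]
  have hUTinj : ∀ w, U.transpose.mulVec w = 0 → w = 0 := fun w hw => by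
    obtain ⟨U', hU'⟩ := hU.exists_right_inv
    rw [← Matrix.one_mulVec w, ← Matrix.transpose_one, ← hU', Matrix.transpose_mul,
      ← Matrix.mulVec_mulVec, hw, Matrix.mulVec_zero]
  have hker : ∀ j : Fin s, A.mulVec (fun i => U i (e (Fin.castAdd r j))) = 0 := fun j => by
    apply hVinj
    ext a
    have := hentry a (e (Fin.castAdd r j))
    rw [Equiv.symm_apply_apply, finSumFinEquiv_symm_apply_castAdd] at this
    rw [Matrix.mulVec_mulVec]
    refine Eq.trans ?_ (this.trans ?_)
    · rw [Matrix.mul_apply]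
      rfl
    · rcases finSumFinEquiv.symm (e.symm a) with x | x <;> simp
  have hcoord : ∀ (y : ι → ℂ) (j : Fin r), (V * A * U).mulVec y (e (Fin.natAdd s j)) =
      y (e (Fin.natAdd s j)) := fun y j => by
    rw [Matrix.mulVec, dotProduct, ← (finSumFinEquiv.trans e).sum_comp, Fintype.sum_sum_type]
    simp [hentry, Matrix.one_apply]
  refine ⟨U, e, hU, hker, fun k hk => ?_, fun hdet => ?_⟩
  · obtain ⟨U', hU'⟩ := hU.exists_right_inv
    set y := U'.mulVec k with hy
    have hky : k = U.mulVec y := by rw [hy, Matrix.mulVec_mulVec, hU', Matrix.one_mulVec]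
    have h0 : ∀ j : Fin r, y (e (Fin.natAdd s j)) = 0 := fun j => by
      rw [← hcoord y, ← Matrix.mulVec_mulVec, ← hky, ← Matrix.mulVec_mulVec, hk]
      simp
    refine ⟨fun j => y (e (Fin.castAdd r j)), ?_⟩
    rw [hky]
    ext i
    rw [Matrix.mulVec, dotProduct, ← (finSumFinEquiv.trans e).sum_comp, Fintype.sum_sum_type]
    simp [h0, mul_comm]
  -- A vector `w` killed by the complementary block, extended by zero, is killed by all of UᵀAU
  -- because symmetry makes the kernel rows zero. Then AUy = 0, while VAU reads off the last
  -- coordinates of y, so w = 0.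
  · obtain ⟨w, hw0, hw⟩ := Matrix.exists_mulVec_eq_zero_iff.2 hdet
    let y : ι → ℂ := fun i => Sum.elim 0 w (finSumFinEquiv.symm (e.symm i))
    have hy : ∀ j, y (e (Fin.natAdd s j)) = w j := fun j => by simp [y]
    have hy0 : ∀ j, y (e (Fin.castAdd r j)) = 0 := fun j => by simp [y]
    have hUAU : (U.transpose * A * U).mulVec y = 0 := by
      ext a
      obtain ⟨a, rfl⟩ := (finSumFinEquiv.trans e).surjective a
      rcases a with a | a
      · have h1 : ∀ b, (U.transpose * A * U) (e (Fin.castAdd r a)) b = 0 := fun b => by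
          have h2 : (U.transpose * A * U).transpose = U.transpose * A * U := by
            simp [Matrix.mul_assoc, hA.eq]
          rw [← h2, Matrix.transpose_apply, Matrix.mul_assoc, Matrix.mul_apply]
          refine Finset.sum_eq_zero fun c _ => ?_
          have := congrFun (hker a) c
          rw [Matrix.mul_apply]
          rw [Matrix.mulVec, dotProduct] at this
          rw [this]
          simp
        simp [Matrix.mulVec, dotProduct, h1]
      · have := congrFun hw a
        rw [Matrix.mulVec, dotProduct] at this
        rw [Matrix.mulVec, dotProduct, ← (finSumFinEquiv.trans e).sum_comp, Fintype.sum_sum_type]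
        simpa [hy, hy0] using this
    have h3 : A.mulVec (U.mulVec y) = 0 := by
      apply hUTinj
      rw [Matrix.mulVec_mulVec, Matrix.mulVec_mulVec, hUAU]
    apply hw0
    ext j
    rw [← hy, ← hcoord y, ← Matrix.mulVec_mulVec, ← Matrix.mulVec_mulVec, h3]
    simp

end Kernel

/-! ### Gradient and Hessian of a symmetric determinant at points of corank one and two. -/

section Symmetric

variable {ι : Type*} {m : ℕ}

/-- The matrix of the `i`-th partial derivatives at `v` of the entries of `A`. -/
def derivMat (A : Matrix ι ι (MvPolynomial (Fin m) ℂ)) (v : Fin m → ℂ) (i : Fin m) :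
    Matrix ι ι ℂ :=
  A.map fun p => eval v (pderiv i p)

theorem derivMat_isSymm {A : Matrix ι ι (MvPolynomial (Fin m) ℂ)} (hA : A.IsSymm)
    (v : Fin m → ℂ) (i : Fin m) : (derivMat A v i).IsSymm := by
  ext a b
  simp [derivMat, hA.apply]

variable [Fintype ι]

/-- The matrix `Uᵀ A U` for a matrix `A` of polynomials and a constant matrix `U`. -/
def conjMat (A : Matrix ι ι (MvPolynomial (Fin m) ℂ)) (U : Matrix ι ι ℂ) :
    Matrix ι ι (MvPolynomial (Fin m) ℂ) :=
  (U.map C).transpose * A * U.map C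

theorem conjMat_map_eval (A : Matrix ι ι (MvPolynomial (Fin m) ℂ)) (U : Matrix ι ι ℂ)
    (v : Fin m → ℂ) : (conjMat A U).map (eval v) = U.transpose * A.map (eval v) * U := by
  ext a b
  simp [conjMat, Matrix.mul_apply]

theorem derivMat_conjMat (A : Matrix ι ι (MvPolynomial (Fin m) ℂ)) (U : Matrix ι ι ℂ)
    (v : Fin m → ℂ) (i : Fin m) :
    derivMat (conjMat A U) v i = U.transpose * derivMat A v i * U := by
  ext a b
  simp [conjMat, derivMat, Matrix.mul_apply, Derivation.leibniz, mul_comm]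

/-- The value of the `i`-th partial derivative of `A` at `v`, as a symmetric bilinear form. -/
def derivForm (A : Matrix ι ι (MvPolynomial (Fin m) ℂ)) (v : Fin m → ℂ) (i : Fin m)
    (k k' : ι → ℂ) : ℂ :=
  dotProduct k ((derivMat A v i).mulVec k')

theorem derivForm_comm {A : Matrix ι ι (MvPolynomial (Fin m) ℂ)} (hA : A.IsSymm)
    (v : Fin m → ℂ) (i : Fin m) (k k' : ι → ℂ) : derivForm A v i k k' = derivForm A v i k' k := by
  rw [derivForm, derivForm, Matrix.dotProduct_mulVec, dotProduct_comm, ← Matrix.mulVec_transpose,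
    (derivMat_isSymm hA v i).eq]

theorem derivForm_smul_add {A : Matrix ι ι (MvPolynomial (Fin m) ℂ)} (hA : A.IsSymm)
    (v : Fin m → ℂ) (i : Fin m) (k k' : ι → ℂ) (s t : ℂ) :
    derivForm A v i (s • k + t • k') (s • k + t • k') = s ^ 2 * derivForm A v i k k +
      2 * s * t * derivForm A v i k k' + t ^ 2 * derivForm A v i k' k' := by
  have := derivForm_comm hA v i k k'
  simp only [derivForm, Matrix.mulVec_add, Matrix.mulVec_smul, dotProduct_add, add_dotProduct,
    smul_dotProduct, dotProduct_smul, smul_eq_mul] at this ⊢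
  linear_combination (-s * t) * this

theorem conj_apply_eq_derivForm (A : Matrix ι ι (MvPolynomial (Fin m) ℂ)) (U : Matrix ι ι ℂ)
    (v : Fin m → ℂ) (i : Fin m) (a b : ι) : eval v (pderiv i (conjMat A U a b)) =
      derivForm A v i (fun c => U c a) (fun c => U c b) := by
  have := congrFun (congrFun (derivMat_conjMat A U v i) a) b
  rw [derivMat, Matrix.map_apply] at this
  rw [this, derivForm, Matrix.mul_assoc, Matrix.mul_apply]
  rfl

theorem conj_apply_eq_zero {A : Matrix ι ι ℂ} (U : Matrix ι ι ℂ) {a : ι}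
    (h : A.mulVec (fun c => U c a) = 0) (b : ι) : (U.transpose * A * U) b a = 0 := by
  rw [Matrix.mul_assoc, Matrix.mul_apply]
  refine Finset.sum_eq_zero fun c _ => ?_
  have := congrFun h c
  rw [Matrix.mulVec, dotProduct] at this
  rw [Matrix.mul_apply, this]
  simp

theorem conjMat_isSymm {A : Matrix ι ι (MvPolynomial (Fin m) ℂ)} (hA : A.IsSymm)
    (U : Matrix ι ι ℂ) : (conjMat A U).IsSymm := by
  rw [Matrix.IsSymm, conjMat, Matrix.transpose_mul, Matrix.transpose_mul,
    Matrix.transpose_transpose, hA.eq, Matrix.mul_assoc]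

variable [DecidableEq ι]

theorem det_conjMat (A : Matrix ι ι (MvPolynomial (Fin m) ℂ)) (U : Matrix ι ι ℂ) :
    (conjMat A U).det = C (U.det ^ 2) * A.det := by
  have : (U.map (C : ℂ → MvPolynomial (Fin m) ℂ)).det = C U.det := by
    rw [RingHom.map_det]
    rfl
  rw [conjMat, Matrix.det_mul, Matrix.det_mul, Matrix.det_transpose, this, C_pow]
  ring

/-- At a point of corank one with kernel spanned by `k`, the gradient of the determinant is a
nonzero multiple of `kᵀ (∂ A) k`. -/
theorem exists_pderiv_det_eq (hι : Fintype.card ι = 4)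
    {A : Matrix ι ι (MvPolynomial (Fin m) ℂ)} (hA : A.IsSymm) {v : Fin m → ℂ}
    (hr : (A.map (eval v)).rank = 3) : ∃ (c : ℂ) (k : ι → ℂ), c ≠ 0 ∧ k ≠ 0 ∧
      (A.map (eval v)).mulVec k = 0 ∧
      ∀ i, eval v (pderiv i A.det) = c * derivForm A v i k k := by
  have hAs : (A.map (eval v)).IsSymm := hA.map _
  obtain ⟨U, e, hU, hk, -, hdet⟩ := exists_adapted_basis hAs hr (s := 1) (by omega)
  have hUdet : U.det ≠ 0 := ((Matrix.isUnit_iff_isUnit_det U).1 hU).ne_zero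
  have h0 : ∀ j, eval v ((conjMat A U).submatrix e e j 0) = 0 := fun j => by
    have := congrFun (congrFun (conjMat_map_eval A U v) (e j)) (e 0)
    rw [conj_apply_eq_zero U (show (A.map (eval v)).mulVec (fun c => U c (e 0)) = 0 from hk 0)] at this
    exact this
  have h0' : ∀ j, eval v ((conjMat A U).submatrix e e 0 j) = 0 := fun j => by
    rw [← h0 j, Matrix.submatrix_apply, (conjMat_isSymm hA U).apply]
    rfl
  have hmain := eval_pderiv_det_of_row_zero ((conjMat A U).submatrix e e) v h0' h0
  have hsub : (((conjMat A U).submatrix e e).map (eval v)).submatrix Fin.succ Fin.succ =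
      (U.transpose * A.map (eval v) * U).submatrix (fun j => e (Fin.natAdd 1 j))
        (fun j => e (Fin.natAdd 1 j)) := by
    rw [← conjMat_map_eval]
    ext a b
    have : ∀ a : Fin 3, Fin.natAdd 1 a = Fin.succ a := fun a => by
      ext
      simp [add_comm]
    simp [this]
  rw [hsub] at hmain
  set d := ((U.transpose * A.map (eval v) * U).submatrix (fun j => e (Fin.natAdd 1 j))
        (fun j => e (Fin.natAdd 1 j))).det
  -- The congruence by `U` multiplies the determinant by (det U)², which is divided out here.
  refine ⟨d / U.det ^ 2, fun c => U c (e 0), div_ne_zero hdet (pow_ne_zero 2 hUdet), ?_, hk 0,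
    fun i => ?_⟩
  · intro h
    apply hUdet
    exact Matrix.det_eq_zero_of_column_eq_zero (e 0) fun i => congrFun h i
  · have := hmain i
    rw [Matrix.det_submatrix_equiv_self, det_conjMat, eval_pderiv_mul, pderiv_C, map_zero, zero_mul,
      zero_add, eval_C, Matrix.submatrix_apply, conj_apply_eq_derivForm] at this
    field_simp
    linear_combination this

/-- A binary quadratic form of zero discriminant is the square of a linear form: the square roots of
a and b can be given matching signs. The case s = 0 is separate because t is otherwise −c/s. -/
theorem exists_sq_eq_of_mul_eq_sq {a b c : ℂ} (h : a * b = c ^ 2) :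
    ∃ s t : ℂ, s ^ 2 = b ∧ t ^ 2 = a ∧ s * t = -c := by
  obtain ⟨s, hs⟩ := IsAlgClosed.exists_pow_nat_eq b (n := 2) two_pos
  by_cases h0 : s = 0
  · obtain ⟨t, ht⟩ := IsAlgClosed.exists_pow_nat_eq a (n := 2) two_pos
    have hb : b = 0 := by rw [← hs, h0]; ring
    have hc : c = 0 := by
      rw [hb, mul_zero] at h
      exact pow_eq_zero_iff (two_ne_zero) |>.1 h.symm
    exact ⟨s, t, hs, ht, by simp [h0, hc]⟩
  · refine ⟨s, -c / s, hs, ?_, ?_⟩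
    · field_simp
      rw [← h, hs]
      ring
    · field_simp

/-- At a point of corank two at which the forms `kᵀ (∂ A) k`, for `k` in the kernel, have no common
zero, the determinant is singular and the kernel of its Hessian consists of the common zeros of all
those linear forms `z ↦ ∑ zᵢ kᵀ (∂ᵢ A) k`. -/
theorem det_singular_of_rank_two (hι : Fintype.card ι = 4)
    {A : Matrix ι ι (MvPolynomial (Fin m) ℂ)} (hA : A.IsSymm) {v : Fin m → ℂ}
    (hr : (A.map (eval v)).rank = 2)
    (hk : ∀ k, k ≠ 0 → (A.map (eval v)).mulVec k = 0 → ∃ i, derivForm A v i k k ≠ 0) :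
    eval v A.det = 0 ∧ (∀ i, eval v (pderiv i A.det) = 0) ∧
      ∀ z : Fin m → ℂ, (Matrix.of fun i j => eval v (pderiv i (pderiv j A.det))).mulVec z = 0 →
        ∀ k, (A.map (eval v)).mulVec k = 0 → ∑ i, z i * derivForm A v i k k = 0 := by
  have hAs : (A.map (eval v)).IsSymm := hA.map _
  obtain ⟨U, e, hU, hker, hspan, hdet⟩ := exists_adapted_basis hAs hr (s := 2) (by omega)
  have hUdet : U.det ≠ 0 := ((Matrix.isUnit_iff_isUnit_det U).1 hU).ne_zero
  have h0 : ∀ j, eval v ((conjMat A U).submatrix e e j 0) = 0 := fun j => by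
    have := congrFun (congrFun (conjMat_map_eval A U v) (e j)) (e 0)
    rw [conj_apply_eq_zero U
      (show (A.map (eval v)).mulVec (fun c => U c (e 0)) = 0 from hker 0)] at this
    exact this
  have h1 : ∀ j, eval v ((conjMat A U).submatrix e e j 1) = 0 := fun j => by
    have := congrFun (congrFun (conjMat_map_eval A U v) (e j)) (e 1)
    rw [conj_apply_eq_zero U
      (show (A.map (eval v)).mulVec (fun c => U c (e 1)) = 0 from hker 1)] at this
    exact this
  have hsymm : ((conjMat A U).submatrix e e).IsSymm := (conjMat_isSymm hA U).submatrix e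
  have h0' : ∀ j, eval v ((conjMat A U).submatrix e e 0 j) = 0 := fun j => by
    rw [← h0 j, hsymm.apply]
  have h1' : ∀ j, eval v ((conjMat A U).submatrix e e 1 j) = 0 := fun j => by
    rw [← h1 j, hsymm.apply]
  have hgrad := eval_pderiv_det_of_row_zero ((conjMat A U).submatrix e e) v h0' h0
  have hhess := eval_pderiv_det_of_rows_zero ((conjMat A U).submatrix e e) v h0' h0 h1' h1
  have hsub : (((conjMat A U).submatrix e e).map (eval v)).submatrix (Fin.natAdd 2) (Fin.natAdd 2) =
      (U.transpose * A.map (eval v) * U).submatrix (fun j => e (Fin.natAdd 2 j))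
        (fun j => e (Fin.natAdd 2 j)) := by
    rw [← conjMat_map_eval]
    rfl
  rw [hsub] at hhess
  set d := ((U.transpose * A.map (eval v) * U).submatrix (fun j => e (Fin.natAdd 2 j))
        (fun j => e (Fin.natAdd 2 j))).det
  set k₁ : ι → ℂ := fun c => U c (e 0) with hk₁
  set k₂ : ι → ℂ := fun c => U c (e 1) with hk₂
  refine ⟨?_, fun i => ?_, fun z hz k hAk => ?_⟩
  · have hdet0 : (A.map (eval v)).det = 0 := by
      refine Matrix.exists_mulVec_eq_zero_iff.1 ⟨k₁, fun h => hUdet ?_, hker 0⟩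
      exact Matrix.det_eq_zero_of_column_eq_zero (e 0) fun i => congrFun h i
    rw [RingHom.map_det]
    exact hdet0
  · have h2 : ((((conjMat A U).submatrix e e).map (eval v)).submatrix Fin.succ Fin.succ).det = 0 :=
      Matrix.det_eq_zero_of_row_eq_zero 0 fun j => h1' j.succ
    have := hgrad i
    rw [h2, mul_zero, Matrix.det_submatrix_equiv_self, det_conjMat, eval_pderiv_mul, pderiv_C,
      map_zero, zero_mul, zero_add, eval_C] at this
    exact (mul_eq_zero.1 this).resolve_left (pow_ne_zero 2 hUdet)
  · set α : Fin m → ℂ := fun i => derivForm A v i k₁ k₁ with hα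
    set β : Fin m → ℂ := fun i => derivForm A v i k₂ k₂ with hβ
    set γ : Fin m → ℂ := fun i => derivForm A v i k₁ k₂ with hγ
    -- Up to a nonzero factor the Hessian is the polarization of αβ − γ².
    have hH : ∀ i j, U.det ^ 2 * eval v (pderiv i (pderiv j A.det)) =
        d * (α i * β j + α j * β i - 2 * γ i * γ j) := fun i j => by
      have := hhess i j
      have hC : pderiv i (pderiv j (C (U.det ^ 2) * A.det))
          = C (U.det ^ 2) * pderiv i (pderiv j A.det) := by
        simp [Derivation.leibniz]
      simp only [Matrix.det_submatrix_equiv_self, det_conjMat, hC, Matrix.submatrix_apply,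
        conj_apply_eq_derivForm, map_mul, eval_C] at this
      rw [this]
      simp only [hα, hβ, hγ]
      rw [derivForm_comm hA v i (fun c => U c (e 1)) (fun c => U c (e 0)),
        derivForm_comm hA v j (fun c => U c (e 1)) (fun c => U c (e 0))]
      ring
    set a := ∑ j, z j * α j with ha
    set b := ∑ j, z j * β j with hb
    set g := ∑ j, z j * γ j with hg
    have hlin : ∀ i, b * α i + a * β i - 2 * g * γ i = 0 := fun i => by
      have h2 := congrFun hz i
      rw [Matrix.mulVec, dotProduct] at h2
      have h3 : d * (b * α i + a * β i - 2 * g * γ i) = 0 := by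
        calc d * (b * α i + a * β i - 2 * g * γ i)
            = ∑ j, d * (α i * β j + α j * β i - 2 * γ i * γ j) * z j := by
              rw [ha, hb, hg]
              simp only [Finset.sum_mul, Finset.mul_sum, mul_sub, mul_add,
                ← Finset.sum_add_distrib, ← Finset.sum_sub_distrib]
              exact Finset.sum_congr rfl fun j _ => by ring
          _ = U.det ^ 2 * ∑ j, eval v (pderiv i (pderiv j A.det)) * z j := by
              rw [Finset.mul_sum]
              exact Finset.sum_congr rfl fun j _ => by rw [← hH]; ring
          _ = 0 := by
              simp only [Matrix.of_apply, Pi.zero_apply] at h2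
              rw [h2, mul_zero]
      exact (mul_eq_zero.1 h3).resolve_left hdet
    -- Pairing the relation bα + aβ − 2gγ = 0 once more with `z` gives 2ab − 2g² = 0.
    have hab : a * b = g ^ 2 := by
      have h2 : ∑ i, z i * (b * α i + a * β i - 2 * g * γ i) = 0 :=
        Finset.sum_eq_zero fun i _ => by rw [hlin, mul_zero]
      have h3 : ∑ i, z i * (b * α i + a * β i - 2 * g * γ i) = b * a + a * b - 2 * g * g := by
        simp only [mul_sub, mul_add, Finset.sum_sub_distrib, Finset.sum_add_distrib,
          mul_left_comm (z _), ← Finset.mul_sum]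
        rw [← ha, ← hb, ← hg]
      rw [h3] at h2
      linear_combination h2 / 2
    obtain ⟨s, t, hs, ht, hst⟩ := exists_sq_eq_of_mul_eq_sq hab
    -- Since s² = b, t² = a and st = −g, the vanishing form bα + aβ − 2gγ is the derivative of A
    -- evaluated on the kernel vector sk₁ + tk₂. By `hk` that vector is zero, which forces a = b = g
    -- = 0.
    have hst0 : s • k₁ + t • k₂ = 0 := by
      by_contra hne
      obtain ⟨i, hi⟩ := hk _ hne (by
        rw [Matrix.mulVec_add, Matrix.mulVec_smul, Matrix.mulVec_smul]
        rw [show (A.map (eval v)).mulVec k₁ = 0 from hker 0,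
          show (A.map (eval v)).mulVec k₂ = 0 from hker 1]
        simp)
      apply hi
      rw [derivForm_smul_add hA]
      linear_combination hlin i + α i * hs + β i * ht + 2 * γ i * hst
    have hs0 : s = 0 ∧ t = 0 := by
      have h2 : U.mulVec (Pi.single (e 0) s + Pi.single (e 1) t) = 0 := by
        rw [Matrix.mulVec_add, Matrix.mulVec_single, Matrix.mulVec_single, ← hst0]
        ext c
        simp [hk₁, hk₂]
      have h3 : (Pi.single (e 0) s + Pi.single (e 1) t : ι → ℂ) = 0 := by
        by_contra hne
        exact hUdet (Matrix.exists_mulVec_eq_zero_iff.1 ⟨_, hne, h2⟩)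
      have hne : e 0 ≠ e 1 := fun h => by simpa using e.injective h
      have h4 := congrFun h3 (e 0)
      have h5 := congrFun h3 (e 1)
      simp [hne, hne.symm] at h4 h5
      exact ⟨h4, h5⟩
    have hb0 : b = 0 := by rw [← hs, hs0.1]; ring
    have ha0 : a = 0 := by rw [← ht, hs0.2]; ring
    have hg0 : g = 0 := by
      have := hst
      rw [hs0.1, zero_mul] at this
      linear_combination this
    obtain ⟨y, rfl⟩ := hspan k hAk
    rw [Fin.sum_univ_two]
    change ∑ i, z i * derivForm A v i (y 0 • k₁ + y 1 • k₂) (y 0 • k₁ + y 1 • k₂) = 0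
    have h2 : ∑ i, z i * derivForm A v i (y 0 • k₁ + y 1 • k₂) (y 0 • k₁ + y 1 • k₂) =
        y 0 ^ 2 * a + 2 * y 0 * y 1 * g + y 1 ^ 2 * b := by
      rw [ha, hb, hg]
      simp only [Finset.mul_sum, ← Finset.sum_add_distrib]
      exact Finset.sum_congr rfl fun j _ => by rw [derivForm_smul_add hA]; ring
    rw [h2, ha0, hb0, hg0]
    ring

end Symmetric

/-! ### Homogeneity -/

section Homogeneous

variable {m : ℕ}

theorem eval_smul_of_isHomogeneous {σ : Type*} [Fintype σ] {p : MvPolynomial σ ℂ} {n : ℕ}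
    (hp : p.IsHomogeneous n) (c : ℂ) (v : σ → ℂ) : eval (c • v) p = c ^ n * eval v p := by
  rw [eval_eq', eval_eq', Finset.mul_sum]
  refine Finset.sum_congr rfl fun d hd => ?_
  have hdeg : ∑ i, d i = n := by
    rw [← hp (mem_support_iff.1 hd), Finsupp.weight_apply, Finsupp.sum_fintype _ _ (by simp)]
    simp
  simp only [Pi.smul_apply, smul_eq_mul, mul_pow, Finset.prod_mul_distrib,
    Finset.prod_pow_eq_pow_sum, hdeg]
  ring

theorem sum_mul_eval_pderiv {p : MvPolynomial (Fin m) ℂ} {n : ℕ} (hp : p.IsHomogeneous n)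
    (v : Fin m → ℂ) : ∑ i, v i * eval v (pderiv i p) = n * eval v p := by
  have := congrArg (eval v) hp.sum_X_mul_pderiv
  simpa using this

theorem eval_zero_of_isHomogeneous {p : MvPolynomial (Fin m) ℂ} {n : ℕ} (hp : p.IsHomogeneous n)
    (hn : n ≠ 0) : eval 0 p = 0 := by
  have := eval_smul_of_isHomogeneous hp 0 0
  rwa [zero_smul, zero_pow hn, zero_mul] at this

theorem eval_eq_of_isHomogeneous_zero {p : MvPolynomial (Fin m) ℂ} (hp : p.IsHomogeneous 0)
    (v w : Fin m → ℂ) : eval v p = eval w p := by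
  have h1 := eval_smul_of_isHomogeneous hp 0 v
  have h2 := eval_smul_of_isHomogeneous hp 0 w
  simp only [zero_smul, pow_zero, one_mul] at h1 h2
  rw [← h1, h2]

/-- Rescaling v multiplies the matrix on both sides by invertible diagonal matrices, because the
degree of an entry is a row weight plus a column weight. -/
theorem rank_map_eval_smul {d : ℕ} {A : Matrix (Fin 3 ⊕ Unit) (Fin 3 ⊕ Unit) (MvPolynomial (Fin m) ℂ)}
    (hA : A ∈ symForms m d) {c : ℂ} (hc : c ≠ 0) (v : Fin m → ℂ) :
    (A.map (eval (c • v))).rank = (A.map (eval v)).rank := by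
  have : A.map (eval (c • v)) = Matrix.diagonal (fun i => c ^ (d + twist i)) * A.map (eval v) *
      Matrix.diagonal (fun i => c ^ twist i) := by
    ext i j
    rw [Matrix.mul_diagonal, Matrix.diagonal_mul, Matrix.map_apply, Matrix.map_apply,
      eval_smul_of_isHomogeneous (hA.2 i j)]
    ring
  rw [this, Matrix.rank_mul_eq_left_of_det_ne_zero, Matrix.rank_mul_eq_right_of_det_ne_zero]
  all_goals
    rw [Matrix.det_diagonal]
    exact Finset.prod_ne_zero_iff.2 fun i _ => pow_ne_zero _ hc

theorem det_isHomogeneous {d : ℕ} {A : Matrix (Fin 3 ⊕ Unit) (Fin 3 ⊕ Unit) (MvPolynomial (Fin m) ℂ)}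
    (hA : A ∈ symForms m d) : A.det.IsHomogeneous (4 * d + 2) := by
  rw [Matrix.det_apply]
  refine IsHomogeneous.sum _ _ _ fun σ _ => ?_
  have h : (∏ i, A (σ i) i).IsHomogeneous (∑ i, (d + twist (σ i) + twist i)) :=
    IsHomogeneous.prod _ _ _ fun i _ => hA.2 _ _
  have hs : ∑ i, (d + twist (σ i) + twist i) = 4 * d + 2 := by
    rw [Finset.sum_add_distrib, Finset.sum_add_distrib, Equiv.sum_comp σ twist]
    simp [twist]
  rw [hs] at h
  rcases Int.units_eq_one_or (Equiv.Perm.sign σ) with hσ | hσ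
  · simpa [hσ] using h
  · simpa [hσ] using h.neg

/-- The condition for `v` to represent an ordinary double point of `{G = 0}`. -/
def IsNodeAt {n : ℕ} (G : MvPolynomial (Fin (n + 1)) ℂ) (v : Fin (n + 1) → ℂ) : Prop :=
  eval v G = 0 ∧ (∀ i, eval v (pderiv i G) = 0) ∧
    (Matrix.of fun i j => eval v (pderiv i (pderiv j G))).rank = n

theorem IsNodeAt.smul {n d : ℕ} {G : MvPolynomial (Fin (n + 1)) ℂ} (hG : G.IsHomogeneous d)
    {v : Fin (n + 1) → ℂ} (h : IsNodeAt G v) {c : ℂ} (hc : c ≠ 0) : IsNodeAt G (c • v) := by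
  refine ⟨?_, fun i => ?_, ?_⟩
  · rw [eval_smul_of_isHomogeneous hG, h.1, mul_zero]
  · rw [eval_smul_of_isHomogeneous hG.pderiv, h.2.1, mul_zero]
  · refine Eq.trans ?_ h.2.2
    have : (Matrix.of fun i j => eval (c • v) (pderiv i (pderiv j G))) =
        c ^ (d - 1 - 1) • Matrix.of fun i j => eval v (pderiv i (pderiv j G)) := by
      ext i j
      simp only [Matrix.of_apply, Matrix.smul_apply, smul_eq_mul]
      exact eval_smul_of_isHomogeneous hG.pderiv.pderiv c v
    rw [this, Matrix.rank_smul_of_mem_nonZeroDivisors]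
    exact mem_nonZeroDivisors_of_ne_zero (pow_ne_zero _ hc)

end Homogeneous

/-! ### Smoothness of the cubic and the derivative of the matrix on its kernel -/

section Smooth

variable {m : ℕ} {A : Matrix (Fin 3 ⊕ Unit) (Fin 3 ⊕ Unit) (MvPolynomial (Fin m) ℂ)}

theorem pderiv_inr_rename_inl {σ τ : Type*} (k : τ) (p : MvPolynomial σ ℂ) :
    pderiv (Sum.inr k : σ ⊕ τ) (rename Sum.inl p) = 0 := by
  classical
  refine pderiv_eq_zero_of_notMem_vars fun h => ?_
  have := vars_rename _ _ h
  simp at this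

theorem eval_elim_rename_inl {σ τ : Type*} (x : σ → ℂ) (y : τ → ℂ) (p : MvPolynomial σ ℂ) :
    eval (Sum.elim x y) (rename Sum.inl p) = eval x p := by
  rw [eval_rename, Sum.elim_comp_inl]

theorem cubicForm_isHomogeneous (hA : A ∈ symForms m 1) : (cubicForm A).IsHomogeneous 3 := by
  refine IsHomogeneous.add (IsHomogeneous.add ?_ ?_) ?_
  · refine IsHomogeneous.sum _ _ _ fun i _ => IsHomogeneous.sum _ _ _ fun j _ => ?_
    exact ((hA.2 _ _).rename_isHomogeneous.mul (isHomogeneous_X _ _)).mul (isHomogeneous_X _ _)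
  · have h : (∑ k : Fin 3, rename Sum.inl (A (Sum.inl k) (Sum.inr ())) * X (Sum.inr k) :
        MvPolynomial (Fin m ⊕ Fin 3) ℂ).IsHomogeneous 3 :=
      IsHomogeneous.sum _ _ _ fun k _ => (hA.2 _ _).rename_isHomogeneous.mul (isHomogeneous_X _ _)
    exact h.C_mul 2
  · exact (hA.2 _ _).rename_isHomogeneous

theorem inr_inl_eq (hA : A.IsSymm) (k : Fin 3) :
    A (Sum.inr ()) (Sum.inl k) = A (Sum.inl k) (Sum.inr ()) :=
  hA.apply _ _

/-- The cubic is a quadratic form in (y, 1) whose coefficients depend on x. This is the link between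
its singular points and kernel vectors of the matrix. -/
theorem eval_cubicForm (hA : A.IsSymm) (x : Fin m → ℂ) (y : Fin 3 → ℂ) :
    eval (Sum.elim x y) (cubicForm A) =
      dotProduct (Sum.elim y 1) ((A.map (eval x)).mulVec (Sum.elim y 1)) := by
  simp only [cubicForm, map_add, map_mul, eval_elim_rename_inl, eval_X, Sum.elim_inr,
    map_ofNat, dotProduct, Matrix.mulVec, Fintype.sum_sum_type, Sum.elim_inl, Matrix.map_apply,
    Pi.one_apply, Finset.univ_unique, Finset.sum_singleton, PUnit.default_eq_unit, mul_one, one_mul,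
    Fin.sum_univ_three, inr_inl_eq hA]
  ring

theorem eval_pderiv_inl_cubicForm (hA : A.IsSymm) (x : Fin m → ℂ) (y : Fin 3 → ℂ) (i : Fin m) :
    eval (Sum.elim x y) (pderiv (Sum.inl i) (cubicForm A)) =
      derivForm A x i (Sum.elim y 1) (Sum.elim y 1) := by
  have hX : ∀ k : Fin 3, pderiv (Sum.inl i : Fin m ⊕ Fin 3)
      (X (Sum.inr k) : MvPolynomial (Fin m ⊕ Fin 3) ℂ) = 0 := fun k =>
    pderiv_X_of_ne (by simp)
  have h2 : pderiv (Sum.inl i : Fin m ⊕ Fin 3) (2 : MvPolynomial (Fin m ⊕ Fin 3) ℂ) = 0 := by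
    exact_mod_cast (pderiv (Sum.inl i : Fin m ⊕ Fin 3)).map_natCast 2
  simp only [cubicForm, map_add, Derivation.leibniz, smul_eq_mul, hX, h2, mul_zero,
    zero_add, add_zero, pderiv_rename Sum.inl_injective, map_mul, eval_elim_rename_inl, eval_X,
    Sum.elim_inr, map_ofNat, derivForm, derivMat, dotProduct, Matrix.mulVec, Fintype.sum_sum_type,
    Sum.elim_inl, Matrix.map_apply, Pi.one_apply, Finset.univ_unique, Finset.sum_singleton,
    PUnit.default_eq_unit, mul_one, one_mul, Fin.sum_univ_three]
  simp only [inr_inl_eq hA]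
  ring

theorem eval_pderiv_inr_cubicForm (hA : A.IsSymm) (x : Fin m → ℂ) (y : Fin 3 → ℂ) (k : Fin 3) :
    eval (Sum.elim x y) (pderiv (Sum.inr k) (cubicForm A)) =
      2 * (A.map (eval x)).mulVec (Sum.elim y 1) (Sum.inl k) := by
  have hX : ∀ j : Fin 3, pderiv (Sum.inr k : Fin m ⊕ Fin 3)
      (X (Sum.inr j) : MvPolynomial (Fin m ⊕ Fin 3) ℂ) = if j = k then 1 else 0 := fun j => by
    rw [pderiv_X, Pi.single_apply]
    simp
  have h2 : pderiv (Sum.inr k : Fin m ⊕ Fin 3) (2 : MvPolynomial (Fin m ⊕ Fin 3) ℂ) = 0 := by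
    exact_mod_cast (pderiv (Sum.inr k : Fin m ⊕ Fin 3)).map_natCast 2
  simp only [cubicForm, map_add, Derivation.leibniz, smul_eq_mul, hX, h2, mul_zero,
    add_zero, pderiv_inr_rename_inl, map_mul, eval_elim_rename_inl, eval_X,
    Sum.elim_inr, map_ofNat, Matrix.mulVec, dotProduct, Fintype.sum_sum_type,
    Sum.elim_inl, Matrix.map_apply, Pi.one_apply, Finset.univ_unique, Finset.sum_singleton,
    PUnit.default_eq_unit, mul_one, Fin.sum_univ_three]
  have h10 := hA.apply (Sum.inl 0) (Sum.inl 1)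
  have h20 := hA.apply (Sum.inl 0) (Sum.inl 2)
  have h21 := hA.apply (Sum.inl 1) (Sum.inl 2)
  fin_cases k <;> simp [h10, h20, h21] <;> ring

end Smooth

/-! ### Consequences of smoothness: corank two and the criterion for nodes. -/

section Tangent

variable {m : ℕ} {A : Matrix (Fin 3 ⊕ Unit) (Fin 3 ⊕ Unit) (MvPolynomial (Fin m) ℂ)}

/-- Smoothness at the points of the plane `{x = 0}`. -/
theorem exists_derivForm_inl_ne_zero (hA : A ∈ symForms m 1)
    (hY : IsSmoothHypersurface (cubicForm A)) {a : Fin 3 → ℂ} (ha : a ≠ 0) (v : Fin m → ℂ) :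
    ∃ i, derivForm A v i (Sum.elim a 0) (Sum.elim a 0) ≠ 0 := by
  have h0 : A.map (eval 0) = 0 := by
    ext i j
    exact eval_zero_of_isHomogeneous (hA.2 i j) (by omega)
  obtain ⟨j, hj⟩ := hY (Sum.elim 0 a) (fun h => ha (by
      ext k
      simpa using congrFun h (Sum.inr k))) (by rw [eval_cubicForm hA.1, h0]; simp)
  rcases j with i | k
  · refine ⟨i, ?_⟩
    rw [eval_pderiv_inl_cubicForm hA.1] at hj
    convert hj using 1
    -- The derivatives of the linear entries are constants, so they may be read at `v` instead of 0.
    -- The derivatives of the other entries vanish at 0 for degree reasons, which is why (a, 1) at 0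
    -- can be replaced by (a, 0) at `v`.
    have hl : ∀ k l, eval v (pderiv i (A (Sum.inl k) (Sum.inl l))) =
        eval 0 (pderiv i (A (Sum.inl k) (Sum.inl l))) := fun k l =>
      eval_eq_of_isHomogeneous_zero (hA.2 (Sum.inl k) (Sum.inl l)).pderiv _ _
    have hq : ∀ k, eval 0 (pderiv i (A k (Sum.inr ()))) = 0 := fun k =>
      eval_zero_of_isHomogeneous (hA.2 _ _).pderiv (by simp [twist])
    have hq' : ∀ k, eval 0 (pderiv i (A (Sum.inr ()) k)) = 0 := fun k =>
      eval_zero_of_isHomogeneous (hA.2 _ _).pderiv (by simp [twist])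
    simp only [derivForm, derivMat, dotProduct, Matrix.mulVec, Fintype.sum_sum_type,
      Matrix.map_apply, Finset.univ_unique, PUnit.default_eq_unit, hl, hq, hq',
      Sum.elim_inl, Sum.elim_inr, zero_mul, mul_zero, Pi.zero_apply, Finset.sum_const_zero,
      add_zero]
  · rw [eval_pderiv_inr_cubicForm hA.1, h0] at hj
    simp at hj

/-- Smoothness of the cubic means that the derivative of the quadratic form `A` does not vanish on
any nonzero vector of its kernel. -/
theorem exists_derivForm_ne_zero (hA : A ∈ symForms m 1)
    (hY : IsSmoothHypersurface (cubicForm A)) {v : Fin m → ℂ} (hv : v ≠ 0)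
    {k : Fin 3 ⊕ Unit → ℂ} (hk : k ≠ 0) (hAk : (A.map (eval v)).mulVec k = 0) :
    ∃ i, derivForm A v i k k ≠ 0 := by
  by_cases hlast : k (Sum.inr ()) = 0
  · have hk' : k = Sum.elim (fun i => k (Sum.inl i)) 0 := by
      ext (i | i)
      · rfl
      · exact hlast
    rw [hk']
    refine exists_derivForm_inl_ne_zero hA hY (fun h => hk ?_) v
    rw [hk', h]
    ext (i | i) <;> rfl
  · set c := k (Sum.inr ()) with hc
    set y : Fin 3 → ℂ := fun i => c⁻¹ * k (Sum.inl i) with hy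
    have hk' : k = c • Sum.elim y 1 := by
      ext (i | i)
      · simp [hy, hlast]
      · simp [hc]
    have hAy : (A.map (eval v)).mulVec (Sum.elim y 1) = 0 := by
      rw [hk', Matrix.mulVec_smul] at hAk
      exact (smul_eq_zero.1 hAk).resolve_left hlast
    obtain ⟨j, hj⟩ := hY (Sum.elim v y) (fun h => hv (by
      ext k
      simpa using congrFun h (Sum.inl k))) (by rw [eval_cubicForm hA.1, hAy, dotProduct_zero])
    rcases j with i | l
    · refine ⟨i, ?_⟩
      rw [eval_pderiv_inl_cubicForm hA.1] at hj
      rw [hk', derivForm, Matrix.mulVec_smul, smul_dotProduct, dotProduct_smul]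
      exact smul_ne_zero hlast (smul_ne_zero hlast hj)
    · rw [eval_pderiv_inr_cubicForm hA.1, hAy] at hj
      simp at hj

/-- Euler's relation on the kernel. -/
theorem sum_mul_derivForm (hA : A ∈ symForms m 1) {v : Fin m → ℂ} {k : Fin 3 ⊕ Unit → ℂ}
    (hAk : (A.map (eval v)).mulVec k = 0) : ∑ i, v i * derivForm A v i k k = 0 := by
  have hAk' : ∀ a, ∑ b, eval v (A a b) * k b = 0 := fun a => congrFun hAk a
  have hAk'' : ∀ b, ∑ a, eval v (A a b) * k a = 0 := fun b => by
    rw [← hAk' b]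
    exact Finset.sum_congr rfl fun a _ => by rw [hA.1.apply]
  calc ∑ i, v i * derivForm A v i k k
      = ∑ a, ∑ b, k a * k b * ∑ i, v i * eval v (pderiv i (A a b)) := by
        simp only [derivForm, derivMat, dotProduct, Matrix.mulVec, Matrix.map_apply, Finset.mul_sum]
        rw [Finset.sum_comm]
        refine Finset.sum_congr rfl fun a _ => ?_
        rw [Finset.sum_comm]
        exact Finset.sum_congr rfl fun b _ => Finset.sum_congr rfl fun i _ => by ring
    -- The degree 1 + twist a + twist b splits into a row part and a column part; each resulting
    -- double sum contains A applied to k.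
    _ = ∑ a, ∑ b, ((1 + twist a) * k a * (eval v (A a b) * k b) +
          twist b * k b * (eval v (A a b) * k a)) := by
        refine Finset.sum_congr rfl fun a _ => Finset.sum_congr rfl fun b _ => ?_
        rw [sum_mul_eval_pderiv (hA.2 a b)]
        push_cast
        ring
    _ = 0 := by
        simp only [Finset.sum_add_distrib]
        rw [Finset.sum_comm (f := fun a b => (twist b : ℂ) * k b * (eval v (A a b) * k a))]
        simp only [← Finset.mul_sum, hAk', hAk'', mul_zero, Finset.sum_const_zero, add_zero]

/-- The quadratic forms `kᵀ (∂ᵢ A) k` on the kernel have a common zero if there are fewer of them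
than the dimension of the kernel. -/
theorem exists_derivForm_eq_zero (A : Matrix (Fin 3 ⊕ Unit) (Fin 3 ⊕ Unit) (MvPolynomial (Fin m) ℂ))
    (v : Fin m → ℂ) (s : Finset (Fin m)) (hs : s.card + (A.map (eval v)).rank < 4) :
    ∃ k, k ≠ 0 ∧ (A.map (eval v)).mulVec k = 0 ∧ ∀ i ∈ s, derivForm A v i k k = 0 := by
  classical
  set K := LinearMap.ker (A.map (eval v)).mulVecLin with hK
  have hdim : (A.map (eval v)).rank + Module.finrank ℂ K = 4 := by
    have := LinearMap.finrank_range_add_finrank_ker (A.map (eval v)).mulVecLin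
    simpa [Matrix.rank] using this
  let b := Module.finBasis ℂ K
  let q : Fin m → MvPolynomial (Fin (Module.finrank ℂ K)) ℂ := fun i =>
    ∑ c, ∑ d, C (derivForm A v i (b c) (b d)) * X c * X d
  obtain ⟨y, hy, hq⟩ := exists_ne_zero_common_zero (s.image q) (by simp [q])
    (Finset.card_image_le.trans_lt (by omega))
  refine ⟨((∑ c, y c • b c : K) : Fin 3 ⊕ Unit → ℂ), fun h => hy ?_, ?_, fun i hi => ?_⟩
  · have h' : ∑ c, y c • b c = 0 := Subtype.ext h
    ext c
    exact Fintype.linearIndependent_iff.1 b.linearIndependent y h' c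
  · exact (∑ c, y c • b c : K).2
  · rw [← hq (q i) (Finset.mem_image_of_mem q hi)]
    simp only [q, map_sum, map_mul, eval_C, eval_X, derivForm, Submodule.coe_sum, Submodule.coe_smul,
      Matrix.mulVec_sum, Matrix.mulVec_smul, dotProduct_sum, sum_dotProduct, smul_dotProduct,
      dotProduct_smul, smul_eq_mul, Finset.mul_sum]
    rw [Finset.sum_comm]
    exact Finset.sum_congr rfl fun c _ => Finset.sum_congr rfl fun d _ => by ring

/-- A singular point of the discriminant of a smooth cubic is a point of rank at most two. -/
theorem rank_le_two_of_pderiv_det_eq_zero (hA : A ∈ symForms m 1)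
    (hY : IsSmoothHypersurface (cubicForm A)) {v : Fin m → ℂ} (hv : v ≠ 0)
    (h : ∀ i, eval v (pderiv i A.det) = 0) : (A.map (eval v)).rank ≤ 2 := by
  have hle : (A.map (eval v)).rank ≤ 4 := by
    simpa using Matrix.rank_le_card_width (A.map (eval v))
  by_contra hr
  have hcase : (A.map (eval v)).rank = 3 ∨ (A.map (eval v)).rank = 4 := by omega
  rcases hcase with h3 | h4
  · obtain ⟨c, k, hc, hk, hAk, hd⟩ := exists_pderiv_det_eq (by simp) hA.1 h3
    obtain ⟨i, hi⟩ := exists_derivForm_ne_zero hA hY hv hk hAk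
    exact mul_ne_zero hc hi ((hd i).symm.trans (h i))
  · have h0 : eval v A.det = 0 := by
      have := sum_mul_eval_pderiv (det_isHomogeneous hA) v
      simp only [h, mul_zero, Finset.sum_const_zero] at this
      exact (mul_eq_zero.1 this.symm).resolve_left (by norm_num)
    rw [RingHom.map_det] at h0
    obtain ⟨k, hk, hAk⟩ := Matrix.exists_mulVec_eq_zero_iff.2 h0
    have hdim := LinearMap.finrank_range_add_finrank_ker (A.map (eval v)).mulVecLin
    have hr4 : Module.finrank ℂ (LinearMap.range (A.map (eval v)).mulVecLin) = 4 := h4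
    rw [hr4] at hdim
    have hker : LinearMap.ker (A.map (eval v)).mulVecLin = ⊥ := by
      apply Submodule.finrank_eq_zero.1
      simpa using hdim
    exact hk ((LinearMap.ker_eq_bot'.1 hker) k hAk)

theorem pderiv_pderiv_comm {σ : Type*} (i j : σ) (p : MvPolynomial σ ℂ) :
    pderiv i (pderiv j p) = pderiv j (pderiv i p) := by
  classical
  have h : ⁅(pderiv i : Derivation ℂ (MvPolynomial σ ℂ) (MvPolynomial σ ℂ)),
      (pderiv j : Derivation ℂ (MvPolynomial σ ℂ) (MvPolynomial σ ℂ))⁆ = 0 := by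
    refine derivation_ext fun k => ?_
    rw [Derivation.commutator_apply, pderiv_X, pderiv_X, Pi.single_apply, Pi.single_apply]
    split_ifs <;> simp
  have := congrArg (fun D : Derivation ℂ (MvPolynomial σ ℂ) (MvPolynomial σ ℂ) => D p) h
  rw [Derivation.commutator_apply] at this
  exact sub_eq_zero.1 this

/-- A sufficient condition for a point of rank two to be a node of the discriminant. -/
theorem isNodeAt_det {n : ℕ}
    {A : Matrix (Fin 3 ⊕ Unit) (Fin 3 ⊕ Unit) (MvPolynomial (Fin (n + 1)) ℂ)}
    (hA : A ∈ symForms (n + 1) 1) (hY : IsSmoothHypersurface (cubicForm A))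
    {v : Fin (n + 1) → ℂ} (hv : v ≠ 0) (hr : (A.map (eval v)).rank = 2)
    (h : ∀ z : Fin (n + 1) → ℂ, (∀ k, (A.map (eval v)).mulVec k = 0 →
      ∑ i, z i * derivForm A v i k k = 0) → ∃ c : ℂ, z = c • v) : IsNodeAt A.det v := by
  obtain ⟨h0, h1, h2⟩ := det_singular_of_rank_two (by simp) hA.1 hr
    fun k hk hAk => exists_derivForm_ne_zero hA hY hv hk hAk
  refine ⟨h0, h1, ?_⟩
  set H : Matrix (Fin (n + 1)) (Fin (n + 1)) ℂ :=
    Matrix.of fun i j => eval v (pderiv i (pderiv j A.det)) with hH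
  -- The kernel of the Hessian always contains `v`, by Euler's relation for the first derivatives;
  -- the hypothesis leaves nothing else, and rank-nullity gives rank n.
  have hker : LinearMap.ker H.mulVecLin = Submodule.span ℂ {v} := by
    apply le_antisymm
    · intro z hz
      obtain ⟨c, rfl⟩ := h z (h2 z hz)
      exact Submodule.smul_mem _ _ (Submodule.mem_span_singleton_self v)
    · rw [Submodule.span_singleton_le_iff_mem, LinearMap.mem_ker, Matrix.mulVecLin_apply]
      ext i
      have := sum_mul_eval_pderiv ((det_isHomogeneous hA).pderiv (i := i)) v
      rw [h1, mul_zero] at this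
      rw [Matrix.mulVec, dotProduct, Pi.zero_apply, ← this]
      refine Finset.sum_congr rfl fun j _ => ?_
      rw [hH, Matrix.of_apply, mul_comm, pderiv_pderiv_comm]
  have hdim := LinearMap.finrank_range_add_finrank_ker H.mulVecLin
  rw [hker, finrank_span_singleton hv, Module.finrank_fin_fun] at hdim
  exact Nat.add_right_cancel hdim

end Tangent

/-! ### The plane sextic -/

section Plane

variable {M : Matrix (Fin 3 ⊕ Unit) (Fin 3 ⊕ Unit) (MvPolynomial (Fin 3) ℂ)}

/-- On a kernel of dimension at least three, two of the three quadratic forms kᵀ(∂ᵢM)k have a common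
nonzero zero. Euler's relation with vᵢ ≠ 0 makes the third vanish as well, against smoothness. -/
theorem two_le_rank (hM : M ∈ symForms 3 1) (hY : IsSmoothHypersurface (cubicForm M))
    {v : Fin 3 → ℂ} (hv : v ≠ 0) : 2 ≤ (M.map (eval v)).rank := by
  by_contra hr
  obtain ⟨i, hi⟩ : ∃ i, v i ≠ 0 := Function.ne_iff.1 hv
  obtain ⟨k, hk, hMk, h⟩ := exists_derivForm_eq_zero M v (Finset.univ.erase i) (by
    rw [Finset.card_erase_of_mem (Finset.mem_univ i)]
    simp
    omega)
  obtain ⟨j, hj⟩ := exists_derivForm_ne_zero hM hY hv hk hMk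
  by_cases hij : j = i
  · subst hij
    have := sum_mul_derivForm hM hMk
    rw [Finset.sum_eq_single j (fun b _ hb => by rw [h b (by simp [hb]), mul_zero]) (by simp)] at this
    exact mul_ne_zero hi hj this
  · exact hj (h j (by simp [hij]))

/-- Two independent vectors in ℂ³ have a one-dimensional annihilator, on which some coordinate is
nonzero. -/
theorem exists_coordinate_of_not_smul {z v : Fin 3 → ℂ} (hv : v ≠ 0) (hz : ∀ c : ℂ, z ≠ c • v) :
    ∃ i, ∀ q : Fin 3 → ℂ, ∑ j, z j * q j = 0 → ∑ j, v j * q j = 0 → q i = 0 → q = 0 := by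
  by_contra! hcon
  have hc : ∀ i j, z i * v j = z j * v i := by
    have key : ∀ i j l : Fin 3, (∀ f : Fin 3 → ℂ, ∑ a, f a = f i + f j + f l) →
        (∀ f : Fin 3 → ℂ, f i = 0 → f j = 0 → f l = 0 → f = 0) → z i * v j = z j * v i := by
      intro i j l hsum hzero
      obtain ⟨q, h1, h2, h3, h4⟩ := hcon l
      rw [hsum] at h1 h2
      simp only [h3, mul_zero, add_zero] at h1 h2
      by_contra hne
      have hne' : z i * v j - z j * v i ≠ 0 := sub_ne_zero.2 hne
      refine h4 (hzero q ?_ ?_ h3)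
      · refine (mul_eq_zero.1 (?_ : (z i * v j - z j * v i) * q i = 0)).resolve_left hne'
        linear_combination v j * h1 - z j * h2
      · refine (mul_eq_zero.1 (?_ : (z i * v j - z j * v i) * q j = 0)).resolve_left hne'
        linear_combination z i * h2 - v i * h1
    have h01 := key 0 1 2 (fun f => by rw [Fin.sum_univ_three]) (fun f h0 h1 h2 => by
      ext a; fin_cases a <;> assumption)
    have h02 := key 0 2 1 (fun f => by rw [Fin.sum_univ_three]; ring) (fun f h0 h1 h2 => by
      ext a; fin_cases a <;> assumption)
    have h12 := key 1 2 0 (fun f => by rw [Fin.sum_univ_three]; ring) (fun f h0 h1 h2 => by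
      ext a; fin_cases a <;> assumption)
    intro i j
    fin_cases i <;> fin_cases j <;> first | rfl | assumption | exact Eq.symm (by assumption)
  obtain ⟨j, hj⟩ : ∃ j, v j ≠ 0 := Function.ne_iff.1 hv
  apply hz (z j / v j)
  ext i
  rw [Pi.smul_apply, smul_eq_mul, div_mul_eq_mul_div, eq_div_iff hj]
  exact hc i j

/-- A kernel of dimension at least two contains k ≠ 0 at which one chosen form kᵀ(∂ᵢM)k vanishes. If
z and v were independent, the vector of all three values, orthogonal to both, would be zero for a
suitable i, against smoothness. -/
theorem exists_smul_of_sum_derivForm (hM : M ∈ symForms 3 1)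
    (hY : IsSmoothHypersurface (cubicForm M)) {v : Fin 3 → ℂ} (hv : v ≠ 0)
    (hr : (M.map (eval v)).rank ≤ 2) (z : Fin 3 → ℂ) (hz : ∀ k, (M.map (eval v)).mulVec k = 0 →
      ∑ i, z i * derivForm M v i k k = 0) : ∃ c : ℂ, z = c • v := by
  by_contra! hcon
  obtain ⟨i, hi⟩ := exists_coordinate_of_not_smul hv hcon
  obtain ⟨k, hk, hMk, h⟩ := exists_derivForm_eq_zero M v {i} (by
    rw [Finset.card_singleton]
    omega)
  obtain ⟨j, hj⟩ := exists_derivForm_ne_zero hM hY hv hk hMk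
  exact hj (congrFun (hi (fun i => derivForm M v i k k) (hz k hMk) (sum_mul_derivForm hM hMk)
    (h i (by simp))) j)

theorem isNodeAt_det_iff (hM : M ∈ symForms 3 1) (hY : IsSmoothHypersurface (cubicForm M))
    {v : Fin 3 → ℂ} (hv : v ≠ 0) :
    IsNodeAt (n := 2) M.det v ↔ (M.map (eval v)).rank ≤ 2 := by
  refine ⟨fun h => rank_le_two_of_pderiv_det_eq_zero hM hY hv h.2.1, fun h => ?_⟩
  exact isNodeAt_det (n := 2) hM hY hv (le_antisymm h (two_le_rank hM hY hv))
    (exists_smul_of_sum_derivForm hM hY hv h)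

end Plane

/-! ### Finiteness of nodes -/

section Finite

open Topology Filter

variable {n : ℕ}

/-- The differential at `v` of a polynomial function. -/
def evalDeriv (p : MvPolynomial (Fin n) ℂ) (v : Fin n → ℂ) : (Fin n → ℂ) →L[ℂ] ℂ :=
  ∑ i, eval v (pderiv i p) • ContinuousLinearMap.proj i

theorem hasFDerivAt_eval (p : MvPolynomial (Fin n) ℂ) (v : Fin n → ℂ) :
    HasFDerivAt (fun w => eval w p) (evalDeriv p v) v := by
  induction p using MvPolynomial.induction_on with
  | C a =>
    have h : evalDeriv (C a) v = 0 := by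
      ext z
      simp [evalDeriv]
    simp only [h, eval_C]
    exact hasFDerivAt_const a v
  | add p q hp hq =>
    have h : evalDeriv (p + q) v = evalDeriv p v + evalDeriv q v := by
      ext z
      simp [evalDeriv, add_mul, Finset.sum_add_distrib]
    simp only [h, map_add]
    exact hp.add hq
  | mul_X p i hp =>
    have h : evalDeriv (p * X i) v =
        eval v p • ContinuousLinearMap.proj i + v i • evalDeriv p v := by
      have hp : ∀ j, eval v (pderiv j (p * X i)) = eval v p * (if j = i then 1 else 0) +
          v i * eval v (pderiv j p) := fun j => by
        rw [eval_pderiv_mul, pderiv_X, Pi.single_apply, eval_X]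
        split_ifs with h1 h2 h2
        · simp [mul_comm, add_comm]
        · exact absurd h1.symm h2
        · exact absurd h2.symm h1
        · simp [mul_comm]
      ext z
      simp only [evalDeriv, hp]
      simp [add_mul, Finset.sum_add_distrib, Finset.mul_sum, mul_assoc]
    simp only [h, map_mul, eval_X]
    exact hp.mul (hasFDerivAt_apply (𝕜 := ℂ) i v)

/-- A hypersurface all of whose singular points are nodes has finitely many singular points. -/
theorem finite_singular {d : ℕ} {G : MvPolynomial (Fin (n + 1)) ℂ} (hG : G.IsHomogeneous d)
    (h : ∀ v : Fin (n + 1) → ℂ, v ≠ 0 → (∀ i, eval v (pderiv i G) = 0) → IsNodeAt G v) :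
    {p : ℙ ℂ (Fin (n + 1) → ℂ) | ∀ i, eval p.rep (pderiv i G) = 0}.Finite := by
  -- Dividing by a coordinate of maximal modulus puts a representative of each singular point into
  -- one of these compact sets.
  let K : Fin (n + 1) → Set (Fin (n + 1) → ℂ) := fun a =>
    {v | v a = 1} ∩ ((⋂ j, {v | ‖v j‖ ≤ 1}) ∩ ⋂ i, {v | eval v (pderiv i G) = 0})
  have hK : ∀ a v, v ∈ K a ↔ v a = 1 ∧ (∀ j, ‖v j‖ ≤ 1) ∧ ∀ i, eval v (pderiv i G) = 0 :=
    fun a v => by simp [K]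
  have hcont : ∀ p : MvPolynomial (Fin (n + 1)) ℂ, Continuous fun v : Fin (n + 1) → ℂ => eval v p :=
    fun p => MvPolynomial.continuous_eval p
  have hcompact : ∀ a, IsCompact (K a) := by
    intro a
    refine Metric.isCompact_of_isClosed_isBounded ?_ ?_
    · refine (isClosed_eq (f := fun v : Fin (n + 1) → ℂ => v a) (continuous_apply a)
        continuous_const).inter (IsClosed.inter ?_ ?_)
      · exact isClosed_iInter fun j => isClosed_le (continuous_apply j).norm continuous_const
      · exact isClosed_iInter fun i => isClosed_eq (hcont _) continuous_const
    · refine (Metric.isBounded_closedBall (x := (0 : Fin (n + 1) → ℂ)) (r := 1)).subset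
        fun v hv => ?_
      rw [mem_closedBall_zero_iff]
      exact (pi_norm_le_iff_of_nonneg zero_le_one).2 ((hK a v).1 hv).2.1
  have hfin : ∀ a, (K a).Finite := by
    intro a
    by_contra hinf
    obtain ⟨v, hv, hacc⟩ := Set.Infinite.exists_accPt_of_subset_isCompact hinf (hcompact a) le_rfl
    rw [hK] at hv
    have hv0 : v ≠ 0 := fun h0 => by
      have := hv.1
      simp [h0] at this
    obtain ⟨-, hgrad, hrank⟩ := h v hv0 hv.2.2
    -- The gradient together with the coordinate a has injective differential at `v`: the kernel of
    -- the Hessian is the line ℂv, and v has a-th coordinate 1. Hence `f` avoids the value f(v) near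
    -- `v`, although it is constant on the infinite set `K a`.
    let f : (Fin (n + 1) → ℂ) → (Fin (n + 1) → ℂ) × ℂ := fun w =>
      (fun i => eval w (pderiv i G), w a)
    let f' : (Fin (n + 1) → ℂ) →L[ℂ] (Fin (n + 1) → ℂ) × ℂ :=
      (ContinuousLinearMap.pi fun i => evalDeriv (pderiv i G) v).prod (ContinuousLinearMap.proj a)
    have hf : HasFDerivAt f f' v :=
      (hasFDerivAt_pi.2 fun i => hasFDerivAt_eval (pderiv i G) v).prodMk (hasFDerivAt_apply a v)
    have hinj : LinearMap.ker (f' : (Fin (n + 1) → ℂ) →ₗ[ℂ] (Fin (n + 1) → ℂ) × ℂ) = ⊥ := by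
      refine LinearMap.ker_eq_bot'.2 fun z hz => ?_
      set H : Matrix (Fin (n + 1)) (Fin (n + 1)) ℂ :=
        Matrix.of fun i j => eval v (pderiv i (pderiv j G)) with hH
      have hz1 : ∀ i, ∑ j, eval v (pderiv j (pderiv i G)) * z j = 0 := fun i => by
        have := congrFun (congrArg Prod.fst hz) i
        simpa [f', evalDeriv] using this
      have hz2 : z a = 0 := congrArg Prod.snd hz
      have hmem : ∀ w : Fin (n + 1) → ℂ, (∀ i, ∑ j, eval v (pderiv j (pderiv i G)) * w j = 0) →
          w ∈ LinearMap.ker H.mulVecLin := fun w hw => by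
        rw [LinearMap.mem_ker, Matrix.mulVecLin_apply]
        ext i
        rw [Matrix.mulVec, dotProduct, Pi.zero_apply, ← hw i]
        refine Finset.sum_congr rfl fun j _ => ?_
        rw [hH, Matrix.of_apply, pderiv_pderiv_comm]
      have hvK : v ∈ LinearMap.ker H.mulVecLin := hmem v fun i => by
        have := sum_mul_eval_pderiv (hG.pderiv (i := i)) v
        rw [hgrad, mul_zero] at this
        rw [← this]
        exact Finset.sum_congr rfl fun j _ => mul_comm _ _
      have hdim := LinearMap.finrank_range_add_finrank_ker H.mulVecLin
      rw [show Module.finrank ℂ (LinearMap.range H.mulVecLin) = n from hrank,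
        Module.finrank_fin_fun] at hdim
      have hspan : LinearMap.ker H.mulVecLin = Submodule.span ℂ {v} := by
        refine (Submodule.eq_of_le_of_finrank_eq
          ((Submodule.span_singleton_le_iff_mem v _).2 hvK) ?_).symm
        rw [finrank_span_singleton hv0]
        omega
      obtain ⟨c, rfl⟩ := Submodule.mem_span_singleton.1 (hspan ▸ hmem z hz1)
      have hc : c = 0 := by simpa [hv.1] using hz2
      rw [hc, zero_smul]
    obtain ⟨C, -, hC⟩ := LinearMap.exists_antilipschitzWith _ hinj
    have hne : ∀ᶠ w in 𝓝[≠] v, f w ≠ f v := hf.eventually_ne ⟨C, hC⟩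
    have hfreq : ∃ᶠ w in 𝓝[≠] v, w ∈ K a := accPt_iff_frequently_nhdsNE.1 hacc
    obtain ⟨w, hw, hwv⟩ := (hfreq.and_eventually hne).exists
    rw [hK] at hw
    refine hwv (Prod.ext (funext fun i => ?_) ?_)
    · exact (hw.2.2 i).trans (hv.2.2 i).symm
    · exact hw.1.trans hv.1.symm
  have hunion : (⋃ a, ⋃ v ∈ K a, {p : ℙ ℂ (Fin (n + 1) → ℂ) |
      ∃ hv : v ≠ 0, p = Projectivization.mk ℂ v hv}).Finite := by
    refine Set.finite_iUnion fun a => (hfin a).biUnion fun v _ => Set.Subsingleton.finite ?_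
    rintro p ⟨hp, rfl⟩ q ⟨hq, rfl⟩
    rfl
  refine hunion.subset fun p hp => ?_
  obtain ⟨a, ha⟩ := Finite.exists_max fun j => ‖p.rep j‖
  have ha0 : p.rep a ≠ 0 := fun h0 => p.rep_nonzero (by
    ext j
    have := ha j
    rw [h0, norm_zero] at this
    simpa using this)
  simp only [Set.mem_iUnion]
  refine ⟨a, (p.rep a)⁻¹ • p.rep, (hK _ _).2 ⟨?_, fun j => ?_, fun i => ?_⟩,
    smul_ne_zero (inv_ne_zero ha0) p.rep_nonzero, ?_⟩
  · simp [ha0]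
  · rw [Pi.smul_apply, smul_eq_mul, norm_mul, norm_inv]
    exact inv_mul_le_one_of_le₀ (ha j) (norm_nonneg _)
  · rw [eval_smul_of_isHomogeneous hG.pderiv, hp i, mul_zero]
  · conv_lhs => rw [← p.mk_rep]
    exact (Projectivization.mk_eq_mk_iff' _ _ _ _ _).2 ⟨p.rep a, by rw [smul_inv_smul₀ ha0]⟩

end Finite

/-! ### Coordinates on the space of extensions -/

section Coordinates

/-- The symmetric matrix with given upper triangular part. -/
def symOfUpper (L : Fin 6 → ℂ) : Matrix (Fin 3) (Fin 3) ℂ :=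
  !![L 0, L 1, L 2; L 1, L 3, L 4; L 2, L 4, L 5]

/-- The upper triangular part of a matrix. -/
def upper (S : Fin 3 → Fin 3 → ℂ) : Fin 6 → ℂ :=
  ![S 0 0, S 0 1, S 0 2, S 1 1, S 1 2, S 2 2]

theorem symOfUpper_isSymm (L : Fin 6 → ℂ) (i j : Fin 3) : symOfUpper L i j = symOfUpper L j i := by
  fin_cases i <;> fin_cases j <;> rfl

theorem symOfUpper_upper {S : Fin 3 → Fin 3 → ℂ} (hS : ∀ i j, S i j = S j i) (i j : Fin 3) :
    symOfUpper (upper S) i j = S i j := by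
  fin_cases i <;> fin_cases j <;> first | rfl | exact hS _ _

theorem upper_symOfUpper (L : Fin 6 → ℂ) : upper (fun i j => symOfUpper L i j) = L := by
  ext i
  fin_cases i <;> rfl

/-- Coordinates `(L, D, c, h, g, e)` for the extensions: `L` for the constants `l̄_ij`, `D` and `c`
for the coefficients of `x_m` and `x₃` in `q̄_k`, and `h`, `g`, `e` for those of `x_m x_l`, `x_m x₃`
and `x₃²` in `f̄`. -/
abbrev ExtParam : Type :=
  (Fin 6 → ℂ) × (Fin 3 → Fin 3 → ℂ) × (Fin 3 → ℂ) × (Fin 3 → Fin 3 → ℂ) × (Fin 3 → ℂ) × ℂ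

/-- The linear form `∑ dₘ xₘ + c x₃`. -/
def linForm (d : Fin 3 → ℂ) (c : ℂ) : MvPolynomial (Fin 4) ℂ :=
  ∑ m : Fin 3, C (d m) * X m.castSucc + C c * X 3

/-- The quadratic form `∑ hₘₗ xₘ xₗ + ∑ gₘ xₘ x₃ + e x₃²`. -/
def quadForm (h : Fin 3 → Fin 3 → ℂ) (g : Fin 3 → ℂ) (e : ℂ) : MvPolynomial (Fin 4) ℂ :=
  ∑ m : Fin 3, ∑ l : Fin 3, C (h m l) * (X m.castSucc * X l.castSucc) +
    ∑ m : Fin 3, C (g m) * (X m.castSucc * X 3) + C e * (X 3 * X 3)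

theorem linForm_isHomogeneous (d : Fin 3 → ℂ) (c : ℂ) : (linForm d c).IsHomogeneous 1 :=
  (IsHomogeneous.sum _ _ _ fun _ _ => isHomogeneous_C_mul_X _ _).add (isHomogeneous_C_mul_X _ _)

theorem quadForm_isHomogeneous (h : Fin 3 → Fin 3 → ℂ) (g : Fin 3 → ℂ) (e : ℂ) :
    (quadForm h g e).IsHomogeneous 2 := by
  have hX : ∀ (c : ℂ) (i j : Fin 4), (C c * (X i * X j) : MvPolynomial (Fin 4) ℂ).IsHomogeneous 2 :=
    fun c i j => ((isHomogeneous_X _ i).mul (isHomogeneous_X _ j)).C_mul c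
  exact ((IsHomogeneous.sum _ _ _ fun m _ => IsHomogeneous.sum _ _ _ fun l _ => hX _ _ _).add
    (IsHomogeneous.sum _ _ _ fun m _ => hX _ _ _)).add (hX _ _ _)

/-- Euler's identity writes p as ∑ xᵢ∂ᵢp with constant partial derivatives; the quadratic case
applies this to the partial derivatives and halves. -/
theorem exists_eq_linForm {p : MvPolynomial (Fin 4) ℂ} (hp : p.IsHomogeneous 1) :
    ∃ d c, p = linForm d c := by
  have hd : ∀ i, pderiv i p = C (coeff 0 (pderiv i p)) := fun i =>
    totalDegree_eq_zero_iff_eq_C.1 ((totalDegree_zero_iff_isHomogeneous _).2 hp.pderiv)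
  refine ⟨fun m => coeff 0 (pderiv m.castSucc p), coeff 0 (pderiv 3 p), ?_⟩
  have h := hp.sum_X_mul_pderiv
  rw [one_smul, Fin.sum_univ_castSucc] at h
  refine h.symm.trans ?_
  rw [linForm]
  refine congrArg₂ (· + ·) (Finset.sum_congr rfl fun m _ => ?_) ?_
  · rw [mul_comm]
    exact congrArg (· * _) (hd _)
  · rw [mul_comm]
    exact congrArg (· * _) (hd _)

theorem exists_eq_quadForm {p : MvPolynomial (Fin 4) ℂ} (hp : p.IsHomogeneous 2) :
    ∃ h g e, p = quadForm h g e := by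
  have hd : ∀ i, ∃ d c, pderiv i p = linForm d c := fun i => exists_eq_linForm hp.pderiv
  choose d c hdc using hd
  refine ⟨fun m l => d m.castSucc l / 2, fun m => (c m.castSucc + d 3 m) / 2, c 3 / 2, ?_⟩
  have h := hp.sum_X_mul_pderiv
  simp only [hdc] at h
  have h2 : p = C (1 / 2) * (2 • p) := by
    rw [two_smul, ← two_mul, ← mul_assoc, show (2 : MvPolynomial (Fin 4) ℂ) = C 2 by rw [map_ofNat],
      ← C_mul]
    norm_num
  refine h2.trans ?_
  rw [← h]
  simp only [linForm, quadForm, Fin.sum_univ_four, Fin.sum_univ_three, div_eq_mul_inv, C_mul, C_add,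
    one_mul, show (Fin.castSucc 0 : Fin 4) = 0 from rfl, show (Fin.castSucc 1 : Fin 4) = 1 from rfl,
    show (Fin.castSucc 2 : Fin 4) = 2 from rfl]
  ring

/-- The extension with given coordinates, as a matrix. -/
def extMat (w : ExtParam) : Matrix (Fin 3 ⊕ Unit) (Fin 3 ⊕ Unit) (MvPolynomial (Fin 4) ℂ) :=
  Matrix.fromBlocks (Matrix.of fun i j => C (symOfUpper w.1 i j))
    (Matrix.of fun k _ => linForm (w.2.1 k) (w.2.2.1 k))
    (Matrix.of fun _ k => linForm (w.2.1 k) (w.2.2.1 k))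
    (Matrix.of fun _ _ => quadForm w.2.2.2.1 w.2.2.2.2.1 w.2.2.2.2.2)

theorem extMat_mem (w : ExtParam) : extMat w ∈ symForms 4 0 := by
  refine ⟨?_, ?_⟩
  · ext (i | i) (j | j)
    · simp [extMat, symOfUpper_isSymm w.1 i j]
    · rfl
    · rfl
    · rfl
  · rintro (i | i) (j | j)
    · exact isHomogeneous_C _ _
    · exact linForm_isHomogeneous _ _
    · exact linForm_isHomogeneous _ _
    · exact quadForm_isHomogeneous _ _ _

/-- The surjective parametrization of the space of extensions. -/
def extParamMap : ExtParam →ₗ[ℂ] symForms 4 0 where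
  toFun w := ⟨extMat w, extMat_mem w⟩
  map_add' w w' := by
    apply Subtype.ext
    have h : ∀ (L L' : Fin 6 → ℂ) i j, symOfUpper (L + L') i j =
        symOfUpper L i j + symOfUpper L' i j := fun L L' i j => by
      fin_cases i <;> fin_cases j <;> rfl
    ext1 (i | i) (j | j)
    · simp [extMat, h]
    · simp [extMat, linForm, add_mul, Finset.sum_add_distrib]
      abel
    · simp [extMat, linForm, add_mul, Finset.sum_add_distrib]
      abel
    · simp [extMat, quadForm, add_mul, Finset.sum_add_distrib]
      abel
  map_smul' c w := by
    apply Subtype.ext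
    have h : ∀ (L : Fin 6 → ℂ) i j, symOfUpper (c • L) i j = c * symOfUpper L i j := fun L i j => by
      fin_cases i <;> fin_cases j <;> rfl
    ext1 (i | i) (j | j)
    · simp [extMat, h, smul_eq_C_mul]
    · simp [extMat, linForm, smul_eq_C_mul, Finset.mul_sum, mul_assoc]
    · simp [extMat, linForm, smul_eq_C_mul, Finset.mul_sum, mul_assoc]
    · simp [extMat, quadForm, smul_eq_C_mul, Finset.mul_sum, mul_assoc]

/-- The array h of quadratic coefficients is not required to be symmetric, so the parametrization
has a kernel; surjectivity is all that the transfer of generic properties needs. -/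
theorem extParamMap_surjective : Function.Surjective extParamMap := by
  rintro ⟨N, hN⟩
  have hl : ∀ i j, N (Sum.inl i) (Sum.inl j) = C (coeff 0 (N (Sum.inl i) (Sum.inl j))) :=
    fun i j => totalDegree_eq_zero_iff_eq_C.1
      ((totalDegree_zero_iff_isHomogeneous _).2 (hN.2 (Sum.inl i) (Sum.inl j)))
  choose d c hq using fun k => exists_eq_linForm (hN.2 (Sum.inl k) (Sum.inr ()))
  obtain ⟨h, g, e, hf⟩ := exists_eq_quadForm (hN.2 (Sum.inr ()) (Sum.inr ()))
  refine ⟨(upper fun i j => coeff 0 (N (Sum.inl i) (Sum.inl j)), d, c, h, g, e), ?_⟩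
  apply Subtype.ext
  ext1 (i | i) (j | j)
  · refine Eq.trans ?_ (hl i j).symm
    exact congrArg C (symOfUpper_upper (S := fun i j => coeff 0 (N (Sum.inl i) (Sum.inl j)))
      (fun i j => by rw [hN.1.apply]) i j)
  · exact (hq i).symm
  · exact (hq j).symm.trans (hN.1.apply _ _)
  · exact hf.symm

end Coordinates

/-! ### Values and derivatives of extensions -/

section Values

variable (M : Matrix (Fin 3 ⊕ Unit) (Fin 3 ⊕ Unit) (MvPolynomial (Fin 3) ℂ))

/-- The vector `(x₀, x₁, x₂, t)`. -/
def affVec (x : Fin 3 → ℂ) (t : ℂ) : Fin 4 → ℂ := Fin.snoc (α := fun _ => ℂ) x t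

@[simp]
theorem affVec_castSucc (x : Fin 3 → ℂ) (t : ℂ) (m : Fin 3) : affVec x t m.castSucc = x m :=
  Fin.snoc_castSucc (α := fun _ => ℂ) _ _ _

@[simp]
theorem affVec_three (x : Fin 3 → ℂ) (t : ℂ) : affVec x t 3 = t :=
  Fin.snoc_last (α := fun _ => ℂ) _ _

theorem eq_affVec (v : Fin 4 → ℂ) : v = affVec (fun m => v m.castSucc) (v 3) := by
  ext i
  refine Fin.lastCases ?_ (fun m => ?_) i
  · exact (affVec_three _ _).symm
  · rw [affVec_castSucc]

theorem extend_mem (hM : M ∈ symForms 3 1) {N} (hN : N ∈ symForms 4 0) :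
    extend M N ∈ symForms 4 1 := by
  refine ⟨(hM.1.map _).add (hN.1.smul _), fun i j => ?_⟩
  refine ((hM.2 i j).rename_isHomogeneous).add ?_
  have := (isHomogeneous_X ℂ (3 : Fin 4)).mul (hN.2 i j)
  rwa [zero_add, ← add_assoc] at this

theorem eval_extend (N) (x : Fin 3 → ℂ) (t : ℂ) (i j) : eval (affVec x t) (extend M N i j) =
    eval x (M i j) + t * eval (affVec x t) (N i j) := by
  have : affVec x t ∘ Fin.castSucc = x := funext fun m => affVec_castSucc x t m
  simp [extend, eval_rename, this]

theorem eval_pderiv_extend (N) (x : Fin 3 → ℂ) (t : ℂ) (m : Fin 3) (i j) :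
    eval (affVec x t) (pderiv m.castSucc (extend M N i j)) =
      eval x (pderiv m (M i j)) + t * eval (affVec x t) (pderiv m.castSucc (N i j)) := by
  have h : affVec x t ∘ Fin.castSucc = x := funext fun m => affVec_castSucc x t m
  have h3 : pderiv m.castSucc (X 3 : MvPolynomial (Fin 4) ℂ) = 0 :=
    pderiv_X_of_ne (Fin.castSucc_lt_last m).ne'
  simp [extend, eval_rename, h, pderiv_rename (Fin.castSucc_injective 3), Derivation.leibniz, h3]

theorem eval_pderiv_three_extend (N) (x : Fin 3 → ℂ) (i j) :
    eval (affVec x 0) (pderiv 3 (extend M N i j)) = eval (affVec x 0) (N i j) := by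
  have h3 : pderiv (3 : Fin 4) (rename Fin.castSucc (M i j)) = 0 := by
    classical
    refine pderiv_eq_zero_of_notMem_vars fun h => ?_
    obtain ⟨m, -, hm⟩ := Finset.mem_image.1 (vars_rename _ _ h)
    exact (Fin.castSucc_lt_last m).ne hm
  simp [extend, Derivation.leibniz, h3]

theorem eval_linForm (d : Fin 3 → ℂ) (c : ℂ) (x : Fin 3 → ℂ) (t : ℂ) :
    eval (affVec x t) (linForm d c) = ∑ m, d m * x m + c * t := by
  simp [linForm]

theorem eval_quadForm (h : Fin 3 → Fin 3 → ℂ) (g : Fin 3 → ℂ) (e : ℂ) (x : Fin 3 → ℂ) (t : ℂ) :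
    eval (affVec x t) (quadForm h g e) =
      ∑ m, ∑ l, h m l * (x m * x l) + ∑ m, g m * (x m * t) + e * (t * t) := by
  simp [quadForm]

theorem eval_pderiv_linForm (d : Fin 3 → ℂ) (c : ℂ) (v : Fin 4 → ℂ) (m : Fin 3) :
    eval v (pderiv m.castSucc (linForm d c)) = d m := by
  have h3 : pderiv m.castSucc (X 3 : MvPolynomial (Fin 4) ℂ) = 0 :=
    pderiv_X_of_ne (Fin.castSucc_lt_last m).ne'
  simp [linForm, Derivation.leibniz, h3, pderiv_X, Pi.single_apply]

theorem eval_pderiv_quadForm (h : Fin 3 → Fin 3 → ℂ) (g : Fin 3 → ℂ) (e : ℂ) (x : Fin 3 → ℂ)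
    (t : ℂ) (m : Fin 3) : eval (affVec x t) (pderiv m.castSucc (quadForm h g e)) =
      ∑ l, (h m l + h l m) * x l + g m * t := by
  have h3 : pderiv m.castSucc (X 3 : MvPolynomial (Fin 4) ℂ) = 0 :=
    pderiv_X_of_ne (Fin.castSucc_lt_last m).ne'
  simp [quadForm, Derivation.leibniz, h3, pderiv_X, Pi.single_apply, Finset.sum_add_distrib, add_mul,
    mul_add]
  exact add_comm _ _

end Values

/-! ### Extensions in the chart `x₃ = 1` -/

section Chart

variable (M : Matrix (Fin 3 ⊕ Unit) (Fin 3 ⊕ Unit) (MvPolynomial (Fin 3) ℂ))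

theorem eval_extMat_inl_inl (w : ExtParam) (x : Fin 3 → ℂ) (i j : Fin 3) :
    eval (affVec x 1) (extend M (extMat w) (Sum.inl i) (Sum.inl j)) =
      eval x (M (Sum.inl i) (Sum.inl j)) + symOfUpper w.1 i j := by
  rw [eval_extend]
  simp [extMat]

theorem eval_extMat_inl_inr (w : ExtParam) (x : Fin 3 → ℂ) (k : Fin 3) :
    eval (affVec x 1) (extend M (extMat w) (Sum.inl k) (Sum.inr ())) =
      eval x (M (Sum.inl k) (Sum.inr ())) + (∑ m, w.2.1 k m * x m + w.2.2.1 k) := by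
  rw [eval_extend]
  simp [extMat, eval_linForm]

theorem eval_extMat_inr_inr (w : ExtParam) (x : Fin 3 → ℂ) :
    eval (affVec x 1) (extend M (extMat w) (Sum.inr ()) (Sum.inr ())) =
      eval x (M (Sum.inr ()) (Sum.inr ())) + (∑ m, ∑ l, w.2.2.2.1 m l * (x m * x l) +
        ∑ m, w.2.2.2.2.1 m * x m + w.2.2.2.2.2) := by
  rw [eval_extend]
  simp [extMat, eval_quadForm]

/-- The formula shows which coordinates move which form: on vectors (a, 0) the derivative does not
depend on the extension, mixed terms with (b, 1) are moved by D, and the square of (b, 1) is moved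
freely by g. -/
theorem derivForm_extend_extMat (w : ExtParam) (x a b : Fin 3 → ℂ) (s t : ℂ) (m : Fin 3) :
    derivForm (extend M (extMat w)) (affVec x 1) m.castSucc (Sum.elim a fun _ => s)
      (Sum.elim b fun _ => t) =
      derivForm M x m (Sum.elim a fun _ => s) (Sum.elim b fun _ => t) +
      (∑ k, w.2.1 k m * (a k * t + s * b k) +
        s * t * (∑ l, (w.2.2.2.1 m l + w.2.2.2.1 l m) * x l + w.2.2.2.2.1 m)) := by
  simp only [derivForm, derivMat, dotProduct, Matrix.mulVec, Fintype.sum_sum_type, Sum.elim_inl,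
    Sum.elim_inr, Matrix.map_apply, eval_pderiv_extend, Finset.univ_unique, Finset.sum_singleton,
    PUnit.default_eq_unit]
  simp only [extMat, Matrix.fromBlocks_apply₁₁, Matrix.fromBlocks_apply₁₂,
    Matrix.fromBlocks_apply₂₁, Matrix.fromBlocks_apply₂₂, Matrix.of_apply, pderiv_C, map_zero,
    eval_pderiv_linForm, eval_pderiv_quadForm, Fin.sum_univ_three]
  ring

/-- The coordinates of the extension whose block `l_ij` takes the value `l` at `(x, 1)`, whose
matrix has `(b, 1)` in its kernel there, and whose other coordinates are `D`, `h`, `g`. -/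
def solveParam (x b : Fin 3 → ℂ) (l D h : Fin 3 → Fin 3 → ℂ) (g : Fin 3 → ℂ) : ExtParam :=
  (upper fun i j => l i j - eval x (M (Sum.inl i) (Sum.inl j)), D,
    fun k => -∑ j, l k j * b j - eval x (M (Sum.inl k) (Sum.inr ())) - ∑ m, D k m * x m, h, g,
    ∑ i, ∑ j, l i j * (b i * b j) - eval x (M (Sum.inr ()) (Sum.inr ())) -
      ∑ m, ∑ l, h m l * (x m * x l) - ∑ m, g m * x m)

/-- The kernel equation for (b, 1) consists of four affine equations: the first three rows determine
c and the last one determines e, so the remaining data recover the extension. -/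
theorem solveParam_eq (hM : M ∈ symForms 3 1) {w : ExtParam} {x b : Fin 3 → ℂ}
    (h : ((extend M (extMat w)).map (eval (affVec x 1))).mulVec (Sum.elim b fun _ => 1) = 0) :
    solveParam M x b (fun i j => eval (affVec x 1) (extend M (extMat w) (Sum.inl i) (Sum.inl j)))
      w.2.1 w.2.2.2.1 w.2.2.2.2.1 = w := by
  obtain ⟨L, D, c, h', g, e⟩ := w
  have hs := (extend_mem M hM (extMat_mem (L, D, c, h', g, e))).1
  have h1 : ∀ k, ∑ j, eval (affVec x 1) (extend M (extMat (L, D, c, h', g, e)) (Sum.inl k)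
      (Sum.inl j)) * b j + eval (affVec x 1) (extend M (extMat (L, D, c, h', g, e)) (Sum.inl k)
      (Sum.inr ())) = 0 := fun k => by
    simpa [Matrix.mulVec, dotProduct] using congrFun h (Sum.inl k)
  have h2 : ∑ j, eval (affVec x 1) (extend M (extMat (L, D, c, h', g, e)) (Sum.inl j)
      (Sum.inr ())) * b j + eval (affVec x 1) (extend M (extMat (L, D, c, h', g, e)) (Sum.inr ())
      (Sum.inr ())) = 0 := by
    have := congrFun h (Sum.inr ())
    simp only [Matrix.mulVec, dotProduct, Fintype.sum_sum_type, Matrix.map_apply, inr_inl_eq hs]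
      at this
    simpa using this
  simp only [eval_extMat_inl_inr, eval_extMat_inr_inr] at h1 h2
  simp only [solveParam, Prod.mk.injEq, true_and]
  refine ⟨?_, funext fun k => ?_, ?_⟩
  · simp only [eval_extMat_inl_inl, add_sub_cancel_left]
    exact upper_symOfUpper L
  · linear_combination -h1 k
  · have h3 : ∑ i, ∑ j, eval (affVec x 1) (extend M (extMat (L, D, c, h', g, e)) (Sum.inl i)
        (Sum.inl j)) * (b i * b j) = -∑ i, (eval x (M (Sum.inl i) (Sum.inr ())) +
          (∑ m, D i m * x m + c i)) * b i := by
      rw [← Finset.sum_neg_distrib]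
      refine Finset.sum_congr rfl fun i _ => ?_
      rw [← neg_mul, ← eq_neg_of_add_eq_zero_left (h1 i), Finset.sum_mul]
      exact Finset.sum_congr rfl fun j _ => by ring
    rw [h3]
    linear_combination -h2

end Chart

/-! ### Polynomiality of the parametrizations used in the dimension counts. -/

section PolyMap

variable {W : Type*} [AddCommGroup W] [Module ℂ W]
variable (M : Matrix (Fin 3 ⊕ Unit) (Fin 3 ⊕ Unit) (MvPolynomial (Fin 3) ℂ))

@[fun_prop]
theorem IsPolyMap.upper {f : W → Fin 3 → Fin 3 → ℂ} (hf : IsPolyMap f) :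
    IsPolyMap fun w => upper (f w) := by
  refine IsPolyMap.pi fun i => ?_
  have h : ∀ a b, IsPolyMap fun w => f w a b := fun a b => by fun_prop
  fin_cases i
  exacts [h 0 0, h 0 1, h 0 2, h 1 1, h 1 2, h 2 2]

@[fun_prop]
theorem IsPolyMap.symOfUpper {f : W → Fin 6 → ℂ} (hf : IsPolyMap f) (i j : Fin 3) :
    IsPolyMap fun w => symOfUpper (f w) i j := by
  fin_cases i <;> fin_cases j <;> simp [CubicPlane.symOfUpper] <;> fun_prop

@[fun_prop]
theorem IsPolyMap.derivForm {x : W → Fin 3 → ℂ} {a b : W → Fin 3 → ℂ} {s t : W → ℂ}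
    (hx : IsPolyMap x) (ha : IsPolyMap a) (hs : IsPolyMap s) (hb : IsPolyMap b) (ht : IsPolyMap t)
    (m : Fin 3) : IsPolyMap fun w => derivForm M (x w) m (Sum.elim (a w) fun _ => s w)
      (Sum.elim (b w) fun _ => t w) := by
  simp only [CubicPlane.derivForm, derivMat, dotProduct, Matrix.mulVec, Fintype.sum_sum_type,
    Sum.elim_inl, Sum.elim_inr, Matrix.map_apply]
  fun_prop

@[fun_prop]
theorem IsPolyMap.solveParam {x b g : W → Fin 3 → ℂ} {l D h : W → Fin 3 → Fin 3 → ℂ}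
    (hx : IsPolyMap x) (hb : IsPolyMap b) (hl : IsPolyMap l) (hD : IsPolyMap D) (hh : IsPolyMap h)
    (hg : IsPolyMap g) :
    IsPolyMap fun w => solveParam M (x w) (b w) (l w) (D w) (h w) (g w) := by
  unfold CubicPlane.solveParam
  fun_prop

@[fun_prop]
theorem IsPolyMap.insertNth {U : Type*} [AddCommGroup U] [Module ℂ U] {n : ℕ} (i : Fin (n + 1))
    {a : W → U} {f : W → Fin n → U} (ha : IsPolyMap a) (hf : IsPolyMap f) :
    IsPolyMap fun w => i.insertNth (α := fun _ => U) (a w) (f w) := by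
  refine IsPolyMap.pi fun j => ?_
  refine Fin.succAboveCases i ?_ (fun k => ?_) j
  · simpa using ha
  · simp only [Fin.insertNth_apply_succAbove]
    fun_prop

end PolyMap

/-! ### The generic extension in the chart `x₃ = 1` -/

section GenericChart

variable {M : Matrix (Fin 3 ⊕ Unit) (Fin 3 ⊕ Unit) (MvPolynomial (Fin 3) ℂ)}

/-- The pair (x, y) contributes six parameters against seven conditions: four kernel equations,
solved for c and e, and three derivatives, solved for g. The source has dimension 30, the space of
extension parameters 31. -/
theorem holdsGenerically_not_singular (hM : M ∈ symForms 3 1) :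
    HoldsGenerically fun w : ExtParam => ∀ x y : Fin 3 → ℂ,
      ((extend M (extMat w)).map (eval (affVec x 1))).mulVec (Sum.elim y fun _ => 1) = 0 →
      ∃ m : Fin 3, derivForm (extend M (extMat w)) (affVec x 1) m.castSucc
        (Sum.elim y fun _ => 1) (Sum.elim y fun _ => 1) ≠ 0 := by
  let g : (Fin 3 → ℂ) × (Fin 3 → ℂ) × (Fin 6 → ℂ) × (Fin 3 → Fin 3 → ℂ) × (Fin 3 → Fin 3 → ℂ) →
      ExtParam := fun p => solveParam M p.1 p.2.1
    (fun i j => eval p.1 (M (Sum.inl i) (Sum.inl j)) + symOfUpper p.2.2.1 i j) p.2.2.2.1 p.2.2.2.2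
    (fun m => -derivForm M p.1 m (Sum.elim p.2.1 fun _ => 1) (Sum.elim p.2.1 fun _ => 1) -
      ∑ k, p.2.2.2.1 k m * (p.2.1 k * 1 + 1 * p.2.1 k) -
      ∑ l, (p.2.2.2.2 m l + p.2.2.2.2 l m) * p.1 l)
  have hg : IsPolyMap g := by fun_prop
  refine (hg.holdsGenerically_notMem_range (by simp [Module.finrank_pi_fintype])).mono fun w hw x y hy => ?_
  by_contra! h
  refine hw ⟨(x, y, w.1, w.2.1, w.2.2.2.1), ?_⟩
  refine Eq.trans ?_ (solveParam_eq M hM hy)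
  simp only [g, eval_extMat_inl_inl]
  congr 1
  funext m
  have := h m
  rw [derivForm_extend_extMat] at this
  linear_combination -this

/-- Six entries l and three entries q are prescribed by the seven parameters x, u, t. With
`holdsGenerically_block_ne_zero` this keeps the first three columns from having rank at most one, so
that the kernel is spanned by vectors (a, 0) and (b, 1). -/
theorem holdsGenerically_rank_one_block (M : Matrix (Fin 3 ⊕ Unit) (Fin 3 ⊕ Unit)
    (MvPolynomial (Fin 3) ℂ)) : HoldsGenerically fun w : ExtParam => ∀ (x u : Fin 3 → ℂ) (t : ℂ),
      ¬((∀ i j, eval (affVec x 1) (extend M (extMat w) (Sum.inl i) (Sum.inl j)) = u i * u j) ∧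
        ∀ k, eval (affVec x 1) (extend M (extMat w) (Sum.inl k) (Sum.inr ())) = t * u k) := by
  let g : (Fin 3 → ℂ) × (Fin 3 → ℂ) × ℂ × (Fin 3 → Fin 3 → ℂ) × (Fin 3 → Fin 3 → ℂ) ×
      (Fin 3 → ℂ) × ℂ → ExtParam := fun p =>
    (upper fun i j => p.2.1 i * p.2.1 j - eval p.1 (M (Sum.inl i) (Sum.inl j)), p.2.2.2.1,
      fun k => p.2.2.1 * p.2.1 k - eval p.1 (M (Sum.inl k) (Sum.inr ())) -
        ∑ m, p.2.2.2.1 k m * p.1 m, p.2.2.2.2)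
  have hg : IsPolyMap g := by fun_prop
  refine (hg.holdsGenerically_notMem_range (by simp [Module.finrank_pi_fintype])).mono ?_
  rintro ⟨L, D, c, h, g', e⟩ hw x u t ⟨h1, h2⟩
  refine hw ⟨(x, u, t, D, h, g', e), ?_⟩
  simp only [eval_extMat_inl_inl, eval_extMat_inl_inr] at h1 h2
  simp only [g, Prod.mk.injEq, true_and, and_true]
  refine ⟨?_, funext fun k => ?_⟩
  · simp only [← h1, add_sub_cancel_left]
    exact upper_symOfUpper L
  · linear_combination -h2 k

theorem holdsGenerically_block_ne_zero (M : Matrix (Fin 3 ⊕ Unit) (Fin 3 ⊕ Unit)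
    (MvPolynomial (Fin 3) ℂ)) : HoldsGenerically fun w : ExtParam => ∀ x : Fin 3 → ℂ,
      ¬∀ i j, eval (affVec x 1) (extend M (extMat w) (Sum.inl i) (Sum.inl j)) = 0 := by
  let g : (Fin 3 → ℂ) × (Fin 3 → Fin 3 → ℂ) × (Fin 3 → ℂ) × (Fin 3 → Fin 3 → ℂ) ×
      (Fin 3 → ℂ) × ℂ → ExtParam := fun p =>
    (upper fun i j => -eval p.1 (M (Sum.inl i) (Sum.inl j)), p.2)
  have hg : IsPolyMap g := by fun_prop
  refine (hg.holdsGenerically_notMem_range (by simp [Module.finrank_pi_fintype])).mono ?_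
  rintro ⟨L, w⟩ hw x h
  refine hw ⟨(x, w), ?_⟩
  simp only [eval_extMat_inl_inl] at h
  simp only [g, Prod.mk.injEq, and_true]
  simp only [fun i j => (eq_neg_of_add_eq_zero_right (h i j)).symm]
  exact upper_symOfUpper L

/-- The symmetric matrix with `(1, a)` (the entry `1` in position `i`) in its kernel whose entries
off the `i`-th row and column are given by `c`. -/
def symOfKernel (i : Fin 3) (a c : Fin 2 → ℂ) (d : ℂ) (r s : Fin 3) : ℂ :=
  c 0 * (i.insertNth (α := fun _ => ℂ) (-a 0) (Pi.single 0 1) r *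
      i.insertNth (α := fun _ => ℂ) (-a 0) (Pi.single 0 1) s) +
    d * (i.insertNth (α := fun _ => ℂ) (-a 0) (Pi.single 0 1) r *
        i.insertNth (α := fun _ => ℂ) (-a 1) (Pi.single 1 1) s +
      i.insertNth (α := fun _ => ℂ) (-a 1) (Pi.single 1 1) r *
        i.insertNth (α := fun _ => ℂ) (-a 0) (Pi.single 0 1) s) +
    c 1 * (i.insertNth (α := fun _ => ℂ) (-a 1) (Pi.single 1 1) r *
      i.insertNth (α := fun _ => ℂ) (-a 1) (Pi.single 1 1) s)

/-- A quadratic form with a given kernel vector descends to the two-dimensional quotient, so three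
numbers determine it; this saves three parameters in the counts below. -/
theorem eq_symOfKernel {S : Fin 3 → Fin 3 → ℂ} (hS : ∀ r s, S r s = S s r) (i : Fin 3)
    (a : Fin 2 → ℂ) (h : ∀ r, ∑ s, S r s * i.insertNth (α := fun _ => ℂ) 1 a s = 0) :
    S = symOfKernel i a (fun k => S (i.succAbove k) (i.succAbove k))
      (S (i.succAbove 0) (i.succAbove 1)) := by
  have h' : ∀ r, S r i = -(S r (i.succAbove 0) * a 0 + S r (i.succAbove 1) * a 1) := fun r => by
    have := h r
    simp only [Fin.sum_univ_succAbove _ i, Fin.insertNth_apply_same, Fin.insertNth_apply_succAbove,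
      Fin.sum_univ_two] at this
    linear_combination this
  have h0 := h' (i.succAbove 0)
  have h1 := h' (i.succAbove 1)
  have h2 := h' i
  rw [hS i (i.succAbove 0), hS i (i.succAbove 1), h0, h1] at h2
  have h3 := hS (i.succAbove 1) (i.succAbove 0)
  funext r s
  refine Fin.succAboveCases i ?_ (fun r => ?_) r <;> refine Fin.succAboveCases i ?_ (fun s => ?_) s
  · simp [symOfKernel, h2, h3]
    ring
  · rw [hS]
    fin_cases s <;> simp [symOfKernel, h0, h1, h3] <;> ring
  · fin_cases r <;> simp [symOfKernel, h0, h1, h3] <;> ring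
  · fin_cases r <;> fin_cases s <;> simp [symOfKernel, h3]

@[fun_prop]
theorem IsPolyMap.symOfKernel {W : Type*} [AddCommGroup W] [Module ℂ W] (i : Fin 3)
    {a c : W → Fin 2 → ℂ} {d : W → ℂ} (ha : IsPolyMap a) (hc : IsPolyMap c) (hd : IsPolyMap d) :
    IsPolyMap fun w => symOfKernel i (a w) (c w) (d w) := by
  refine IsPolyMap.pi fun r => IsPolyMap.pi fun s => ?_
  unfold CubicPlane.symOfKernel
  fun_prop

theorem block_eq_symOfKernel {w : ExtParam} (hM : M ∈ symForms 3 1) {x : Fin 3 → ℂ} {i : Fin 3}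
    {a' : Fin 2 → ℂ} (ha : ((extend M (extMat w)).map (eval (affVec x 1))).mulVec
      (Sum.elim (i.insertNth (α := fun _ => ℂ) 1 a') fun _ => 0) = 0) :
    (fun r s => eval (affVec x 1) (extend M (extMat w) (Sum.inl r) (Sum.inl s))) =
      symOfKernel i a' (fun k => eval (affVec x 1) (extend M (extMat w) (Sum.inl (i.succAbove k))
        (Sum.inl (i.succAbove k)))) (eval (affVec x 1) (extend M (extMat w)
          (Sum.inl (i.succAbove 0)) (Sum.inl (i.succAbove 1)))) := by
  refine eq_symOfKernel (fun r s => ?_) i a' fun r => ?_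
  · rw [(extend_mem M hM (extMat_mem w)).1.apply]
  · simpa [Matrix.mulVec, dotProduct] using congrFun ha (Sum.inl r)

/-- Generically `γ` is not a multiple of `α`. -/
theorem holdsGenerically_gamma (hM : M ∈ symForms 3 1) (i : Fin 3) :
    HoldsGenerically fun w : ExtParam => ∀ (x : Fin 3 → ℂ) (a' b' : Fin 2 → ℂ) (s : ℂ),
      ((extend M (extMat w)).map (eval (affVec x 1))).mulVec
        (Sum.elim (i.insertNth (α := fun _ => ℂ) 1 a') fun _ => 0) = 0 →
      ((extend M (extMat w)).map (eval (affVec x 1))).mulVec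
        (Sum.elim (i.insertNth (α := fun _ => ℂ) 0 b') fun _ => 1) = 0 →
      ¬∀ m : Fin 3, derivForm (extend M (extMat w)) (affVec x 1) m.castSucc
          (Sum.elim (i.insertNth (α := fun _ => ℂ) 1 a') fun _ => 0)
          (Sum.elim (i.insertNth (α := fun _ => ℂ) 0 b') fun _ => 1) =
        s * derivForm M x m (Sum.elim (i.insertNth (α := fun _ => ℂ) 1 a') fun _ => 0)
          (Sum.elim (i.insertNth (α := fun _ => ℂ) 1 a') fun _ => 0) := by
  -- The source has dimension 29, below 31. Because the i-th entry of the first kernel vector is 1,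
  -- the i-th row of D enters γ with coefficient one and is solved from γ = sα.
  let g : (Fin 3 → ℂ) × (Fin 2 → ℂ) × (Fin 2 → ℂ) × ((Fin 2 → ℂ) × ℂ) × ℂ ×
      (Fin 2 → Fin 3 → ℂ) × (Fin 3 → Fin 3 → ℂ) × (Fin 3 → ℂ) → ExtParam :=
    fun ⟨x, a', b', c, s, D', h, g⟩ =>
      solveParam M x (i.insertNth (α := fun _ => ℂ) 0 b') (symOfKernel i a' c.1 c.2)
        (i.insertNth (α := fun _ => Fin 3 → ℂ) (fun m =>
          s * derivForm M x m (Sum.elim (i.insertNth (α := fun _ => ℂ) 1 a') fun _ => 0)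
            (Sum.elim (i.insertNth (α := fun _ => ℂ) 1 a') fun _ => 0) -
          derivForm M x m (Sum.elim (i.insertNth (α := fun _ => ℂ) 1 a') fun _ => 0)
            (Sum.elim (i.insertNth (α := fun _ => ℂ) 0 b') fun _ => 1) -
          ∑ k, D' k m * a' k) D') h g
  have hg : IsPolyMap g := by fun_prop
  refine (hg.holdsGenerically_notMem_range (by simp [Module.finrank_pi_fintype])).mono fun w hw x a' b' s ha hb h => ?_
  refine hw ⟨(x, a', b', (fun k => eval (affVec x 1) (extend M (extMat w)
    (Sum.inl (i.succAbove k)) (Sum.inl (i.succAbove k))), eval (affVec x 1) (extend M (extMat w)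
      (Sum.inl (i.succAbove 0)) (Sum.inl (i.succAbove 1)))), s, fun k => w.2.1 (i.succAbove k),
      w.2.2.2.1, w.2.2.2.2.1), ?_⟩
  refine Eq.trans ?_ (solveParam_eq M hM hb)
  simp only [g]
  rw [← block_eq_symOfKernel hM ha]
  congr 1
  refine Fin.insertNth_eq_iff.2 ⟨funext fun m => ?_, rfl⟩
  have := h m
  rw [derivForm_extend_extMat] at this
  simp only [Fin.sum_univ_succAbove _ i, Fin.insertNth_apply_same,
    Fin.insertNth_apply_succAbove, Fin.sum_univ_two] at this ⊢
  linear_combination -this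

/-- Generically `β` is not a linear combination of `α` and `γ`. -/
theorem holdsGenerically_beta (hM : M ∈ symForms 3 1) (i : Fin 3) :
    HoldsGenerically fun w : ExtParam => ∀ (x : Fin 3 → ℂ) (a' b' : Fin 2 → ℂ) (s r : ℂ),
      ((extend M (extMat w)).map (eval (affVec x 1))).mulVec
        (Sum.elim (i.insertNth (α := fun _ => ℂ) 1 a') fun _ => 0) = 0 →
      ((extend M (extMat w)).map (eval (affVec x 1))).mulVec
        (Sum.elim (i.insertNth (α := fun _ => ℂ) 0 b') fun _ => 1) = 0 →
      ¬∀ m : Fin 3, derivForm (extend M (extMat w)) (affVec x 1) m.castSucc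
          (Sum.elim (i.insertNth (α := fun _ => ℂ) 0 b') fun _ => 1)
          (Sum.elim (i.insertNth (α := fun _ => ℂ) 0 b') fun _ => 1) =
        s * derivForm M x m (Sum.elim (i.insertNth (α := fun _ => ℂ) 1 a') fun _ => 0)
          (Sum.elim (i.insertNth (α := fun _ => ℂ) 1 a') fun _ => 0) +
        r * derivForm (extend M (extMat w)) (affVec x 1) m.castSucc
          (Sum.elim (i.insertNth (α := fun _ => ℂ) 1 a') fun _ => 0)
          (Sum.elim (i.insertNth (α := fun _ => ℂ) 0 b') fun _ => 1) := by
  -- The source has dimension 30, below 31. The coordinates g enter β with coefficient one and are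
  -- absent from α and γ, so β = sα + rγ can be solved for them.
  let g : (Fin 3 → ℂ) × (Fin 2 → ℂ) × (Fin 2 → ℂ) × ((Fin 2 → ℂ) × ℂ) × (ℂ × ℂ) ×
      (Fin 3 → Fin 3 → ℂ) × (Fin 3 → Fin 3 → ℂ) → ExtParam :=
    fun ⟨x, a', b', c, s, D, h⟩ =>
      solveParam M x (i.insertNth (α := fun _ => ℂ) 0 b') (symOfKernel i a' c.1 c.2) D h
        (fun m =>
          s.1 * derivForm M x m (Sum.elim (i.insertNth (α := fun _ => ℂ) 1 a') fun _ => 0)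
            (Sum.elim (i.insertNth (α := fun _ => ℂ) 1 a') fun _ => 0) +
          s.2 * (derivForm M x m (Sum.elim (i.insertNth (α := fun _ => ℂ) 1 a') fun _ => 0)
            (Sum.elim (i.insertNth (α := fun _ => ℂ) 0 b') fun _ => 1) +
            ∑ k, D k m * (i.insertNth (α := fun _ => ℂ) 1 a' k * 1 +
              0 * i.insertNth (α := fun _ => ℂ) 0 b' k)) -
          derivForm M x m (Sum.elim (i.insertNth (α := fun _ => ℂ) 0 b') fun _ => 1)
            (Sum.elim (i.insertNth (α := fun _ => ℂ) 0 b') fun _ => 1) -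
          ∑ k, D k m * (i.insertNth (α := fun _ => ℂ) 0 b' k * 1 +
              1 * i.insertNth (α := fun _ => ℂ) 0 b' k) -
          ∑ l, (h m l + h l m) * x l)
  have hg : IsPolyMap g := by fun_prop
  refine (hg.holdsGenerically_notMem_range (by simp [Module.finrank_pi_fintype])).mono fun w hw x a' b' s r ha hb h => ?_
  refine hw ⟨(x, a', b', (fun k => eval (affVec x 1) (extend M (extMat w)
    (Sum.inl (i.succAbove k)) (Sum.inl (i.succAbove k))), eval (affVec x 1) (extend M (extMat w)
      (Sum.inl (i.succAbove 0)) (Sum.inl (i.succAbove 1)))), (s, r), w.2.1, w.2.2.2.1), ?_⟩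
  refine Eq.trans ?_ (solveParam_eq M hM hb)
  simp only [g]
  rw [← block_eq_symOfKernel hM ha]
  congr 1
  funext m
  have := h m
  rw [derivForm_extend_extMat, derivForm_extend_extMat] at this
  linear_combination -this

end GenericChart

/-! ### The generic extension is smooth and its nodes off the plane are ordinary -/

section Dichotomy

theorem mul_eq_mul_of_rank_le_one {m n : Type*} [Fintype m] [Fintype n] {B : Matrix m n ℂ}
    (hB : B.rank ≤ 1) (i j : m) (k l : n) : B i k * B j l = B i l * B j k := by
  by_contra h
  have hdet : (B.submatrix ![i, j] ![k, l]).det ≠ 0 := by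
    rw [Matrix.det_fin_two]
    simpa [sub_eq_zero] using h
  have h1 := Matrix.rank_of_isUnit _ ((Matrix.isUnit_iff_isUnit_det _).2 hdet.isUnit)
  have h2 := B.rank_submatrix_le ![i, j] ![k, l]
  rw [h1, Fintype.card_fin] at h2
  omega

/-- A nonzero entry of a symmetric block of rank one forces a nonzero diagonal entry, and the column
through it, divided by a square root of that entry, is u. The 2 × 2 minors with the last row make q
proportional to u. -/
theorem block_of_rank_le_one {A : Matrix (Fin 3 ⊕ Unit) (Fin 3 ⊕ Unit) ℂ} (hA : A.IsSymm)
    (hr : (A.submatrix id Sum.inl).rank ≤ 1) :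
    (∃ (u : Fin 3 → ℂ) (t : ℂ), (∀ i j, A (Sum.inl i) (Sum.inl j) = u i * u j) ∧
      ∀ k, A (Sum.inl k) (Sum.inr ()) = t * u k) ∨ ∀ i j, A (Sum.inl i) (Sum.inl j) = 0 := by
  have hmin := mul_eq_mul_of_rank_le_one hr
  simp only [Matrix.submatrix_apply, id] at hmin
  by_cases h0 : ∃ k l, A (Sum.inl k) (Sum.inl l) ≠ 0
  · left
    obtain ⟨k, l, hkl⟩ := h0
    have hkk : A (Sum.inl k) (Sum.inl k) ≠ 0 := fun h => by
      have := hmin (Sum.inl k) (Sum.inl l) l k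
      rw [h, zero_mul, hA.apply (Sum.inl k) (Sum.inl l)] at this
      exact hkl (mul_self_eq_zero.1 this)
    obtain ⟨r, hr⟩ := IsAlgClosed.exists_pow_nat_eq (A (Sum.inl k) (Sum.inl k)) two_pos
    have hr0 : r ≠ 0 := by
      rintro rfl
      exact hkk (by simpa using hr.symm)
    refine ⟨fun i => A (Sum.inl i) (Sum.inl k) / r, A (Sum.inr ()) (Sum.inl k) / r,
      fun i j => ?_, fun i => ?_⟩
    · have := hmin (Sum.inl i) (Sum.inl k) j k
      rw [hA.apply (Sum.inl j) (Sum.inl k), ← hr] at this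
      field_simp
      linear_combination this
    · have := hmin (Sum.inr ()) (Sum.inl k) i k
      rw [hA.apply (Sum.inl i) (Sum.inr ()), hA.apply (Sum.inl i) (Sum.inl k), ← hr] at this
      field_simp
      linear_combination this
  · right
    push Not at h0
    exact h0

/-- The first three columns already span the range: a relation among them gives (a, 0), and
expressing the last column through them gives (b, 1). Scaling a and subtracting a multiple of it
from b fix one coordinate of each. -/
theorem exists_kernel_of_rank {A : Matrix (Fin 3 ⊕ Unit) (Fin 3 ⊕ Unit) ℂ} (hr : A.rank ≤ 2)
    (hB : 2 ≤ (A.submatrix id Sum.inl).rank) : A.rank = 2 ∧ ∃ (i : Fin 3) (a b : Fin 2 → ℂ),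
      A.mulVec (Sum.elim (i.insertNth (α := fun _ => ℂ) 1 a) fun _ => 0) = 0 ∧
      A.mulVec (Sum.elim (i.insertNth (α := fun _ => ℂ) 0 b) fun _ => 1) = 0 := by
  set B := A.submatrix id (Sum.inl : Fin 3 → Fin 3 ⊕ Unit) with hBdef
  have hle : B.rank ≤ A.rank := A.rank_submatrix_le id Sum.inl
  have hrank : A.rank = 2 := by omega
  have hmul : ∀ (a : Fin 3 → ℂ) (s : ℂ), A.mulVec (Sum.elim a fun _ => s) =
      B.mulVec a + s • fun i => A i (Sum.inr ()) := fun a s => by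
    ext i
    simp [Matrix.mulVec, dotProduct, hBdef, mul_comm]
  obtain ⟨a, ha, ha0⟩ : ∃ a, B.mulVec a = 0 ∧ a ≠ 0 := by
    have h := LinearMap.finrank_range_add_finrank_ker B.mulVecLin
    have h' : Module.finrank ℂ (LinearMap.range B.mulVecLin) ≤ 2 := by
      have : B.rank ≤ 2 := by omega
      exact this
    have : LinearMap.ker B.mulVecLin ≠ ⊥ := fun hbot => by
      rw [hbot, finrank_bot, Module.finrank_fin_fun] at h
      omega
    obtain ⟨a, ha, ha0⟩ := Submodule.exists_mem_ne_zero_of_ne_bot this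
    exact ⟨a, ha, ha0⟩
  have hrange : LinearMap.range B.mulVecLin = LinearMap.range A.mulVecLin := by
    refine Submodule.eq_of_le_of_finrank_le ?_ ?_
    · rintro _ ⟨a, rfl⟩
      refine ⟨Sum.elim a fun _ => 0, ?_⟩
      rw [Matrix.mulVecLin_apply, hmul, zero_smul, add_zero, Matrix.mulVecLin_apply]
    · have : A.rank ≤ B.rank := by omega
      exact this
  obtain ⟨b, hb⟩ : ∃ b, B.mulVec b = fun i => A i (Sum.inr ()) := by
    have : (fun i => A i (Sum.inr ())) ∈ LinearMap.range B.mulVecLin := by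
      rw [hrange]
      refine ⟨Sum.elim 0 fun _ => 1, ?_⟩
      rw [Matrix.mulVecLin_apply, hmul, Matrix.mulVec_zero, zero_add, one_smul]
    exact this
  obtain ⟨i, hi⟩ := Function.ne_iff.1 ha0
  have hi' : a i ≠ 0 := hi
  have hins : ∀ f : Fin 3 → ℂ,
      i.insertNth (α := fun _ => ℂ) (f i) (fun k => f (i.succAbove k)) = f := fun f =>
    Fin.insertNth_eq_iff.2 ⟨rfl, rfl⟩
  refine ⟨hrank, i, fun k => ((a i)⁻¹ • a) (i.succAbove k),
    fun k => (-b + (b i * (a i)⁻¹) • a) (i.succAbove k), ?_, ?_⟩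
  · have := hins ((a i)⁻¹ • a)
    rw [Pi.smul_apply, smul_eq_mul, inv_mul_cancel₀ hi'] at this
    rw [this, hmul, Matrix.mulVec_smul, ha]
    simp
  · have := hins (-b + (b i * (a i)⁻¹) • a)
    rw [Pi.add_apply, Pi.smul_apply, smul_eq_mul, Pi.neg_apply, mul_assoc, inv_mul_cancel₀ hi',
      mul_one, neg_add_cancel] at this
    rw [this, hmul, Matrix.mulVec_add, Matrix.mulVec_neg, Matrix.mulVec_smul, ha, hb]
    simp

end Dichotomy

/-! ### Smoothness of the cubic fivefold. -/

section Smooth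

variable {M : Matrix (Fin 3 ⊕ Unit) (Fin 3 ⊕ Unit) (MvPolynomial (Fin 3) ℂ)}

theorem map_eval_extend_zero (M : Matrix (Fin 3 ⊕ Unit) (Fin 3 ⊕ Unit) (MvPolynomial (Fin 3) ℂ))
    (N) (x : Fin 3 → ℂ) : (extend M N).map (eval (affVec x 0)) = M.map (eval x) := by
  ext i j
  simp [eval_extend]

theorem derivForm_extend_zero (M : Matrix (Fin 3 ⊕ Unit) (Fin 3 ⊕ Unit) (MvPolynomial (Fin 3) ℂ))
    (N) (x : Fin 3 → ℂ) (m : Fin 3) (k k') :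
    derivForm (extend M N) (affVec x 0) m.castSucc k k' = derivForm M x m k k' := by
  simp [derivForm, derivMat, eval_pderiv_extend, Matrix.mulVec, dotProduct]

/-- The y-derivatives kill the first three entries of A(x)(y, 1); the value of the cubic is then the
last entry. -/
theorem mulVec_eq_zero_of_singular {m : ℕ}
    {A : Matrix (Fin 3 ⊕ Unit) (Fin 3 ⊕ Unit) (MvPolynomial (Fin m) ℂ)} (hA : A.IsSymm)
    {x : Fin m → ℂ} {y : Fin 3 → ℂ} (h0 : eval (Sum.elim x y) (cubicForm A) = 0)
    (h : ∀ k, eval (Sum.elim x y) (pderiv (Sum.inr k) (cubicForm A)) = 0) :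
    (A.map (eval x)).mulVec (Sum.elim y 1) = 0 := by
  have h1 : ∀ k, (A.map (eval x)).mulVec (Sum.elim y 1) (Sum.inl k) = 0 := fun k => by
    simpa [eval_pderiv_inr_cubicForm hA] using h k
  ext (k | k)
  · exact h1 k
  · rw [eval_cubicForm hA, dotProduct, Fintype.sum_sum_type] at h0
    simpa [h1] using h0

/-- A singular point with x₃ = 0 would be singular on the hyperplane section, which is the original
fourfold; any other one can be rescaled into the chart x₃ = 1, where the hypothesis applies. -/
theorem isSmoothHypersurface_extend (hM : M ∈ symForms 3 1)
    (hY : IsSmoothHypersurface (cubicForm M)) {N} (hN : N ∈ symForms 4 0)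
    (h : ∀ x y : Fin 3 → ℂ,
      ((extend M N).map (eval (affVec x 1))).mulVec (Sum.elim y fun _ => 1) = 0 →
      ∃ m : Fin 3, derivForm (extend M N) (affVec x 1) m.castSucc
        (Sum.elim y fun _ => 1) (Sum.elim y fun _ => 1) ≠ 0) :
    IsSmoothHypersurface (cubicForm (extend M N)) := by
  have hA := extend_mem M hM hN
  intro v hv hv0
  by_contra! hv1
  obtain ⟨X, y, rfl⟩ : ∃ X y, v = Sum.elim X y := ⟨_, _, (Sum.elim_comp_inl_inr v).symm⟩
  obtain ⟨x, t, rfl⟩ : ∃ x t, X = affVec x t := ⟨_, _, eq_affVec X⟩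
  by_cases ht : t = 0
  · subst ht
    have hne : Sum.elim x y ≠ 0 := fun h0 => hv (by
      ext (i | i)
      · refine Fin.lastCases ?_ (fun m => ?_) i
        · exact affVec_three _ _
        · rw [Sum.elim_inl, affVec_castSucc]
          exact congrFun h0 (Sum.inl m)
      · exact congrFun h0 (Sum.inr i))
    rw [eval_cubicForm hA.1, map_eval_extend_zero, ← eval_cubicForm hM.1] at hv0
    obtain ⟨i | k, hi⟩ := hY _ hne hv0
    · refine hi ?_
      have := hv1 (Sum.inl i.castSucc)
      rwa [eval_pderiv_inl_cubicForm hA.1, derivForm_extend_zero,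
        ← eval_pderiv_inl_cubicForm hM.1] at this
    · refine hi ?_
      have := hv1 (Sum.inr k)
      rwa [eval_pderiv_inr_cubicForm hA.1, map_eval_extend_zero,
        ← eval_pderiv_inr_cubicForm hM.1] at this
  · have hG := cubicForm_isHomogeneous hA
    have hsm : t⁻¹ • Sum.elim (affVec x t) y = Sum.elim (affVec (t⁻¹ • x) 1) (t⁻¹ • y) := by
      ext (i | i)
      · refine Fin.lastCases ?_ (fun m => ?_) i
        · have := affVec_three x t
          have h' := affVec_three (t⁻¹ • x) 1
          simp only [Fin.reduceLast, Pi.smul_apply, Sum.elim_inl, smul_eq_mul, this, h']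
          exact inv_mul_cancel₀ ht
        · simp
      · simp
    have h0 : eval (Sum.elim (affVec (t⁻¹ • x) 1) (t⁻¹ • y)) (cubicForm (extend M N)) = 0 := by
      rw [← hsm, eval_smul_of_isHomogeneous hG, hv0, mul_zero]
    have h1 : ∀ i, eval (Sum.elim (affVec (t⁻¹ • x) 1) (t⁻¹ • y))
        (pderiv i (cubicForm (extend M N))) = 0 := fun i => by
      rw [← hsm, eval_smul_of_isHomogeneous hG.pderiv, hv1, mul_zero]
    obtain ⟨m, hm⟩ := h (t⁻¹ • x) (t⁻¹ • y)
      (mulVec_eq_zero_of_singular hA.1 h0 fun k => h1 (Sum.inr k))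
    have := h1 (Sum.inl m.castSucc)
    rw [eval_pderiv_inl_cubicForm hA.1] at this
    exact hm this

end Smooth

/-! ### Nodes of the discriminant surface in the chart x₃ = 1. -/

section Nodes

variable {M : Matrix (Fin 3 ⊕ Unit) (Fin 3 ⊕ Unit) (MvPolynomial (Fin 3) ℂ)}

/-- Polarization: a linear combination of the derivatives of the matrix that vanishes on the
diagonal of a subspace is zero on the subspace. -/
theorem sum_mul_derivForm_polar {m : ℕ}
    {A : Matrix (Fin 3 ⊕ Unit) (Fin 3 ⊕ Unit) (MvPolynomial (Fin m) ℂ)} (hA : A.IsSymm)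
    (v z : Fin m → ℂ) {k k' : Fin 3 ⊕ Unit → ℂ} (h : ∑ i, z i * derivForm A v i k k = 0)
    (h' : ∑ i, z i * derivForm A v i k' k' = 0)
    (h'' : ∑ i, z i * derivForm A v i (k + k') (k + k') = 0) :
    ∑ i, z i * derivForm A v i k k' = 0 := by
  have key : ∀ i, z i * derivForm A v i (k + k') (k + k') = z i * derivForm A v i k k +
      2 * (z i * derivForm A v i k k') + z i * derivForm A v i k' k' := fun i => by
    have := derivForm_smul_add hA v i k k' 1 1
    simp only [one_smul] at this
    rw [this]
    ring
  simp only [key, Finset.sum_add_distrib, h, h', ← Finset.mul_sum] at h''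
  simpa using h''

theorem isNodeAt_det_extend (hM : M ∈ symForms 3 1) {N} (hN : N ∈ symForms 4 0)
    (hY : IsSmoothHypersurface (cubicForm (extend M N))) {x : Fin 3 → ℂ}
    (hr : ((extend M N).map (eval (affVec x 1))).rank = 2) {k k' : Fin 3 ⊕ Unit → ℂ}
    (hk : ((extend M N).map (eval (affVec x 1))).mulVec k = 0)
    (hk' : ((extend M N).map (eval (affVec x 1))).mulVec k' = 0)
    (hind : ∀ r : Fin 3 → ℂ, (∀ m : Fin 3,
      r 0 * derivForm (extend M N) (affVec x 1) m.castSucc k k +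
      r 1 * derivForm (extend M N) (affVec x 1) m.castSucc k k' +
      r 2 * derivForm (extend M N) (affVec x 1) m.castSucc k' k' = 0) → r = 0) :
    IsNodeAt (n := 3) (extend M N).det (affVec x 1) := by
  have hA := extend_mem M hM hN
  have hv : affVec x 1 ≠ 0 := fun h => by simpa using congrFun h 3
  refine isNodeAt_det (n := 3) hA hY hv hr fun z hz => ⟨z 3, ?_⟩
  -- Subtracting a multiple of `v` removes the last coordinate of `z`. By Euler's relation the three
  -- linear forms still vanish, so their independence in the first three variables forces z' = 0.
  set z' : Fin 3 → ℂ := fun m => z m.castSucc - z 3 * x m with hz'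
  have hsum : ∀ q : Fin 4 → ℂ, ∑ i, z i * q i = 0 → ∑ i, affVec x 1 i * q i = 0 →
      ∑ m : Fin 3, z' m * q m.castSucc = 0 := fun q h1 h2 => by
    have h3 := affVec_three x 1
    simp only [Fin.sum_univ_castSucc (n := 3), affVec_castSucc, Fin.reduceLast, h3] at h1 h2
    simp only [hz', sub_mul, Finset.sum_sub_distrib, mul_assoc, ← Finset.mul_sum]
    linear_combination h1 - z 3 * h2
  have hkk : ((extend M N).map (eval (affVec x 1))).mulVec (k + k') = 0 := by
    rw [Matrix.mulVec_add, hk, hk', add_zero]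
  have e1 := hsum _ (hz k hk) (sum_mul_derivForm hA hk)
  have e3 := hsum _ (hz k' hk') (sum_mul_derivForm hA hk')
  have e2 := hsum _ (sum_mul_derivForm_polar hA.1 _ z (hz k hk) (hz k' hk') (hz _ hkk))
    (sum_mul_derivForm_polar hA.1 _ _ (sum_mul_derivForm hA hk) (sum_mul_derivForm hA hk')
      (sum_mul_derivForm hA hkk))
  have hz0 : z' = 0 := by
    by_contra hne
    let P : Matrix (Fin 3) (Fin 3) ℂ := Matrix.of
      ![fun m => derivForm (extend M N) (affVec x 1) m.castSucc k k,
        fun m => derivForm (extend M N) (affVec x 1) m.castSucc k k',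
        fun m => derivForm (extend M N) (affVec x 1) m.castSucc k' k']
    have hP : P.mulVec z' = 0 := by
      ext j
      rw [Matrix.mulVec, dotProduct_comm]
      fin_cases j
      · exact e1
      · exact e2
      · exact e3
    obtain ⟨r, hr0, hrP⟩ := Matrix.exists_vecMul_eq_zero_iff.2
      (Matrix.exists_mulVec_eq_zero_iff.1 ⟨z', hne, hP⟩)
    refine hr0 (hind r fun m => ?_)
    have := congrFun hrP m
    simpa [Matrix.vecMul, dotProduct, Fin.sum_univ_three, P] using this
  ext i
  refine Fin.lastCases ?_ (fun m => ?_) i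
  · have h3 := affVec_three x 1
    simp only [Fin.reduceLast, Pi.smul_apply, smul_eq_mul, h3, mul_one]
  · have := congrFun hz0 m
    simp only [hz', Pi.zero_apply] at this
    simp only [Pi.smul_apply, smul_eq_mul, affVec_castSucc]
    linear_combination this

theorem holdsGenerically_chart (hM : M ∈ symForms 3 1)
    (hY : IsSmoothHypersurface (cubicForm M)) : HoldsGenerically fun N : symForms 4 0 =>
      IsSmoothHypersurface (cubicForm (extend M N)) ∧
      ∀ x, ((extend M N).map (eval (affVec x 1))).rank ≤ 2 →
        IsNodeAt (n := 3) (extend M N).det (affVec x 1) := by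
  refine HoldsGenerically.of_surjective extParamMap_surjective ?_
  refine ((((holdsGenerically_not_singular hM).and (holdsGenerically_rank_one_block M)).and
    (holdsGenerically_block_ne_zero M)).and
    ((HoldsGenerically.forall_fin fun i => holdsGenerically_gamma hM i).and
      (HoldsGenerically.forall_fin fun i => holdsGenerically_beta hM i))).mono ?_
  rintro w ⟨⟨⟨h1, h2⟩, h3⟩, h4, h5⟩
  have hsm := isSmoothHypersurface_extend hM hY (extMat_mem w) h1
  refine ⟨hsm, fun x hx => ?_⟩
  change ((extend M (extMat w)).map (eval (affVec x 1))).rank ≤ 2 at hx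
  change IsNodeAt (n := 3) (extend M (extMat w)).det (affVec x 1)
  have hA := extend_mem M hM (extMat_mem w)
  have hB : 2 ≤ (((extend M (extMat w)).map (eval (affVec x 1))).submatrix id Sum.inl).rank := by
    by_contra hlt
    rcases block_of_rank_le_one (hA.1.map (eval (affVec x 1))) (by omega) with ⟨u, t, hut⟩ | h0
    · exact h2 x u t hut
    · exact h3 x h0
  obtain ⟨hr, i, a, b, ha, hb⟩ := exists_kernel_of_rank hx hB
  refine isNodeAt_det_extend hM (extMat_mem w) hsm hr ha hb fun r hr => ?_
  -- The form α is insensitive to the extension; that it is nonzero comes from smoothness of the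
  -- fourfold along the plane x = 0, not from genericity.
  have hα : ∀ m : Fin 3, derivForm (extend M (extMat w)) (affVec x 1) m.castSucc
      (Sum.elim (i.insertNth (α := fun _ => ℂ) 1 a) fun _ => 0)
      (Sum.elim (i.insertNth (α := fun _ => ℂ) 1 a) fun _ => 0) =
      derivForm M x m (Sum.elim (i.insertNth (α := fun _ => ℂ) 1 a) fun _ => 0)
      (Sum.elim (i.insertNth (α := fun _ => ℂ) 1 a) fun _ => 0) := fun m => by
    rw [derivForm_extend_extMat]
    simp
  have r2 : r 2 = 0 := by
    by_contra hne
    refine h5 i x a b (-r 0 / r 2) (-r 1 / r 2) ha hb fun m => ?_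
    have := hr m
    rw [← hα]
    field_simp
    linear_combination this
  have r1 : r 1 = 0 := by
    by_contra hne
    refine h4 i x a b (-r 0 / r 1) ha hb fun m => ?_
    have := hr m
    rw [r2] at this
    rw [← hα]
    field_simp
    linear_combination this
  have r0 : r 0 = 0 := by
    have ha0 : i.insertNth (α := fun _ => ℂ) 1 a ≠ 0 := fun h => by
      simpa using congrFun h i
    obtain ⟨m, hm⟩ := exists_derivForm_inl_ne_zero hM hY ha0 x
    have := hr m
    rw [r1, r2, hα] at this
    simpa [show (fun _ : Unit => (0 : ℂ)) = 0 from rfl, hm] using this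
  ext j
  fin_cases j
  · exact r0
  · exact r1
  · exact r2

end Nodes

/-! ### The degenerate points of the generic extension on the plane -/

section PlaneNodes

variable {M : Matrix (Fin 3 ⊕ Unit) (Fin 3 ⊕ Unit) (MvPolynomial (Fin 3) ℂ)}

/-- The value at `v` of a member of `symForms m d`, as a bilinear form. -/
def evalForm {m d : ℕ} (v : Fin m → ℂ) (k k' : Fin 3 ⊕ Unit → ℂ) : symForms m d →ₗ[ℂ] ℂ where
  toFun N := dotProduct k ((N.1.map (eval v)).mulVec k')
  map_add' N N' := by
    have : (N + N').1.map (eval v) = N.1.map (eval v) + N'.1.map (eval v) := by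
      ext i j
      simp
    rw [this, Matrix.add_mulVec, dotProduct_add]
  map_smul' c N := by
    have : (c • N).1.map (eval v) = c • N.1.map (eval v) := by
      ext i j
      simp [smul_eval]
    rw [this, Matrix.smul_mulVec, dotProduct_smul]
    rfl

/-- Every rank one value φφᵀ is attained at `v` by monomials in a coordinate that does not vanish
there. Hence a nonzero functional on the values restricted to the kernel is nonzero on extensions.
-/
theorem exists_evalForm_eq {m : ℕ} {v : Fin m → ℂ} (hv : v ≠ 0) (φ : Fin 3 ⊕ Unit → ℂ) :
    ∃ N : symForms m 0, ∀ k k', evalForm v k k' N = dotProduct φ k * dotProduct φ k' := by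
  obtain ⟨l, hl⟩ := Function.ne_iff.1 hv
  have hl' : v l ≠ 0 := hl
  refine ⟨⟨Matrix.of fun i j => C (φ i * φ j / v l ^ (twist i + twist j)) *
    X l ^ (twist i + twist j), ?_, fun i j => ?_⟩, fun k k' => ?_⟩
  · ext1 i j
    simp only [Matrix.transpose_apply, Matrix.of_apply, mul_comm (φ i), add_comm (twist i)]
  · rw [Matrix.of_apply, zero_add]
    exact (isHomogeneous_X_pow l _).C_mul _
  · have h : ∀ i j, eval v (C (φ i * φ j / v l ^ (twist i + twist j)) *
        X l ^ (twist i + twist j)) = φ i * φ j := fun i j => by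
      rw [map_mul, eval_C, map_pow, eval_X, div_mul_cancel₀ _ (pow_ne_zero _ hl')]
    simp only [evalForm, LinearMap.coe_mk, AddHom.coe_mk, dotProduct, Matrix.mulVec,
      Matrix.map_apply, Matrix.of_apply, h, Finset.mul_sum, Finset.sum_mul]
    rw [Finset.sum_comm]
    exact Finset.sum_congr rfl fun i _ => Finset.sum_congr rfl fun j _ => by ring

theorem derivForm_three_extend (N : symForms 4 0) (x : Fin 3 → ℂ) (k k') :
    derivForm (extend M N) (affVec x 0) 3 k k' = evalForm (affVec x 0) k k' N := by
  simp [derivForm, derivMat, evalForm, eval_pderiv_three_extend, Matrix.mulVec, dotProduct]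

theorem affVec_ne_zero {x : Fin 3 → ℂ} (hx : x ≠ 0) : affVec x 0 ≠ 0 := fun h =>
  hx (funext fun m => by simpa using congrFun h m.castSucc)

/-- In the plane α, β, γ all vanish at x and so satisfy a linear relation ρ. In space their
∂₃-components are values of N, and if ρ does not annihilate these, a common zero has z₃ = 0 and the
planar statement applies. -/
theorem holdsGenerically_isNodeAt_plane (hM : M ∈ symForms 3 1)
    (hY : IsSmoothHypersurface (cubicForm M)) {x : Fin 3 → ℂ} (hx : x ≠ 0)
    (hr : (M.map (eval x)).rank ≤ 2) : HoldsGenerically fun N : symForms 4 0 =>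
      IsSmoothHypersurface (cubicForm (extend M N)) →
        IsNodeAt (n := 3) (extend M N).det (affVec x 0) := by
  have hr2 : (M.map (eval x)).rank = 2 := le_antisymm hr (two_le_rank hM hY hx)
  obtain ⟨U, e, hU, hker, -, -⟩ := exists_adapted_basis (hM.1.map (eval x)) hr2 (s := 2) rfl
  obtain ⟨U', hU'⟩ := hU.exists_left_inv
  set k : Fin 3 ⊕ Unit → ℂ := fun i => U i (e (Fin.castAdd 2 0)) with hkdef
  set k' : Fin 3 ⊕ Unit → ℂ := fun i => U i (e (Fin.castAdd 2 1)) with hkdef'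
  have hk : (M.map (eval x)).mulVec k = 0 := hker 0
  have hk' : (M.map (eval x)).mulVec k' = 0 := hker 1
  have hkk : (M.map (eval x)).mulVec (k + k') = 0 := by rw [Matrix.mulVec_add, hk, hk', add_zero]
  have hφ : ∀ p q : ℂ, ∃ φ, dotProduct φ k = p ∧ dotProduct φ k' = q := fun p q => by
    have hU'' : ∀ a b, dotProduct (U' a) (fun i => U i b) = (1 : Matrix _ _ ℂ) a b := fun a b => by
      rw [← hU', Matrix.mul_apply]
      rfl
    refine ⟨p • U' (e (Fin.castAdd 2 0)) + q • U' (e (Fin.castAdd 2 1)), ?_, ?_⟩ <;>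
      simp only [hkdef, hkdef', add_dotProduct, smul_dotProduct, hU''] <;>
      simp
  let P : Matrix (Fin 3) (Fin 3) ℂ := Matrix.of
    ![fun m => derivForm M x m k k, fun m => derivForm M x m k k', fun m => derivForm M x m k' k']
  have hP : P.mulVec x = 0 := by
    have e1 := sum_mul_derivForm hM hk
    have e3 := sum_mul_derivForm hM hk'
    have e2 := sum_mul_derivForm_polar hM.1 _ _ e1 e3 (sum_mul_derivForm hM hkk)
    ext j
    rw [Matrix.mulVec, dotProduct_comm]
    fin_cases j
    · exact e1
    · exact e2
    · exact e3
  obtain ⟨ρ, hρ, hρP⟩ := Matrix.exists_vecMul_eq_zero_iff.2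
    (Matrix.exists_mulVec_eq_zero_iff.1 ⟨x, hx, hP⟩)
  let Φ : Module.Dual ℂ (symForms 4 0) := ρ 0 • evalForm (affVec x 0) k k +
    ρ 1 • evalForm (affVec x 0) k k' + ρ 2 • evalForm (affVec x 0) k' k'
  have hΦ : Φ ≠ 0 := fun h0 => hρ (by
    -- Rank one values of N with prescribed pairings p, q with k, k' make Φ a binary quadratic form
    -- with coefficients ρ; its values at three points recover ρ.
    have key : ∀ p q : ℂ, ρ 0 * (p * p) + ρ 1 * (p * q) + ρ 2 * (q * q) = 0 := fun p q => by
      obtain ⟨φ, h1, h2⟩ := hφ p q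
      obtain ⟨N, hN⟩ := exists_evalForm_eq (affVec_ne_zero hx) φ
      have := LinearMap.congr_fun h0 N
      simpa [Φ, hN, h1, h2] using this
    have h10 := key 1 0
    have h01 := key 0 1
    have h11 := key 1 1
    have r0 : ρ 0 = 0 := by linear_combination h10
    have r2 : ρ 2 = 0 := by linear_combination h01
    have r1 : ρ 1 = 0 := by linear_combination h11 - h10 - h01
    ext j
    fin_cases j
    · exact r0
    · exact r1
    · exact r2)
  refine (holdsGenerically_ne_zero hΦ).mono fun N hN hsm => ?_
  have hA := extend_mem M hM N.2
  refine isNodeAt_det (n := 3) hA hsm (affVec_ne_zero hx) (by rw [map_eval_extend_zero, hr2])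
    fun z hz => ?_
  rw [map_eval_extend_zero] at hz
  have e1 := hz k hk
  have e3 := hz k' hk'
  have e2 := sum_mul_derivForm_polar hA.1 _ _ e1 e3 (hz _ hkk)
  simp only [Fin.sum_univ_castSucc (n := 3), derivForm_extend_zero, Fin.reduceLast,
    derivForm_three_extend] at e1 e2 e3
  have hz3 : z 3 = 0 := by
    have h1 := congrFun hρP 0
    have h2 := congrFun hρP 1
    have h3 := congrFun hρP 2
    simp only [Matrix.vecMul, dotProduct, Fin.sum_univ_three, P, Matrix.of_apply,
      Matrix.cons_val, Pi.zero_apply] at h1 h2 h3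
    simp only [Fin.sum_univ_three] at e1 e2 e3
    have : z 3 * Φ N = 0 := by
      simp only [Φ, LinearMap.add_apply, LinearMap.smul_apply, smul_eq_mul]
      linear_combination ρ 0 * e1 + ρ 1 * e2 + ρ 2 * e3 - z (Fin.castSucc 0) * h1 -
        z (Fin.castSucc 1) * h2 - z (Fin.castSucc 2) * h3
    exact (mul_eq_zero.1 this).resolve_right hN
  obtain ⟨c, hc⟩ := exists_smul_of_sum_derivForm hM hY hx hr (fun m => z m.castSucc)
    fun k hk => by
      have := hz k hk
      simpa only [Fin.sum_univ_castSucc (n := 3), derivForm_extend_zero, Fin.reduceLast, hz3,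
        zero_mul, add_zero] using this
  refine ⟨c, ?_⟩
  ext i
  refine Fin.lastCases ?_ (fun m => ?_) i
  · have h3 := affVec_three x 0
    simp only [Fin.reduceLast, Pi.smul_apply, smul_eq_mul, h3, hz3, mul_zero]
  · simpa using congrFun hc m

theorem smul_affVec (c : ℂ) (x : Fin 3 → ℂ) (t : ℂ) : c • affVec x t = affVec (c • x) (c * t) := by
  ext i
  refine Fin.lastCases ?_ (fun m => ?_) i
  · have h3 := affVec_three x t
    have h3' := affVec_three (c • x) (c * t)
    simp only [Fin.reduceLast, Pi.smul_apply, smul_eq_mul, h3, h3']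
  · simp

/-- The plane has only finitely many points of rank at most two, so finitely many generic conditions
are combined. Homogeneity passes from the chosen representatives to all others. -/
theorem holdsGenerically_plane (hM : M ∈ symForms 3 1)
    (hY : IsSmoothHypersurface (cubicForm M)) : HoldsGenerically fun N : symForms 4 0 =>
      IsSmoothHypersurface (cubicForm (extend M N)) → ∀ x : Fin 3 → ℂ, x ≠ 0 →
        (M.map (eval x)).rank ≤ 2 → IsNodeAt (n := 3) (extend M N).det (affVec x 0) := by
  have hfin := finite_singular (n := 2) (det_isHomogeneous hM) fun v hv h =>
    (isNodeAt_det_iff hM hY hv).2 (rank_le_two_of_pderiv_det_eq_zero hM hY hv h)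
  refine (HoldsGenerically.forall_mem_finset hfin.toFinset fun p hp =>
    holdsGenerically_isNodeAt_plane hM hY p.rep_nonzero
      (rank_le_two_of_pderiv_det_eq_zero hM hY p.rep_nonzero (hfin.mem_toFinset.1 hp))).mono ?_
  intro N hN hsm x hx hr
  obtain ⟨c, hc⟩ := Projectivization.exists_smul_eq_mk_rep ℂ x hx
  have hc' : (c : ℂ) • x = (Projectivization.mk ℂ x hx).rep := hc
  have hnode := hN (Projectivization.mk ℂ x hx) (hfin.mem_toFinset.2 (by
    have := (((isNodeAt_det_iff hM hY hx).2 hr).smul (det_isHomogeneous hM) c.ne_zero).2.1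
    rwa [hc'] at this)) hsm
  have := hnode.smul (det_isHomogeneous (extend_mem M hM N.2)) (inv_ne_zero c.ne_zero)
  rwa [← hc', smul_affVec, mul_zero, smul_smul, inv_mul_cancel₀ c.ne_zero, one_smul] at this

theorem holdsGenerically_isNodeAt (hM : M ∈ symForms 3 1)
    (hY : IsSmoothHypersurface (cubicForm M)) : HoldsGenerically fun N : symForms 4 0 =>
      IsSmoothHypersurface (cubicForm (extend M N)) ∧ ∀ v : Fin 4 → ℂ, v ≠ 0 →
        ((extend M N).map (eval v)).rank ≤ 2 → IsNodeAt (n := 3) (extend M N).det v := by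
  refine ((holdsGenerically_chart hM hY).and (holdsGenerically_plane hM hY)).mono ?_
  rintro N ⟨⟨hsm, h1⟩, h2⟩
  refine ⟨hsm, fun v hv hr => ?_⟩
  have hA := extend_mem M hM N.2
  obtain ⟨x, t, rfl⟩ : ∃ x t, v = affVec x t := ⟨_, _, eq_affVec v⟩
  by_cases ht : t = 0
  · subst ht
    refine h2 hsm x (fun hx => hv ?_) (by rwa [map_eval_extend_zero] at hr)
    have := smul_affVec 0 0 0
    rw [hx]
    simpa using this.symm
  · have hmul : affVec x t = t • affVec (t⁻¹ • x) 1 := by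
      rw [smul_affVec, smul_smul, mul_inv_cancel₀ ht, one_smul, mul_one]
    rw [hmul] at hr ⊢
    rw [rank_map_eval_smul hA ht] at hr
    exact (h1 _ hr).smul (det_isHomogeneous hA) ht

end PlaneNodes

/-! ### The degeneracy locus in projective space and its plane section. -/

section Loci

variable {M : Matrix (Fin 3 ⊕ Unit) (Fin 3 ⊕ Unit) (MvPolynomial (Fin 3) ℂ)}

theorem planeLin_eq (x : Fin 3 → ℂ) : planeLin x = affVec x 0 := by
  ext i
  fin_cases i
  · exact (affVec_castSucc x 0 0).symm
  · exact (affVec_castSucc x 0 1).symm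
  · exact (affVec_castSucc x 0 2).symm
  · exact (affVec_three x 0).symm

theorem degeneracyLocus_nonempty {A : Matrix (Fin 3 ⊕ Unit) (Fin 3 ⊕ Unit) (MvPolynomial (Fin 4) ℂ)}
    (hA : A ∈ symForms 4 1) : (degeneracyLocus (n := 3) 2 A).Nonempty := by
  let e : Fin 4 ≃ Fin 3 ⊕ Unit := Fintype.equivOfCardEq rfl
  obtain ⟨v, hv, hr⟩ := exists_rank_le_two (A.submatrix e e) (hA.1.submatrix _) fun i j =>
    eval_zero_of_isHomogeneous (hA.2 _ _) (by omega)
  obtain ⟨c, hc⟩ := Projectivization.exists_smul_eq_mk_rep ℂ v hv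
  have hc' : (c : ℂ) • v = (Projectivization.mk ℂ v hv).rep := hc
  refine ⟨Projectivization.mk ℂ v hv, ?_⟩
  rw [degeneracyLocus, Set.mem_ofPred_eq, ← hc', rank_map_eval_smul hA c.ne_zero]
  rwa [← Matrix.submatrix_map, Matrix.rank_submatrix] at hr

/-- On x₃ = 0 every extension restricts to M, so both sets are cut out by rank at most two; no
genericity is involved. -/
theorem bijOn_planeEmb (hM : M ∈ symForms 3 1) (hY : IsSmoothHypersurface (cubicForm M))
    {N} (hN : N ∈ symForms 4 0) :
    Set.BijOn planeEmb {p | IsOrdinaryDoublePoint (n := 2) M.det p}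
      (degeneracyLocus (n := 3) 2 (extend M N) ∩ hyperplane) := by
  have hA := extend_mem M hM hN
  have hrep : ∀ p, ∃ c : ℂ, c ≠ 0 ∧ (planeEmb p).rep = c • affVec p.rep 0 := fun p => by
    have hne : planeLin p.rep ≠ 0 := by
      rw [planeLin_eq]
      exact affVec_ne_zero p.rep_nonzero
    obtain ⟨c, hc⟩ := Projectivization.exists_smul_eq_mk_rep ℂ (planeLin p.rep) hne
    have hp : planeEmb p = Projectivization.mk ℂ (planeLin p.rep) hne := by
      conv_lhs => rw [← p.mk_rep]
      rfl
    exact ⟨c, c.ne_zero, by rw [hp, ← hc, planeLin_eq]; rfl⟩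
  have hmem : ∀ p, IsOrdinaryDoublePoint (n := 2) M.det p ↔
      planeEmb p ∈ degeneracyLocus (n := 3) 2 (extend M N) := fun p => by
    obtain ⟨c, hc, hp⟩ := hrep p
    rw [degeneracyLocus, Set.mem_ofPred_eq, hp, rank_map_eval_smul hA hc, map_eval_extend_zero]
    exact isNodeAt_det_iff hM hY p.rep_nonzero
  refine ⟨fun p hp => ⟨(hmem p).1 hp, ?_⟩,
    (Projectivization.map_injective planeLin planeLin_injective).injOn, fun q hq => ?_⟩
  · obtain ⟨c, hc, hp⟩ := hrep p
    simp [hyperplane, hp]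
  · have hq3 : q.rep 3 = 0 := hq.2
    have hv : q.rep = planeLin fun m => q.rep m.castSucc := by
      rw [planeLin_eq, ← hq3]
      exact eq_affVec _
    have hne : (fun m => q.rep (Fin.castSucc m)) ≠ 0 := fun h0 => q.rep_nonzero (by
      rw [hv, h0, map_zero])
    have himg : planeEmb (Projectivization.mk ℂ _ hne) = q := by
      conv_rhs => rw [← q.mk_rep]
      simp only [planeEmb, Projectivization.map_mk, ← hv]
    refine ⟨_, (hmem _).2 ?_, himg⟩
    rw [himg]
    exact hq.1

end Loci

end CubicPlane

end

theorem mainTheorem3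
    (M : Matrix (Fin 3 ⊕ Unit) (Fin 3 ⊕ Unit) (MvPolynomial (Fin 3) ℂ))
    (hM : M ∈ CubicPlane.symForms 3 1)
    (hY : CubicPlane.IsSmoothHypersurface (CubicPlane.cubicForm M)) :
    CubicPlane.HoldsGenerically fun N : CubicPlane.symForms 4 0 =>
      CubicPlane.IsSmoothHypersurface (CubicPlane.cubicForm (CubicPlane.extend M N)) ∧
      CubicPlane.codim (CubicPlane.degeneracyLocus 2 (CubicPlane.extend M N)) = 3 ∧
      (CubicPlane.degeneracyLocus 2 (CubicPlane.extend M N)).Finite ∧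
      (∀ p ∈ CubicPlane.degeneracyLocus 2 (CubicPlane.extend M N),
        CubicPlane.IsOrdinaryDoublePoint (n := 3) (CubicPlane.extend M N).det p) ∧
      Set.BijOn CubicPlane.planeEmb
        {p | CubicPlane.IsOrdinaryDoublePoint (n := 2) M.det p}
        (CubicPlane.degeneracyLocus 2 (CubicPlane.extend M N) ∩ CubicPlane.hyperplane) := by
  refine (CubicPlane.holdsGenerically_isNodeAt hM hY).mono fun N hN => ?_
  obtain ⟨hsm, hnode⟩ := hN
  have hA := CubicPlane.extend_mem M hM N.2
  have hD : ∀ p ∈ CubicPlane.degeneracyLocus 2 (CubicPlane.extend M N),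
      CubicPlane.IsOrdinaryDoublePoint (n := 3) (CubicPlane.extend M N).det p :=
    fun p hp => hnode p.rep p.rep_nonzero hp
  -- Smoothness of the fivefold places every singular point of the surface in D₂, where all points
  -- are nodes; so the singular locus is finite, and it contains D₂.
  have hfin : (CubicPlane.degeneracyLocus (n := 3) 2 (CubicPlane.extend M N)).Finite :=
    (CubicPlane.finite_singular (n := 3) (CubicPlane.det_isHomogeneous hA) fun v hv h =>
      hnode v hv (CubicPlane.rank_le_two_of_pderiv_det_eq_zero hA hsm hv h)).subset
      fun p hp => (hD p hp).2.1
  exact ⟨hsm, CubicPlane.codim_eq_of_finite hfin (CubicPlane.degeneracyLocus_nonempty hA), hfin, hD,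
    CubicPlane.bijOn_planeEmb hM hY N.2⟩
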